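/- \textbf{Propagation of local equilibrium for the symmetric inclusion process.} Let $m>0$. The symmetric inclusion process SIP($m$) on $\Omega=\mathbb N^{\mathbb Z}$ ($\mathbb N\ni 0$) has the generator $$\mathcal L f(\eta)=\sum_{i\in\mathbb Z}\sum_{j\in\{i-1,i+1\}}\eta_i\Big(\frac m2+\eta_j\Big)\big(f(\eta-\delta_i+\delta_j)-f(\eta)\big);$$ a SIP($m$) started from $\mu$ is a càdlàg process with initial law $\mu$ which solves the martingale problem for $\mathcal L$ on functions $f$ of finitely many coordinates with at most polynomial growth (with $\mathcal L f(\eta(s))$ integrable over $[0,T]\times\{\text{sample space}\}$ for every $T$). For $\lambda:\mathbb Z\to[0,1)$ let $\nu_\lambda$ be the product measure on $\Omega$ with marginals $$\nu_{\lambda(i)}(n)=(1-\lambda(i))^{m/2}\,\frac{\lambda(i)^n}{n!}\,\frac{\Gamma(\frac m2+n)}{\Gamma(\frac m2)},\qquad n\in\mathbb N .$$ For a finite configuration $\xi$ put $D(\xi,\eta)=\prod_{i} d(\xi_i,\eta_i)$, where $d(k,n)=\frac{n!}{(n-k)!}\frac{\Gamma(m/2)}{\Gamma(m/2+k)}$ if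 $k\le n$ and $d(k,n)=0$ otherwise. A sequence of measures $\mu_N$ on $\Omega$ satisfies the local equilibrium property with profile $\pi:\mathbb R\to[0,1)$, written $\mu_N\approx\mathrm{LEP}(\pi)$, if for all $n$ and all $y_1,\dots,y_n\in\mathbb R$ the function $D\big(\sum_{i=1}^n\delta_{\lfloor Ny_i\rfloor},\cdot\big)$ is $\mu_N$-integrable for all large $N$ and $$\lim_{N\to\infty}\int D\Big(\sum_{i=1}^n\delta_{\lfloor Ny_i\rfloor},\eta\Big)\,\mu_N(d\eta)=\prod_{i=1}^n\frac{\pi(y_i)}{1-\pi(y_i)} .$$ Let $\pi:\mathbb R\to[0,1)$ be $C^\infty$, and let $\lambda_N:\mathbb Z\to[0,1)$ be profiles which correspond to $\pi$, i.e. $\nu_{\lambda_N}\approx\mathrm{LEP}(\pi)$. Assume that there are constants $C,a$ such that $$\frac{\lambda_N(i)}{1-\lambda_N(i)}\le C\,e^{a|i|/N}\qquad\text{for all } N\ge 1,\ i\in\mathbb Z .$$ For each $N\ge1$ let $(\eta^N(t))_{t\ge0}$ be a SIP($m$) started from $\nu_{\lambda_N}$. Then: (1) there is a function $\psi$, continuous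 on $[0,\infty)\times\mathbb R$, with $\psi(t,\cdot)\in C^2(\mathbb{R})$ for $t>0$ and with $|\psi(t,y)|\le C_Te^{a_T|y|}$ for $0\le t\le T$, $y\in\mathbb R$, for every $T$ and some constants $C_T,a_T$, which solves $$\partial_t\psi=\frac m2\,\partial_y^2\psi\quad(t>0),\qquad \psi(0,y)=\frac{\pi(y)}{1-\pi(y)};$$ (2) for every such $\psi$ and every $t\ge0$ one has $\psi(t,\cdot)\ge0$, and the law of $\eta^N(N^2t)$ satisfies the local equilibrium property with the profile $\pi_t=\psi(t,\cdot)/(1+\psi(t,\cdot))$, that is, for all $n$ and all $y_1,\dots,y_n\in\mathbb R$, $$\lim_{N\to\infty}\mathbb E\, D\Big(\sum_{i=1}^n\delta_{\lfloor Ny_i\rfloor},\eta^N(N^2t)\Big)=\prod_{i=1}^n\psi(t,y_i),$$ where these functions are integrable for all large $N$. -/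

import Mathlib

open MeasureTheory ProbabilityTheory Filter Topology
open scoped NNReal

noncomputable section

namespace InclusionProcess

/-- Particle configurations on `ℤ` (product topology of discrete spaces, product `σ`-algebra). -/
abbrev Config : Type := ℤ → ℕ

/-- `η^{ij} = η - δ_i + δ_j`; only used with a positive weight when there is a particle at `i`. -/
def move (η : Config) (i j : ℤ) : Config := η - Pi.single i 1 + Pi.single j 1

/-- The generator of the symmetric inclusion process with parameter `m` on `ℤ`.  For a function of
finitely many coordinates only finitely many terms of the sum are nonzero. -/
def generator (m : ℝ) (f : Config → ℝ) (η : Config) : ℝ :=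
  ∑' i : ℤ, ∑ j ∈ ({i - 1, i + 1} : Finset ℤ),
    (η i : ℝ) * (m / 2 + (η j : ℝ)) * (f (move η i j) - f η)

/-- Local functions of at most polynomial growth: `f` depends on finitely many coordinates only and
is bounded by a polynomial in them.  Bounded local functions and polynomials in finitely many of
the variables `η i` are of this kind. -/
def IsLocalPoly (f : Config → ℝ) : Prop :=
  ∃ Λ : Finset ℤ, (∀ η η' : Config, (∀ i ∈ Λ, η i = η' i) → f η = f η') ∧
    ∃ (C : ℝ) (k : ℕ), ∀ η : Config, |f η| ≤ C * (1 + ∑ i ∈ Λ, (η i : ℝ)) ^ k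

/-- `η` is a symmetric inclusion process with parameter `m` and initial distribution `μ`: it has
càdlàg paths and solves the martingale problem for the generator on local functions of polynomial
growth. -/
structure IsSIP {Ω : Type*} [mΩ : MeasurableSpace Ω] (m : ℝ) (μ : Measure Config)
    (P : Measure Ω) (η : ℝ≥0 → Ω → Config) : Prop where
  right_continuous : ∀ ω t, ContinuousWithinAt (fun s => η s ω) (Set.Ici t) t
  left_limits : ∀ ω t, ∃ ζ : Config, Tendsto (fun s => η s ω) (𝓝[<] t) (𝓝 ζ)
  initial : P.map (η 0) = μ
  martingale_problem : ∃ ℱ : Filtration ℝ≥0 mΩ, (∀ t, Measurable[ℱ t] (η t)) ∧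
    ∀ f : Config → ℝ, IsLocalPoly f →
      (∀ T : ℝ, Integrable (fun p : ℝ × Ω => generator m f (η p.1.toNNReal p.2))
        ((volume.restrict (Set.Icc 0 T)).prod P)) ∧
      Martingale (fun (t : ℝ≥0) ω =>
        f (η t ω) - ∫ s in (0 : ℝ)..t, generator m f (η s.toNNReal ω)) ℱ P

/-- The weights of the discrete Gamma (negative binomial) distribution with scale parameter `l`
and shape parameter `m / 2`. -/
def discreteGammaWeight (m l : ℝ) (n : ℕ) : ℝ :=
  (1 / (1 - l) ^ (-(m / 2))) * (l ^ n / (n.factorial : ℝ))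
    * (Real.Gamma (m / 2 + n) / Real.Gamma (m / 2))

/-- The discrete Gamma distribution on `ℕ`. -/
def discreteGamma (m l : ℝ) : Measure ℕ :=
  Measure.sum fun n => ENNReal.ofReal (discreteGammaWeight m l n) • Measure.dirac n

lemma Gamma_add_nat_div (a : ℝ) (ha : 0 < a) (n : ℕ) :
    Real.Gamma (a + n) / Real.Gamma a = (ascPochhammer ℝ n).eval a := by
  have h0 := (Real.Gamma_pos_of_pos ha).ne'
  induction n with
  | zero => simp [h0]
  | succ n ih =>
    rw [ascPochhammer_succ_eval, ← ih]
    push_cast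
    rw [← add_assoc, Real.Gamma_add_one (by positivity)]
    ring

lemma hasSum_discreteGammaWeight {m l : ℝ} (hm : 0 < m) (h0 : 0 ≤ l) (h1 : l < 1) :
    HasSum (discreteGammaWeight m l) 1 := by
  have hs := (Real.one_div_one_sub_rpow_hasFPowerSeriesOnBall_zero (m / 2)).hasSum
    (y := l) (by simp [Real.enorm_eq_ofReal h0, h1])
  have hpos : 0 < (1 - l) ^ (m / 2) := Real.rpow_pos_of_pos (by linarith) _
  have h2 := hs.mul_left ((1 - l) ^ (m / 2))
  rw [zero_add, mul_one_div_cancel hpos.ne'] at h2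
  refine Eq.mp (congrArg (fun g : ℕ → ℝ => HasSum g 1) (funext fun n => ?_).symm) h2
  have h3 : (ascPochhammer ℝ n).eval (m / 2)
      = (n.factorial : ℝ) * Ring.choose (m / 2 + n - 1) n := by
    have h4 := Ring.factorial_nsmul_multichoose_eq_ascPochhammer (m / 2) n
    rw [nsmul_eq_mul, Polynomial.ascPochhammer_smeval_eq_eval] at h4
    rw [← h4, Ring.choose]
    congr 2
    ring
  have hf : (n.factorial : ℝ) ≠ 0 := by positivity
  rw [discreteGammaWeight, Gamma_add_nat_div _ (by positivity), h3,
    Real.rpow_neg (by linarith)]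
  simp
  field_simp

lemma discreteGammaWeight_nonneg {m l : ℝ} (hm : 0 < m) (h0 : 0 ≤ l) (h1 : l < 1) (n : ℕ) :
    0 ≤ discreteGammaWeight m l n := by
  have := Real.Gamma_pos_of_pos (show 0 < m / 2 by positivity)
  have := Real.Gamma_pos_of_pos (show 0 < m / 2 + n by positivity)
  have := Real.rpow_pos_of_pos (show 0 < 1 - l by linarith) (-(m / 2))
  unfold discreteGammaWeight
  positivity

lemma isProbabilityMeasure_discreteGamma {m l : ℝ} (hm : 0 < m) (h0 : 0 ≤ l) (h1 : l < 1) :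
    IsProbabilityMeasure (discreteGamma m l) := by
  have h := hasSum_discreteGammaWeight hm h0 h1
  constructor
  rw [discreteGamma, Measure.sum_apply _ MeasurableSet.univ]
  simp only [Measure.smul_apply, measure_univ, smul_eq_mul, mul_one]
  rw [← ENNReal.ofReal_tsum_of_nonneg (discreteGammaWeight_nonneg hm h0 h1) h.summable,
    h.tsum_eq, ENNReal.ofReal_one]

/-- The product measure on `Config` with discrete Gamma marginals of scale parameters `l i`. -/
def localGamma (m : ℝ) (l : ℤ → ℝ) : Measure Config :=
  Measure.infinitePi fun i => discreteGamma m (l i)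

/-- The single-site duality polynomial `n! / (n - k)! * Γ(m/2) / Γ(m/2 + k)`, equal to `0` for
`k > n`. -/
def dualitySingle (m : ℝ) (k n : ℕ) : ℝ :=
  if k ≤ n then (n.factorial : ℝ) / ((n - k).factorial : ℝ)
    * (Real.Gamma (m / 2) / Real.Gamma (m / 2 + k)) else 0

/-- The duality function `D(ξ, η) = ∏ i, d(ξ i, η i)` for a finite configuration `ξ`; the factors
with `ξ i = 0` are equal to `1`. -/
def duality (m : ℝ) (ξ : ℤ →₀ ℕ) (η : Config) : ℝ :=
  ∏ i ∈ ξ.support, dualitySingle m (ξ i) (η i)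

/-- The finite configuration `∑ i, δ_{x i}`. -/
def pointConfig {n : ℕ} (x : Fin n → ℤ) : ℤ →₀ ℕ := ∑ i, Finsupp.single (x i) 1

/-- The local equilibrium property with profile `p` of a sequence of measures `μ N` on `Config`:
all duality functions at the points `⌊N y i⌋` are (eventually) integrable, and their integrals
converge to `∏ i, p (y i) / (1 - p (y i))`. -/
def LocalEquilibrium (m : ℝ) (μ : ℕ → Measure Config) (p : ℝ → ℝ) : Prop :=
  ∀ (n : ℕ) (y : Fin n → ℝ),
    (∀ᶠ N : ℕ in atTop,
      Integrable (duality m (pointConfig fun i => ⌊(N : ℝ) * y i⌋)) (μ N)) ∧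
    Tendsto (fun N : ℕ => ∫ η, duality m (pointConfig fun i => ⌊(N : ℝ) * y i⌋) η ∂(μ N)) atTop
      (𝓝 (∏ i, p (y i) / (1 - p (y i))))

/-- The profiles `l N` correspond to the macro profile `p`. -/
def Corresponds (m : ℝ) (l : ℕ → ℤ → ℝ) (p : ℝ → ℝ) : Prop :=
  LocalEquilibrium m (fun N => localGamma m (l N)) p

/-- `ψ` is a classical solution on `[0, ∞) × ℝ` of `∂_t ψ = κ ∂_y² ψ`, `ψ(0, ·) = φ`, in the class
of functions that grow at most exponentially in `y`, locally uniformly in `t` (a class in which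
solutions are unique). -/
structure IsDiffusionSolution (κ : ℝ) (φ : ℝ → ℝ) (ψ : ℝ → ℝ → ℝ) : Prop where
  continuousOn : ContinuousOn (fun q : ℝ × ℝ => ψ q.1 q.2) (Set.Ici 0 ×ˢ Set.univ)
  initial : ∀ y, ψ 0 y = φ y
  contDiff_space : ∀ t, 0 < t → ContDiff ℝ 2 (ψ t)
  equation : ∀ t y, 0 < t →
    HasDerivAt (fun s => ψ s y) (κ * iteratedDeriv 2 (ψ t) y) t
  growth : ∀ T : ℝ, ∃ C a : ℝ, ∀ t ∈ Set.Icc 0 T, ∀ y, |ψ t y| ≤ C * Real.exp (a * |y|)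

end InclusionProcess

end

/-! Duality reduces the infinite system to finitely many particles. The generator acting on `D(ξ,
·)` equals the inclusion generator acting on `ξ` (`generator_duality`), so the expectations F(s, x)
of the duality functions at n labelled points solve a closed linear equation
(`IsSIP.isNonnegSolution`): every label walks at rate m/2 in each direction and, in addition, jumps
at rate 1 onto the site of each label next to it. For n = 1 the attraction disappears and u(s, a)
solves the discrete heat equation. The initial law is a product measure, hence F(0, x) = ∏ u(0,
x_i). It remains to show that F − ∏ u tends to zero on the diffusive scale and that u converges to
the heat flow.

Factorization. The attraction applied to ∏ u(x_i) gives half the sum, over ordered pairs of labels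
on neighbouring sites, of (u(x_l) − u(x_k))² times the other factors (`attractOp_prod`). This is
nonnegative, so F ≥ ∏ u (`prod_le_correlation`). For the converse, Bernstein's estimate
(`IsNonnegSolution.gradient_sq_le`) bounds the squared gradient by O(1/s). Since 1/s is not
integrable at infinity, it must also be used that two labels are rarely adjacent. This is the
content of the explicit barrier `exists_pair_barrier`: a source of size s^(-3/4) acting only at
distance one produces a contribution that still decays like a negative power of s. The spatial
growth of u is carried by cosh weights, and `exists_decorrelation` combines the two.

Hydrodynamic limit of u. The hypothesis provides convergence of the initial values only at ⌊Ny⌋ for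
each fixed y. Dominated convergence upgrades this to uniform closeness of averages over blocks of εN
sites (`eventually_blockAvg_close`). Block averages solve the same discrete equation and are
compared with the Gaussian solution by a Taylor estimate; at time N²t the gradient bound removes the
averaging (`tendsto_scaled_walk`).

Comparison. All these arguments rest on a comparison principle, but the correlations are only known
to be nonnegative; no spatial growth bound is given at positive times. A Harnack inequality shows
that a nonnegative solution grows at most like B^k k! along k jumps (`IsNonnegSolution.growth`), and
comparison holds exactly in such a class because k jumps within time T have probability at most
(RT)^k / k! (`IsSubsolution.nonpos`). On the macroscopic side, a maximum principle gives ψ ≥ 0 and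
identifies every admissible ψ with the Gaussian one. -/

namespace InclusionProcess

/-! ### Jump operators with bounded rates and their comparison principle -/

/-- The jump operator with rates `r i` and moves `σ i`. -/
def jumpOp {X I : Type*} [Fintype I] (r : I → X → ℝ) (σ : I → X → X) (f : X → ℝ) (x : X) : ℝ :=
  ∑ i, r i x * (f (σ i x) - f x)

/-- The endpoint of the path that starts at `x` and makes the moves in the list. -/
abbrev pathEnd {X I : Type*} (σ : I → X → X) (l : List I) (x : X) : X :=
  l.foldl (fun y i => σ i y) x

/-- `w` is a subsolution on `[0, T]` of the evolution equation of a jump operator. -/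
structure IsSubsolution {X I : Type*} [Fintype I] (r : I → X → ℝ) (σ : I → X → X) (T : ℝ)
    (w : ℝ → X → ℝ) : Prop where
  cont : ∀ x, ContinuousOn (fun s => w s x) (Set.Icc 0 T)
  deriv : ∀ x, ∀ s ∈ Set.Ioo 0 T, ∃ w', HasDerivAt (fun s => w s x) w' s ∧
    w' ≤ jumpOp r σ (w s) x

section comparison

variable {X I : Type*} [Fintype I] {r : I → X → ℝ} {σ : I → X → X} {R T : ℝ} {w : ℝ → X → ℝ}

/-- A value at the end of a path of length `k` is felt at `x` only if `k` jumps occur before time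
`s`, an event of probability at most `(R s) ^ k / k!`. The induction peels off the first jump: the
bound of order `k` at the neighbours acts as a source whose primitive is the bound of order `k + 1`.
-/
lemma IsSubsolution.le_pow_div_factorial (hr : ∀ i x, 0 ≤ r i x) (hR : ∀ x, ∑ i, r i x ≤ R)
    (hw : IsSubsolution r σ T w) (h0 : ∀ x, w 0 x ≤ 0) {M : ℝ} (hM : 0 ≤ M) (k : ℕ) :
    ∀ x, (∀ l : List I, l.length = k → ∀ s ∈ Set.Icc 0 T, w s (pathEnd σ l x) ≤ M) →
      ∀ s ∈ Set.Icc 0 T, w s x ≤ M * ((R * s) ^ k / (k.factorial : ℝ)) := by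
  induction k with
  | zero => intro x hx s hs; simpa using hx [] rfl s hs
  | succ k ih =>
    intro x hx s hs
    have hR0 : 0 ≤ R := (Finset.sum_nonneg fun i _ => hr i x).trans (hR x)
    have hi : ∀ i, ∀ s ∈ Set.Icc 0 T, w s (σ i x) ≤ M * ((R * s) ^ k / (k.factorial : ℝ)) := by
      intro i
      apply ih
      intro l hl
      exact hx (i :: l) (by simp [hl])
    set ρ := ∑ i, r i x with hρ
    have hρ0 : 0 ≤ ρ := Finset.sum_nonneg fun i _ => hr i x
    set q : ℝ → ℝ := fun s => M * ((R * s) ^ (k + 1) / ((k + 1).factorial : ℝ)) with hq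
    have hqd : ∀ s, HasDerivAt q (M * (R * ((R * s) ^ k / (k.factorial : ℝ)))) s := by
      intro s
      have h1 := ((((hasDerivAt_id s).const_mul R).pow (k + 1)).div_const
        ((k + 1).factorial : ℝ)).const_mul M
      refine h1.congr_deriv ?_
      simp only [id, Nat.factorial_succ, Nat.cast_mul, Nat.add_sub_cancel]
      have : (k.factorial : ℝ) ≠ 0 := by positivity
      have : ((k + 1 : ℕ) : ℝ) ≠ 0 := by positivity
      field_simp
    -- With the integrating factor `exp (ρ s)`, `ρ` being the total rate at `x`, it suffices that
    -- `(w - q)' + ρ (w - q) ≤ -ρ q ≤ 0`.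
    have hanti : AntitoneOn (fun s => Real.exp (ρ * s) * (w s x - q s)) (Set.Icc 0 T) := by
      have hcq : Continuous q := by fun_prop
      choose! w' hw' hw'' using hw.deriv x
      have hder : ∀ s ∈ Set.Ioo 0 T, HasDerivAt (fun s => Real.exp (ρ * s) * (w s x - q s))
          (Real.exp (ρ * s) * ρ * (w s x - q s) + Real.exp (ρ * s) *
            (w' s - M * (R * ((R * s) ^ k / (k.factorial : ℝ))))) s := by
        intro s hs
        have h1 : HasDerivAt (fun s => Real.exp (ρ * s)) (Real.exp (ρ * s) * ρ) s := by
          simpa using ((hasDerivAt_id s).const_mul ρ).exp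
        exact h1.mul ((hw' s hs).sub (hqd s))
      apply antitoneOn_of_deriv_nonpos (convex_Icc 0 T)
      · exact (Continuous.continuousOn (by fun_prop)).mul ((hw.cont x).sub hcq.continuousOn)
      · intro s hs
        rw [interior_Icc] at hs
        exact (hder s hs).differentiableAt.differentiableWithinAt
      · intro s hs
        rw [interior_Icc] at hs
        rw [(hder s hs).deriv]
        have hs' : s ∈ Set.Icc 0 T := ⟨hs.1.le, hs.2.le⟩
        have hp : 0 ≤ M * ((R * s) ^ k / (k.factorial : ℝ)) := by
          have := mul_nonneg hR0 hs.1.le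
          positivity
        have hq0 : 0 ≤ q s := by
          have := mul_nonneg hR0 hs.1.le
          simp only [hq]; positivity
        have h1 := hw'' s hs
        have h2 : jumpOp r σ (w s) x ≤ R * (M * ((R * s) ^ k / (k.factorial : ℝ))) - ρ * w s x := by
          unfold jumpOp
          simp only [mul_sub, Finset.sum_sub_distrib, ← Finset.sum_mul]
          gcongr
          calc ∑ i, r i x * w s (σ i x)
              ≤ ∑ i, r i x * (M * ((R * s) ^ k / (k.factorial : ℝ))) :=
                Finset.sum_le_sum fun i _ => mul_le_mul_of_nonneg_left (hi i s hs') (hr i x)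
            _ ≤ _ := by rw [← Finset.sum_mul]; exact mul_le_mul_of_nonneg_right (hR x) hp
        have he := Real.exp_pos (ρ * s)
        have h3 : ρ * (w s x - q s) + (w' s - M * (R * ((R * s) ^ k / (k.factorial : ℝ)))) ≤ 0 := by
          have := mul_nonneg hρ0 hq0
          linarith
        have := mul_nonpos_of_nonneg_of_nonpos he.le h3
        linarith
    have h := hanti ⟨le_rfl, hs.1.trans hs.2⟩ hs hs.1
    have hq00 : q 0 = 0 := by simp [hq]
    simp only [hq00, mul_zero, Real.exp_zero, one_mul, sub_zero] at h
    have h2 := h.trans (h0 x)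
    have : w s x - q s ≤ 0 := le_of_mul_le_mul_left (by simpa using h2) (Real.exp_pos (ρ * s))
    linarith

/-- The factorials cancel: growth `A B ^ k k!` against `(R s) ^ k / k!` leaves a multiple of `(R T
B) ^ k`, which tends to zero for short times. -/
lemma IsSubsolution.nonpos_of_small (hr : ∀ i x, 0 ≤ r i x) (hR : ∀ x, ∑ i, r i x ≤ R)
    (hw : IsSubsolution r σ T w) (h0 : ∀ x, w 0 x ≤ 0) {B : ℝ} (hB : 0 ≤ B)
    (hg : ∀ x, ∃ A, ∀ l : List I, ∀ s ∈ Set.Icc 0 T,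
      w s (pathEnd σ l x) ≤ A * B ^ l.length * (l.length.factorial : ℝ))
    (hT : R * T * B < 1) (x : X) {s : ℝ} (hs : s ∈ Set.Icc 0 T) : w s x ≤ 0 := by
  obtain ⟨A, hA⟩ := hg x
  have hR0 : 0 ≤ R := (Finset.sum_nonneg fun i _ => hr i x).trans (hR x)
  have hT0 : 0 ≤ T := hs.1.trans hs.2
  have key : ∀ k : ℕ, w s x ≤ |A| * (R * T * B) ^ k := by
    intro k
    have h1 := hw.le_pow_div_factorial hr hR h0
      (M := |A| * B ^ k * (k.factorial : ℝ)) (by positivity) k x ?_ s hs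
    · refine h1.trans ?_
      have hk : (k.factorial : ℝ) ≠ 0 := by positivity
      calc |A| * B ^ k * (k.factorial : ℝ) * ((R * s) ^ k / (k.factorial : ℝ))
          = |A| * (R * s * B) ^ k := by rw [mul_pow _ B]; field_simp
        _ ≤ _ := by
          have : 0 ≤ R * s * B := mul_nonneg (mul_nonneg hR0 hs.1) hB
          gcongr
          exact hs.2
    · intro l hl s hs
      refine (hA l s hs).trans ?_
      rw [hl]
      gcongr
      exact le_abs_self A
  have hlim : Tendsto (fun k : ℕ => |A| * (R * T * B) ^ k) atTop (𝓝 (|A| * 0)) :=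
    (tendsto_pow_atTop_nhds_zero_of_lt_one (by positivity) hT).const_mul _
  rw [mul_zero] at hlim
  exact ge_of_tendsto' hlim key

/-- Comparison principle for the evolution equation of a jump operator with bounded rates, in the
class of functions which grow at most like `B ^ k * k!` along paths of length `k`. -/
theorem IsSubsolution.nonpos (hr : ∀ i x, 0 ≤ r i x) (hR : ∀ x, ∑ i, r i x ≤ R)
    (hw : IsSubsolution r σ T w) (h0 : ∀ x, w 0 x ≤ 0) {B : ℝ} (hB : 0 ≤ B)
    (hg : ∀ x, ∃ A, ∀ l : List I, ∀ s ∈ Set.Icc 0 T,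
      w s (pathEnd σ l x) ≤ A * B ^ l.length * (l.length.factorial : ℝ))
    (x : X) {s : ℝ} (hs : s ∈ Set.Icc 0 T) : w s x ≤ 0 := by
  have hT0 : 0 ≤ T := hs.1.trans hs.2
  obtain ⟨n, hn⟩ := exists_nat_gt (R * T * B)
  have hn0 : 0 < n + 1 := Nat.succ_pos n
  -- Time is cut into steps with `R τ B < 1`. The growth constants hold on the whole of `[0, T]`, so
  -- the short-time statement can be restarted after each step.
  set τ := T / (n + 1 : ℕ) with hτ
  have hτ0 : 0 ≤ τ := by positivity
  have hsmall : R * τ * B < 1 := by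
    have hc : (0 : ℝ) < (n + 1 : ℕ) := by exact_mod_cast hn0
    rw [hτ, show R * (T / (n + 1 : ℕ)) * B = R * T * B / (n + 1 : ℕ) by ring, div_lt_one hc]
    push_cast
    linarith
  have hnτ : ((n + 1 : ℕ) : ℝ) * τ = T := by
    rw [hτ]; field_simp
  have key : ∀ j : ℕ, j ≤ n + 1 → ∀ x, ∀ s ∈ Set.Icc 0 (j * τ), w s x ≤ 0 := by
    intro j
    induction j with
    | zero =>
      intro _ x s hs
      have : s = 0 := le_antisymm (by simpa using hs.2) hs.1
      rw [this]; exact h0 x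
    | succ j ih =>
      intro hj x s hs
      have hjτ : 0 ≤ j * τ := by positivity
      have hle : j * τ + τ ≤ T := by
        rw [← hnτ]
        have : ((j : ℝ) + 1) ≤ (n + 1 : ℕ) := by exact_mod_cast hj
        nlinarith
      rcases le_total s (j * τ) with h | h
      · exact ih (by omega) x s ⟨hs.1, h⟩
      · have hsub : IsSubsolution r σ τ (fun s x => w (s + j * τ) x) := by
          constructor
          · intro x
            refine (hw.cont x).comp (Continuous.continuousOn (by fun_prop)) ?_
            intro s hs
            exact ⟨by linarith [hs.1], by linarith [hs.2]⟩
          · intro x s hs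
            obtain ⟨w', h1, h2⟩ := hw.deriv x (s + j * τ)
              ⟨by linarith [hs.1], by linarith [hs.2]⟩
            exact ⟨w', h1.comp_add_const s (j * τ), h2⟩
        have h1 := hsub.nonpos_of_small hr hR (fun x => by
          simpa using ih (by omega) x (j * τ) ⟨hjτ, le_rfl⟩) hB (fun x => ?_) hsmall x
          (s := s - j * τ) ⟨by linarith, by have := hs.2; push_cast at this; linarith⟩
        · simpa using h1
        · obtain ⟨A, hA⟩ := hg x
          exact ⟨A, fun l s hs => hA l _ ⟨by linarith [hs.1], by linarith [hs.2]⟩⟩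
  exact key (n + 1) le_rfl x s ⟨hs.1, by rw [hnτ]; exact hs.2⟩

end comparison

/-! ### Harnack inequality and a priori growth of nonnegative solutions -/

/-- A nonnegative solution on `[0, ∞)` of the evolution equation of a jump operator. -/
structure IsNonnegSolution {X I : Type*} [Fintype I] (r : I → X → ℝ) (σ : I → X → X)
    (F : ℝ → X → ℝ) : Prop where
  nonneg : ∀ s x, 0 ≤ F s x
  cont : ∀ x, ContinuousOn (fun s => F s x) (Set.Ici 0)
  deriv : ∀ x s, 0 < s → HasDerivAt (fun s => F s x) (jumpOp r σ (F s) x) s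

section harnack

variable {X I : Type*} [Fintype I] {r : I → X → ℝ} {σ : I → X → X} {R c : ℝ} {F : ℝ → X → ℝ}

/-- Nonnegativity allows gain terms to be dropped: `exp (R t) F` is nondecreasing at every site, and
at `x` it receives at least `c` times its value at `σ i x` per unit time, during the time `δ`. -/
lemma IsNonnegSolution.harnack_step (hc : 0 < c) (hr : ∀ i x, c ≤ r i x)
    (hR : ∀ x, ∑ i, r i x ≤ R) (hF : IsNonnegSolution r σ F) {s δ : ℝ} (hs : 0 ≤ s) (hδ : 0 < δ)
    (i : I) (x : X) : F s (σ i x) ≤ Real.exp (R * δ) / (c * δ) * F (s + δ) x := by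
  have hr0 : ∀ i x, 0 ≤ r i x := fun i x => hc.le.trans (hr i x)
  have hterm : ∀ (ρ : ℝ) (z : X) (t : ℝ), 0 < t → HasDerivAt (fun s => Real.exp (ρ * s) * F s z)
      (Real.exp (ρ * t) * (ρ * F t z + jumpOp r σ (F t) z)) t := by
    intro ρ z t ht
    have h1 : HasDerivAt (fun s => Real.exp (ρ * s)) (Real.exp (ρ * t) * ρ) t := by
      simpa using ((hasDerivAt_id t).const_mul ρ).exp
    exact (h1.mul (hF.deriv z t ht)).congr_deriv (by ring)
  have hop : ∀ (z : X) (t : ℝ), ∑ i, r i z * F t (σ i z) ≤ R * F t z + jumpOp r σ (F t) z := by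
    intro z t
    have h := mul_le_mul_of_nonneg_right (hR z) (hF.nonneg t z)
    unfold jumpOp
    simp only [mul_sub, Finset.sum_sub_distrib, ← Finset.sum_mul]
    linarith
  have hcont : ∀ (ρ : ℝ) (z : X) , ContinuousOn (fun s => Real.exp (ρ * s) * F s z) (Set.Ici 0) :=
    fun ρ z => (Continuous.continuousOn (by fun_prop)).mul (hF.cont z)
  have hmono : ∀ z : X, MonotoneOn (fun s => Real.exp (R * s) * F s z) (Set.Ici 0) := by
    intro z
    apply monotoneOn_of_deriv_nonneg (convex_Ici 0) (hcont R z)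
    · intro t ht
      rw [interior_Ici] at ht
      exact (hterm R z t ht).differentiableAt.differentiableWithinAt
    · intro t ht
      rw [interior_Ici] at ht
      rw [(hterm R z t ht).deriv]
      have h1 := hop z t
      have h2 : 0 ≤ ∑ i, r i z * F t (σ i z) :=
        Finset.sum_nonneg fun i _ => mul_nonneg (hr0 i z) (hF.nonneg t _)
      exact mul_nonneg (Real.exp_pos _).le (h2.trans h1)
  set a := Real.exp (R * s) * F s (σ i x) with ha
  have hmono2 : MonotoneOn (fun t => Real.exp (R * t) * F t x - c * a * t) (Set.Icc s (s + δ)) := by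
    have hsub : Set.Icc s (s + δ) ⊆ Set.Ici (0 : ℝ) := fun t ht => hs.trans ht.1
    have hd : ∀ t, 0 < t → HasDerivAt (fun t => Real.exp (R * t) * F t x - c * a * t)
        (Real.exp (R * t) * (R * F t x + jumpOp r σ (F t) x) - c * a) t := by
      intro t ht
      exact ((hterm R x t ht).sub ((hasDerivAt_id t).const_mul (c * a))).congr_deriv (by simp)
    apply monotoneOn_of_deriv_nonneg (convex_Icc _ _)
    · exact ((hcont R x).mono hsub).sub (Continuous.continuousOn (by fun_prop))
    · intro t ht
      rw [interior_Icc] at ht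
      exact (hd t (hs.trans_lt ht.1)).differentiableAt.differentiableWithinAt
    · intro t ht
      rw [interior_Icc] at ht
      rw [(hd t (hs.trans_lt ht.1)).deriv]
      have h1 := hop x t
      have h2 : r i x * F t (σ i x) ≤ ∑ i, r i x * F t (σ i x) :=
        Finset.single_le_sum (f := fun i => r i x * F t (σ i x))
          (fun i _ => mul_nonneg (hr0 i x) (hF.nonneg t _)) (Finset.mem_univ i)
      have h3 : c * F t (σ i x) ≤ r i x * F t (σ i x) :=
        mul_le_mul_of_nonneg_right (hr i x) (hF.nonneg t _)
      have h4 : a ≤ Real.exp (R * t) * F t (σ i x) :=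
        hmono (σ i x) hs (hs.trans ht.1.le : (0 : ℝ) ≤ t) ht.1.le
      have he := Real.exp_pos (R * t)
      have h5 := mul_le_mul_of_nonneg_left h4 hc.le
      have h6 := mul_le_mul_of_nonneg_left (h3.trans (h2.trans h1)) he.le
      linarith
  have h := hmono2 ⟨le_rfl, by linarith⟩ ⟨by linarith, le_rfl⟩ (by linarith : s ≤ s + δ)
  have hpos : 0 ≤ Real.exp (R * s) * F s x := mul_nonneg (Real.exp_pos _).le (hF.nonneg _ _)
  have h7 : c * δ * a ≤ Real.exp (R * (s + δ)) * F (s + δ) x := by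
    simp only at h
    linarith
  rw [ha, mul_add, Real.exp_add] at h7
  have he := Real.exp_pos (R * s)
  have h8 : c * δ * F s (σ i x) ≤ Real.exp (R * δ) * F (s + δ) x := by
    refine le_of_mul_le_mul_left ?_ he
    linarith
  rw [div_mul_eq_mul_div, le_div_iff₀ (by positivity)]
  linarith

lemma IsNonnegSolution.harnack (hc : 0 < c) (hr : ∀ i x, c ≤ r i x)
    (hR : ∀ x, ∑ i, r i x ≤ R) (hF : IsNonnegSolution r σ F) {δ : ℝ} (hδ : 0 < δ)
    (l : List I) : ∀ (x : X) (s : ℝ), 0 ≤ s → F s (pathEnd σ l x) ≤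
      (Real.exp (R * δ) / (c * δ)) ^ l.length * F (s + l.length * δ) x := by
  induction l with
  | nil => intro x s _; simp
  | cons i l ih =>
    intro x s hs
    have h1 := ih (σ i x) s hs
    have h2 := hF.harnack_step hc hr hR (s := s + l.length * δ) (by positivity) hδ i x
    have h0 : 0 ≤ Real.exp (R * δ) / (c * δ) := by positivity
    calc F s (pathEnd σ (i :: l) x) = F s (pathEnd σ l (σ i x)) := rfl
      _ ≤ _ := h1
      _ ≤ _ := mul_le_mul_of_nonneg_left h2 (pow_nonneg h0 _)
      _ = _ := by
        rw [List.length_cons, pow_succ, mul_assoc]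
        push_cast
        ring_nf

lemma pow_self_le_exp_mul_factorial (k : ℕ) :
    (k : ℝ) ^ k ≤ Real.exp 1 ^ k * (k.factorial : ℝ) := by
  have h := Real.pow_div_factorial_le_exp (k : ℝ) (by positivity) k
  rw [div_le_iff₀ (by positivity)] at h
  simpa [← Real.exp_nat_mul] using h

/-- A nonnegative solution grows at most like `B ^ k * k!` along paths of length `k`. -/
theorem IsNonnegSolution.growth (hc : 0 < c) (hr : ∀ i x, c ≤ r i x)
    (hR : ∀ x, ∑ i, r i x ≤ R) (hF : IsNonnegSolution r σ F) (T : ℝ) (x : X) :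
    ∃ A, ∀ l : List I, ∀ s ∈ Set.Icc 0 T,
      F s (pathEnd σ l x) ≤ A * (Real.exp 1 / c) ^ l.length * (l.length.factorial : ℝ) := by
  have hsub : Set.Icc 0 (T + 1) ⊆ Set.Ici (0 : ℝ) := fun t ht => ht.1
  obtain ⟨M, hM⟩ := isCompact_Icc.bddAbove_image ((hF.cont x).mono hsub)
  have hM' : ∀ t ∈ Set.Icc 0 (T + 1), F t x ≤ |M| := fun t ht =>
    (hM (Set.mem_image_of_mem _ ht)).trans (le_abs_self M)
  refine ⟨Real.exp |R| * |M|, ?_⟩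
  intro l s hs
  rcases Nat.eq_zero_or_pos l.length with h0 | hpos
  · obtain rfl := List.length_eq_zero_iff.1 h0
    have h1 := hM' s ⟨hs.1, by linarith [hs.2]⟩
    have h2 : 1 ≤ Real.exp |R| := Real.one_le_exp (abs_nonneg R)
    have h3 : |M| ≤ Real.exp |R| * |M| := le_mul_of_one_le_left (abs_nonneg M) h2
    simpa using h1.trans h3
  · set k := l.length with hk
    have hk0 : (0 : ℝ) < k := by exact_mod_cast hpos
    -- A waiting time `1 / k` per jump keeps the total extra time equal to one for every path
    -- length; the price `k ^ k` is at most `e ^ k * k!`.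
    have h1 := hF.harnack hc hr hR (δ := 1 / k) (by positivity) l x s hs.1
    have h2 := hM' (s + k * (1 / k)) ⟨by have := hs.1; positivity, by
      rw [mul_one_div_cancel hk0.ne']; linarith [hs.2]⟩
    have h3 : (Real.exp (R * (1 / k)) / (c * (1 / k))) ^ k = Real.exp R * ((k : ℝ) ^ k / c ^ k) := by
      rw [div_pow, ← Real.exp_nat_mul, mul_pow, one_div, inv_pow]
      field_simp
    rw [h3] at h1
    have h4 := pow_self_le_exp_mul_factorial k
    calc F s (pathEnd σ l x) ≤ Real.exp R * ((k : ℝ) ^ k / c ^ k) * |M| :=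
          h1.trans (mul_le_mul_of_nonneg_left h2 (by positivity))
      _ ≤ Real.exp |R| * ((Real.exp 1 ^ k * (k.factorial : ℝ)) / c ^ k) * |M| := by
          gcongr
          exact le_abs_self R
      _ = _ := by rw [div_pow]; ring

end harnack

/-! ### Single-site relations for the duality polynomials -/

section singleSite

variable {m : ℝ}

lemma dualitySingle_eq (m : ℝ) (k n : ℕ) : dualitySingle m k n =
    (n.descFactorial k : ℝ) * (Real.Gamma (m / 2) / Real.Gamma (m / 2 + k)) := by
  unfold dualitySingle
  split_ifs with h
  · rw [Nat.descFactorial_eq_div h, Nat.cast_div (Nat.factorial_dvd_factorial (Nat.sub_le n k))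
      (by positivity)]
  · rw [Nat.descFactorial_of_lt (not_le.1 h)]; simp

lemma dualitySingle_zero (hm : 0 < m) (n : ℕ) : dualitySingle m 0 n = 1 := by
  have := (Real.Gamma_pos_of_pos (show 0 < m / 2 by positivity)).ne'
  simp [dualitySingle_eq, this]

lemma dualitySingle_nonneg (hm : 0 < m) (k n : ℕ) : 0 ≤ dualitySingle m k n := by
  have := Real.Gamma_pos_of_pos (show 0 < m / 2 by positivity)
  have := Real.Gamma_pos_of_pos (show 0 < m / 2 + k by positivity)
  rw [dualitySingle_eq]
  positivity

lemma Gamma_div_succ (hm : 0 < m) (k : ℕ) :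
    (m / 2 + k) * (Real.Gamma (m / 2) / Real.Gamma (m / 2 + (k + 1 : ℕ))) =
      Real.Gamma (m / 2) / Real.Gamma (m / 2 + k) := by
  have h1 := (Real.Gamma_pos_of_pos (show 0 < m / 2 + k by positivity)).ne'
  have h2 : m / 2 + (k : ℝ) ≠ 0 := by positivity
  push_cast
  rw [← add_assoc, Real.Gamma_add_one h2]
  field_simp

lemma cast_mul_descFactorial (n k : ℕ) :
    (n : ℝ) * (n.descFactorial k : ℝ) = n.descFactorial (k + 1) + k * n.descFactorial k := by
  rw [Nat.descFactorial_succ]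
  rcases le_or_gt k n with h | h
  · push_cast [Nat.cast_sub h]; ring
  · rw [Nat.descFactorial_of_lt h]; simp

/-- This identity and the next two translate removing, counting and adding a particle in `n` into
operations on `k`; they are the `su(1,1)` relations behind self-duality. The truncated `n - 1` at `n
= 0` is harmless because of the factor `n`. -/
lemma mul_dualitySingle_sub_one (hm : 0 < m) (k n : ℕ) :
    (n : ℝ) * dualitySingle m k (n - 1) = (m / 2 + k) * dualitySingle m (k + 1) n := by
  rw [dualitySingle_eq, dualitySingle_eq, mul_left_comm (m / 2 + k : ℝ), Gamma_div_succ hm,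
    ← mul_assoc]
  congr 1
  cases n with
  | zero => simp
  | succ n => rw [Nat.succ_descFactorial_succ]; push_cast; simp

lemma mul_dualitySingle (hm : 0 < m) (k n : ℕ) : (n : ℝ) * dualitySingle m k n =
    (m / 2 + k) * dualitySingle m (k + 1) n + k * dualitySingle m k n := by
  rw [dualitySingle_eq, dualitySingle_eq, mul_left_comm (m / 2 + k : ℝ), Gamma_div_succ hm,
    ← mul_assoc, cast_mul_descFactorial]
  ring

lemma mul_dualitySingle_add_one (hm : 0 < m) (k n : ℕ) :
    (m / 2 + n) * dualitySingle m k (n + 1) = (m / 2 + k) * dualitySingle m (k + 1) n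
      + (m / 2 + 2 * k) * dualitySingle m k n + k * dualitySingle m (k - 1) n := by
  have h0 := mul_dualitySingle hm k n
  cases k with
  | zero =>
    simp only [dualitySingle_zero hm] at h0 ⊢
    push_cast at h0 ⊢
    linarith
  | succ q =>
    have h1 := mul_dualitySingle hm q n
    -- Pascal's rule for falling factorials: `(n+1)_(q+1) = (n)_(q+1) + (q+1) (n)_q`.
    have h2 : dualitySingle m (q + 1) (n + 1) = dualitySingle m (q + 1) n +
        (q + 1) * (n.descFactorial q *
          (Real.Gamma (m / 2) / Real.Gamma (m / 2 + (q + 1 : ℕ)))) := by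
      rw [dualitySingle_eq, dualitySingle_eq, Nat.succ_descFactorial_succ]
      have := cast_mul_descFactorial n q
      push_cast
      linear_combination (Real.Gamma (m / 2) / Real.Gamma (m / 2 + (q + 1))) * this
    have h3 : (m / 2 + q) * (n.descFactorial q *
          (Real.Gamma (m / 2) / Real.Gamma (m / 2 + (q + 1 : ℕ)))) = dualitySingle m q n := by
      rw [dualitySingle_eq, mul_left_comm, Gamma_div_succ hm]
    have h4 : (n : ℝ) * (n.descFactorial q *
          (Real.Gamma (m / 2) / Real.Gamma (m / 2 + (q + 1 : ℕ)))) =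
          dualitySingle m (q + 1) n + q * (n.descFactorial q *
          (Real.Gamma (m / 2) / Real.Gamma (m / 2 + (q + 1 : ℕ)))) := by
      rw [dualitySingle_eq, ← mul_assoc, cast_mul_descFactorial]
      ring
    rw [h2]
    simp only [Nat.add_sub_cancel]
    push_cast at *
    linear_combination h0 + (q + 1) * h4 + (q + 1) * h3

/-- Self-duality of the inclusion process on two sites. -/
lemma bond_duality (hm : 0 < m) (p q n k : ℕ) :
    (n : ℝ) * (m / 2 + k) * (dualitySingle m p (n - 1) * dualitySingle m q (k + 1)
        - dualitySingle m p n * dualitySingle m q k)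
      + k * (m / 2 + n) * (dualitySingle m p (n + 1) * dualitySingle m q (k - 1)
        - dualitySingle m p n * dualitySingle m q k)
    = p * (m / 2 + q) * (dualitySingle m (p - 1) n * dualitySingle m (q + 1) k
        - dualitySingle m p n * dualitySingle m q k)
      + q * (m / 2 + p) * (dualitySingle m (p + 1) n * dualitySingle m (q - 1) k
        - dualitySingle m p n * dualitySingle m q k) := by
  have a1 := mul_dualitySingle_sub_one hm p n
  have a2 := mul_dualitySingle hm p n
  have a3 := mul_dualitySingle_add_one hm p n
  have b1 := mul_dualitySingle_sub_one hm q k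
  have b2 := mul_dualitySingle hm q k
  have b3 := mul_dualitySingle_add_one hm q k
  -- The bond generator is grouped into products of one factor per site, to each of which one of the
  -- single-site relations applies.
  have e : ∀ (x y z u v w : ℝ), (n : ℝ) * (m / 2 + k) * (x * v - y * u)
      + k * (m / 2 + n) * (z * w - y * u) = (n * x) * ((m / 2 + k) * v)
        + ((m / 2 + n) * z) * (k * w) - 2 * ((n * y) * (k * u)) - m / 2 * ((n * y) * u)
        - m / 2 * (y * (k * u)) := by
    intros; ring
  rw [e, a1, a2, a3, b1, b2, b3]
  ring

end singleSite

/-! ### Self-duality on the lattice and the labelled dual process -/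

section generator

variable {m : ℝ}

/-- The product of the single-site duality polynomials over a finite set of sites. -/
noncomputable def dualProd (m : ℝ) (S : Finset ℤ) (ξ η : Config) : ℝ := ∏ i ∈ S, dualitySingle m (ξ i) (η i)

lemma move_apply_left {η : Config} {i j : ℤ} (h : i ≠ j) : move η i j i = η i - 1 := by
  simp [move, h]

lemma move_apply_right {η : Config} {i j : ℤ} (h : i ≠ j) : move η i j j = η j + 1 := by
  simp [move, h.symm]

lemma move_apply_of_ne {η : Config} {i j k : ℤ} (h : k ≠ i) (h' : k ≠ j) : move η i j k = η k := by
  simp [move, h, h']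

lemma dualProd_eq_mul {S : Finset ℤ} {ξ η ξ' η' : Config} {a b : ℤ} (hab : a ≠ b) (ha : a ∈ S)
    (hb : b ∈ S) (hξ : ∀ k, k ≠ a → k ≠ b → ξ' k = ξ k) (hη : ∀ k, k ≠ a → k ≠ b → η' k = η k) :
    dualProd m S ξ' η' = dualitySingle m (ξ' a) (η' a) * dualitySingle m (ξ' b) (η' b) *
      dualProd m ((S.erase a).erase b) ξ η := by
  unfold dualProd
  rw [← Finset.mul_prod_erase S _ ha, ← Finset.mul_prod_erase (S.erase a) _
    (Finset.mem_erase.2 ⟨hab.symm, hb⟩), mul_assoc]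
  congr 2
  apply Finset.prod_congr rfl
  intro k hk
  simp only [Finset.mem_erase] at hk
  rw [hξ k hk.2.1 hk.1, hη k hk.2.1 hk.1]

/-- A move along the bond changes only the factors at `a` and `b`, so the two-site identity is
multiplied by a common remaining product. -/
lemma dualProd_bond (hm : 0 < m) {S : Finset ℤ} (ξ η : Config) {a b : ℤ} (hab : a ≠ b)
    (ha : a ∈ S) (hb : b ∈ S) :
    (η a : ℝ) * (m / 2 + η b) * (dualProd m S ξ (move η a b) - dualProd m S ξ η)
      + η b * (m / 2 + η a) * (dualProd m S ξ (move η b a) - dualProd m S ξ η)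
    = ξ a * (m / 2 + ξ b) * (dualProd m S (move ξ a b) η - dualProd m S ξ η)
      + ξ b * (m / 2 + ξ a) * (dualProd m S (move ξ b a) η - dualProd m S ξ η) := by
  have h : ∀ {ξ' η' : Config}, (∀ k, k ≠ a → k ≠ b → ξ' k = ξ k) →
      (∀ k, k ≠ a → k ≠ b → η' k = η k) → dualProd m S ξ' η' =
      dualitySingle m (ξ' a) (η' a) * dualitySingle m (ξ' b) (η' b) *
      dualProd m ((S.erase a).erase b) ξ η := fun h1 h2 => dualProd_eq_mul hab ha hb h1 h2
  have h1 : ∀ (ζ : Config) k, k ≠ a → k ≠ b → ζ k = ζ k := fun _ _ _ _ => rfl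
  have h2 : ∀ (ζ : Config) k, k ≠ a → k ≠ b → move ζ a b k = ζ k :=
    fun _ _ h h' => move_apply_of_ne h h'
  have h3 : ∀ (ζ : Config) k, k ≠ a → k ≠ b → move ζ b a k = ζ k :=
    fun _ _ h h' => move_apply_of_ne h' h
  rw [h (h1 ξ) (h2 η), h (h1 ξ) (h3 η), h (h1 ξ) (h1 η), h (h2 ξ) (h1 η), h (h3 ξ) (h1 η)]
  simp only [move_apply_left hab, move_apply_left hab.symm, move_apply_right hab,
    move_apply_right hab.symm]
  have := bond_duality hm (ξ a) (ξ b) (η a) (η b)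
  linear_combination (dualProd m ((S.erase a).erase b) ξ η) * this

lemma duality_eq_dualProd (hm : 0 < m) {S : Finset ℤ} {ξ : ℤ →₀ ℕ} (h : ξ.support ⊆ S)
    (η : Config) : duality m ξ η = dualProd m S ξ η := by
  unfold duality dualProd
  apply Finset.prod_subset h
  intro i _ hi
  rw [Finsupp.notMem_support_iff.1 hi, dualitySingle_zero hm]

/-- Resummation along the bonds. -/
lemma tsum_neighbours {T : ℤ → ℤ → ℝ} {U : Finset ℤ} (hU : ∀ i ∉ U, T i (i - 1) = 0)
    (hU' : ∀ i ∉ U, T i (i + 1) = 0) :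
    ∑' i : ℤ, ∑ j ∈ ({i - 1, i + 1} : Finset ℤ), T i j = ∑' i : ℤ, (T i (i + 1) + T (i + 1) i) := by
  have s1 : Summable fun i : ℤ => T i (i - 1) := summable_of_ne_finset_zero (s := U) hU
  have s2 : Summable fun i : ℤ => T i (i + 1) := summable_of_ne_finset_zero (s := U) hU'
  have s3 : Summable fun i : ℤ => T (i + 1) i := by
    have := (Equiv.addRight (1 : ℤ)).summable_iff.2 s1
    simpa [Function.comp_def] using this
  have e : ∀ i : ℤ, ∑ j ∈ ({i - 1, i + 1} : Finset ℤ), T i j = T i (i - 1) + T i (i + 1) := by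
    intro i
    rw [Finset.sum_pair (by omega)]
  simp only [e]
  rw [s1.tsum_add s2, s2.tsum_add s3, add_comm]
  congr 1
  rw [← (Equiv.addRight (1 : ℤ)).tsum_eq (fun i : ℤ => T i (i - 1))]
  simp

/-- The displacement of a nearest neighbour step. -/
def stepZ (e : Bool) : ℤ := if e then 1 else -1

/-- The jump rates of the labelled finite inclusion process. -/
noncomputable def dualRate (m : ℝ) {n : ℕ} (i : Fin n × Bool) (x : Fin n → ℤ) : ℝ :=
  m / 2 + ∑ j, if x j = x i.1 + stepZ i.2 then 1 else 0

/-- The jumps of the labelled finite inclusion process. -/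
def dualMove {n : ℕ} (i : Fin n × Bool) (x : Fin n → ℤ) : Fin n → ℤ :=
  Function.update x i.1 (x i.1 + stepZ i.2)

lemma stepZ_ne_zero (e : Bool) : stepZ e ≠ 0 := by cases e <;> simp [stepZ]

lemma pointConfig_apply {n : ℕ} (x : Fin n → ℤ) (a : ℤ) :
    pointConfig x a = ∑ k, if x k = a then 1 else 0 := by
  simp [pointConfig, Finsupp.finsetSum_apply, Finsupp.single_apply]

lemma pointConfig_apply_real {n : ℕ} (x : Fin n → ℤ) (a : ℤ) :
    (pointConfig x a : ℝ) = ∑ k, if x k = a then (1 : ℝ) else 0 := by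
  rw [pointConfig_apply]; push_cast; rfl

lemma pointConfig_update {n : ℕ} (x : Fin n → ℤ) (k : Fin n) {b : ℤ} (hb : x k ≠ b) :
    (pointConfig (Function.update x k b) : Config) = move (pointConfig x) (x k) b := by
  have e : ∀ y : Fin n → ℤ, ∀ c, pointConfig y c = (if y k = c then 1 else 0) +
      ∑ j ∈ Finset.univ.erase k, if y j = c then 1 else 0 := by
    intro y c
    rw [pointConfig_apply, ← Finset.add_sum_erase _ _ (Finset.mem_univ k)]
  funext c
  have h1 : ∑ j ∈ Finset.univ.erase k, (if Function.update x k b j = c then 1 else 0) =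
      ∑ j ∈ Finset.univ.erase k, if x j = c then 1 else 0 := by
    apply Finset.sum_congr rfl
    intro j hj
    rw [Function.update_of_ne (Finset.ne_of_mem_erase hj)]
  by_cases h2 : c = x k
  · subst h2
    rw [move_apply_left hb, e, e x, h1]
    simp [hb.symm]
  · by_cases h3 : c = b
    · subst h3
      rw [move_apply_right hb, e, e x, h1]
      simp [hb, add_comm]
    · rw [move_apply_of_ne h2 h3, e, e x, h1]
      simp [Ne.symm h2, Ne.symm h3]

lemma move_of_notMem {S : Finset ℤ} {ξ : ℤ →₀ ℕ} (η : Config) {a b : ℤ} (hS : ξ.support ⊆ S)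
    (ha : a ∉ ξ.support) (hb : b ∉ ξ.support) (hm : 0 < m) :
    dualProd m S ξ (move η a b) = dualProd m S ξ η := by
  rw [← duality_eq_dualProd hm hS, ← duality_eq_dualProd hm hS]
  unfold duality
  apply Finset.prod_congr rfl
  intro i hi
  rw [move_apply_of_ne]
  · rintro rfl; exact ha hi
  · rintro rfl; exact hb hi

/-- Self-duality of the inclusion process. -/
theorem generator_duality (hm : 0 < m) {n : ℕ} (x : Fin n → ℤ) (η : Config) :
    generator m (duality m (pointConfig x)) η =
      jumpOp (dualRate m) dualMove (fun y => duality m (pointConfig y) η) x := by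
  set ξ := pointConfig x with hξ
  -- The sites of `ξ` and their neighbours. For a site outside this set, neither a jump of `η` nor a
  -- jump of `ξ` from it contributes.
  set S₁ : Finset ℤ := ξ.support ∪ ξ.support.image (· + 1) ∪ ξ.support.image (· - 1) with hS₁
  -- A product over all sites does not refer to a finite set, which may then be enlarged for each
  -- bond separately.
  set D : Config → Config → ℝ := fun ξ η => ∏ᶠ i, dualitySingle m (ξ i) (η i) with hD
  have hDS : ∀ (S : Finset ℤ) (ξ η : Config), (∀ i ∉ S, ξ i = 0) → D ξ η = dualProd m S ξ η := by
    intro S ξ η h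
    simp only [hD, dualProd]
    apply finprod_eq_prod_of_mulSupport_subset
    intro i hi
    by_contra hc
    exact hi (by simp [h i hc, dualitySingle_zero hm])
  have hξS : ∀ S : Finset ℤ, S₁ ⊆ S → ∀ i ∉ S, ξ i = 0 := by
    intro S hS i hi
    by_contra hc
    exact hi (hS (by simp [hS₁, hc]))
  have hDd : ∀ y : Fin n → ℤ, ∀ η, duality m (pointConfig y) η = D (pointConfig y) η := by
    intro y η
    rw [hDS (pointConfig y).support _ _ (by simp)]
    rfl
  -- the contribution of a bond on both sides
  set T : ℤ → ℤ → ℝ := fun i j => (η i : ℝ) * (m / 2 + (η j : ℝ)) * (D ξ (move η i j) - D ξ η)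
  set T' : ℤ → ℤ → ℝ := fun i j => (ξ i : ℝ) * (m / 2 + (ξ j : ℝ)) * (D (move ξ i j) η - D ξ η)
  have hbond : ∀ i : ℤ, T i (i + 1) + T (i + 1) i = T' i (i + 1) + T' (i + 1) i := by
    intro i
    set S := S₁ ∪ {i, i + 1}
    have hi : i ∈ S := by simp [S]
    have hi' : i + 1 ∈ S := by simp [S]
    have hz : ∀ k ∉ S, ξ k = 0 := hξS S Finset.subset_union_left
    have hz' : ∀ a b, a ∈ S → b ∈ S → ∀ k ∉ S, move ξ a b k = 0 := by
      intro a b ha hb k hk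
      rw [move_apply_of_ne (by rintro rfl; exact hk ha) (by rintro rfl; exact hk hb), hz k hk]
    simp only [T, T']
    rw [hDS S _ _ hz, hDS S _ _ hz, hDS S _ _ hz, hDS S _ _ (hz' _ _ hi hi'),
      hDS S _ _ (hz' _ _ hi' hi)]
    exact dualProd_bond hm ξ η (by omega) hi hi'
  have hTz : ∀ a b, ξ a = 0 → ξ b = 0 → T a b = 0 := by
    intro a b ha hb
    simp only [T]
    rw [hDS ξ.support _ _ (by simp), hDS ξ.support _ _ (by simp),
      move_of_notMem η subset_rfl (by simp [ha]) (by simp [hb]) hm, sub_self, mul_zero]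
  have hz₁ : ∀ i ∉ S₁, ξ i = 0 ∧ ξ (i - 1) = 0 ∧ ξ (i + 1) = 0 := by
    intro i hi
    refine ⟨?_, ?_, ?_⟩ <;> by_contra hc <;> apply hi <;> simp only [hS₁, Finset.mem_union,
      Finset.mem_image, Finsupp.mem_support_iff]
    · exact Or.inl (Or.inl hc)
    · exact Or.inl (Or.inr ⟨_, hc, by ring⟩)
    · exact Or.inr ⟨_, hc, by ring⟩
  have e1 : generator m (duality m ξ) η = ∑' i : ℤ, ∑ j ∈ ({i - 1, i + 1} : Finset ℤ), T i j := by
    unfold generator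
    simp only [T]
    refine tsum_congr fun i => Finset.sum_congr rfl fun j _ => ?_
    rw [hξ, hDd, hDd]
  rw [e1, tsum_neighbours (U := S₁) (fun i hi => hTz _ _ (hz₁ i hi).1 (hz₁ i hi).2.1)
    (fun i hi => hTz _ _ (hz₁ i hi).1 (hz₁ i hi).2.2)]
  simp only [hbond]
  have hT'z : ∀ i ∉ S₁, ∀ j, T' i j = 0 := by
    intro i hi j
    simp [T', (hz₁ i hi).1]
  rw [← tsum_neighbours (U := S₁) (fun i hi => hT'z i hi _) (fun i hi => hT'z i hi _),
    tsum_eq_sum (s := S₁) (fun i hi => Finset.sum_eq_zero fun j _ => hT'z i hi j)]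
  -- The factor `ξ i` is read as the number of labels at `i`, which distributes the rate of a site
  -- over its labelled particles.
  have e2 : ∀ i : ℤ, ∑ j ∈ ({i - 1, i + 1} : Finset ℤ), T' i j = ∑ k : Fin n, if x k = i then
      ∑ e : Bool, (m / 2 + (ξ (i + stepZ e) : ℝ)) * (D (move ξ i (i + stepZ e)) η - D ξ η)
      else 0 := by
    intro i
    rw [Finset.sum_pair (by omega), sub_eq_add_neg]
    simp only [T', Fintype.sum_bool, stepZ, if_true, Bool.false_eq_true, if_false]
    rw [hξ, pointConfig_apply_real x i, ← hξ]
    simp only [Finset.sum_mul, ite_mul, one_mul, zero_mul, ← Finset.sum_add_distrib]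
    refine Finset.sum_congr rfl fun k _ => ?_
    by_cases h : x k = i
    · simp only [h, if_true]
      ring
    · simp only [h, if_false, add_zero]
  simp only [e2]
  rw [Finset.sum_comm]
  unfold jumpOp
  rw [Fintype.sum_prod_type]
  refine Finset.sum_congr rfl fun k _ => ?_
  rw [Finset.sum_ite_eq S₁ (x k), if_pos]
  · refine Finset.sum_congr rfl fun e _ => ?_
    simp only [hDd, dualMove]
    rw [pointConfig_update x k (by have := stepZ_ne_zero e; omega), ← hξ, dualRate, hξ,
      pointConfig_apply_real]
  · by_contra hc
    have := (hz₁ _ hc).1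
    rw [hξ, pointConfig_apply] at this
    have := Finset.sum_eq_zero_iff.1 this k (Finset.mem_univ _)
    simp at this

end generator

/-! ### Duality moments of the product measures -/

section moments

variable {m : ℝ}

/-- The shift `n = j + k` turns the weight of shape `m / 2` times the polynomial into `(l / (1 - l))
^ k` times the weight of shape `m / 2 + k`, whose total mass is one; hence the parameter `m + 2 *
k`. -/
lemma hasSum_weight_mul_dualitySingle (hm : 0 < m) {l : ℝ} (h0 : 0 ≤ l) (h1 : l < 1) (k : ℕ) :
    HasSum (fun n => discreteGammaWeight m l n * dualitySingle m k n) ((l / (1 - l)) ^ k) := by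
  have hs := (hasSum_discreteGammaWeight (m := m + 2 * k) (by positivity) h0 h1).mul_left
    ((l / (1 - l)) ^ k)
  rw [mul_one] at hs
  have hinj : Function.Injective (fun j : ℕ => j + k) := add_left_injective k
  rw [← hinj.hasSum_iff]
  · refine Eq.mp (congrArg (fun g : ℕ → ℝ => HasSum g _) (funext fun j => ?_)) hs
    have hl : 0 < 1 - l := by linarith
    have g1 := (Real.Gamma_pos_of_pos (show 0 < m / 2 by positivity)).ne'
    have g2 := (Real.Gamma_pos_of_pos (show 0 < m / 2 + k by positivity)).ne'
    have e1 : (m + 2 * k) / 2 = m / 2 + k := by ring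
    simp only [Function.comp, discreteGammaWeight, dualitySingle, Nat.le_add_left, if_true,
      Nat.add_sub_cancel, e1]
    rw [neg_add, Real.rpow_add hl, Real.rpow_neg hl.le (k : ℝ), Real.rpow_natCast]
    have hr := (Real.rpow_pos_of_pos hl (-(m / 2))).ne'
    have e2 : m / 2 + (k : ℝ) + j = m / 2 + ((j + k : ℕ) : ℝ) := by push_cast; ring
    rw [e2, pow_add, div_pow]
    have : ((j + k).factorial : ℝ) ≠ 0 := by positivity
    have : (j.factorial : ℝ) ≠ 0 := by positivity
    field_simp
  · intro n hn
    have : ¬ k ≤ n := fun h => hn ⟨n - k, by simp [h]⟩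
    simp [dualitySingle, this]

lemma integral_dualitySingle (hm : 0 < m) {l : ℝ} (h0 : 0 ≤ l) (h1 : l < 1) (k : ℕ) :
    Integrable (dualitySingle m k) (discreteGamma m l) ∧
      ∫ n, dualitySingle m k n ∂(discreteGamma m l) = (l / (1 - l)) ^ k := by
  have hs := hasSum_weight_mul_dualitySingle hm h0 h1 k
  have hw := discreteGammaWeight_nonneg hm h0 h1
  have hi : ∀ n, ∫ x, dualitySingle m k x
      ∂(ENNReal.ofReal (discreteGammaWeight m l n) • Measure.dirac n) =
      discreteGammaWeight m l n * dualitySingle m k n := by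
    intro n
    rw [integral_smul_measure, integral_dirac, ENNReal.toReal_ofReal (hw n), smul_eq_mul]
  have hint : Integrable (dualitySingle m k) (discreteGamma m l) := by
    apply integrable_sum_measure
    · intro n
      exact (integrable_dirac (by simp)).smul_measure ENNReal.ofReal_ne_top
    · have : ∀ n, ∫ x, ‖dualitySingle m k x‖
          ∂(ENNReal.ofReal (discreteGammaWeight m l n) • Measure.dirac n) =
          discreteGammaWeight m l n * dualitySingle m k n := by
        intro n
        simp only [Real.norm_of_nonneg (dualitySingle_nonneg hm k _)]
        exact hi n
      simp only [this]
      exact hs.summable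
  refine ⟨hint, ?_⟩
  have h := hasSum_integral_measure hint
  simp only [hi] at h
  exact h.unique hs

/-- Only the sites in the support matter, and there the law is a finite product measure. Regrouping
the powers by labels turns the product over sites into a product over `k`. -/
lemma integral_duality_localGamma (hm : 0 < m) {l : ℤ → ℝ} (hl : ∀ i, l i ∈ Set.Ico (0 : ℝ) 1)
    {n : ℕ} (x : Fin n → ℤ) :
    Integrable (duality m (pointConfig x)) (localGamma m l) ∧
      ∫ η, duality m (pointConfig x) η ∂(localGamma m l) = ∏ k, l (x k) / (1 - l (x k)) := by
  have hp : ∀ i, IsProbabilityMeasure (discreteGamma m (l i)) := fun i =>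
    isProbabilityMeasure_discreteGamma hm (hl i).1 (hl i).2
  set ξ := pointConfig x with hξ
  set S := ξ.support
  set g : (S → ℕ) → ℝ := fun ζ => ∏ i : S, dualitySingle m (ξ i) (ζ i) with hg
  have hcomp : duality m ξ = g ∘ S.restrict := by
    funext η
    simp only [duality, hg, Function.comp, Finset.restrict]
    exact (Finset.prod_coe_sort S (fun i => dualitySingle m (ξ i) (η i))).symm
  have hmeas : Measurable (S.restrict : Config → S → ℕ) := Finset.measurable_restrict _
  have hgint : Integrable g (Measure.pi fun i : S => discreteGamma m (l i)) :=
    Integrable.fintype_prod (f := fun i : S => dualitySingle m (ξ i))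
      fun i => (integral_dualitySingle hm (hl i).1 (hl i).2 _).1
  have hmap : Measure.map S.restrict (localGamma m l) =
      Measure.pi fun i : S => discreteGamma m (l i) := Measure.infinitePi_map_restrict _
  rw [hcomp]
  constructor
  · rw [← hmap] at hgint
    exact hgint.comp_measurable hmeas
  · rw [← hmap] at hgint
    have h1 := integral_map (μ := localGamma m l) hmeas.aemeasurable hgint.aestronglyMeasurable
    simp only [Function.comp]
    rw [← h1, hmap, hg, integral_fintype_prod_eq_prod (fun i : S => dualitySingle m (ξ i))]
    simp only [fun i : S => (integral_dualitySingle hm (hl i).1 (hl i).2 (ξ i)).2]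
    rw [Finset.prod_coe_sort S (fun i => (l i / (1 - l i)) ^ (ξ i))]
    change ξ.prod (fun i k => (l i / (1 - l i)) ^ k) = _
    rw [hξ, pointConfig, ← Finsupp.prod_finsetSum_index (by simp) (by intros; rw [pow_add])]
    simp

end moments

/-! ### Correlation functions through the martingale problem -/

section localPoly

variable {m : ℝ}

lemma dualitySingle_le (hm : 0 < m) (k n : ℕ) : dualitySingle m k n ≤
    (Real.Gamma (m / 2) / Real.Gamma (m / 2 + k)) * (n : ℝ) ^ k := by
  have := Real.Gamma_pos_of_pos (show 0 < m / 2 by positivity)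
  have := Real.Gamma_pos_of_pos (show 0 < m / 2 + k by positivity)
  rw [dualitySingle_eq, mul_comm]
  gcongr
  exact_mod_cast Nat.descFactorial_le_pow n k

lemma duality_nonneg (hm : 0 < m) (ξ : ℤ →₀ ℕ) (η : Config) : 0 ≤ duality m ξ η :=
  Finset.prod_nonneg fun _ _ => dualitySingle_nonneg hm _ _

lemma isLocalPoly_duality (hm : 0 < m) (ξ : ℤ →₀ ℕ) : IsLocalPoly (duality m ξ) := by
  refine ⟨ξ.support, fun η η' h => Finset.prod_congr rfl fun i hi => by rw [h i hi],
    ∏ i ∈ ξ.support, (Real.Gamma (m / 2) / Real.Gamma (m / 2 + ξ i)), ∑ i ∈ ξ.support, ξ i, ?_⟩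
  intro η
  rw [abs_of_nonneg (duality_nonneg hm ξ η), ← Finset.prod_pow_eq_pow_sum,
    ← Finset.prod_mul_distrib]
  apply Finset.prod_le_prod
  · exact fun i _ => dualitySingle_nonneg hm _ _
  · intro i hi
    refine (dualitySingle_le hm _ _).trans ?_
    have := Real.Gamma_pos_of_pos (show 0 < m / 2 by positivity)
    have := Real.Gamma_pos_of_pos (show 0 < m / 2 + ξ i by positivity)
    have h : (η i : ℝ) ≤ ∑ i ∈ ξ.support, (η i : ℝ) :=
      Finset.single_le_sum (f := fun i => (η i : ℝ)) (fun _ _ => by positivity) hi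
    gcongr
    linarith

end localPoly

/-- The correlation function of a process: expectations of the duality functions. -/
noncomputable def correlation {Ω : Type*} [MeasurableSpace Ω] (m : ℝ) (P : Measure Ω)
    (η : ℝ≥0 → Ω → Config) {n : ℕ} (s : ℝ) (x : Fin n → ℤ) : ℝ :=
  ∫ ω, duality m (pointConfig x) (η s.toNNReal ω) ∂P

section martingale

variable {m : ℝ} {Ω : Type*} [mΩ : MeasurableSpace Ω] {P : Measure Ω}
  {μ : Measure Config} {η : ℝ≥0 → Ω → Config}

lemma IsSIP.measurable (h : IsSIP m μ P η) (t : ℝ≥0) : Measurable (η t) := by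
  obtain ⟨ℱ, hℱ, -⟩ := h.martingale_problem
  exact (hℱ t).mono (ℱ.le t) le_rfl

/-- Dynkin's formula for a solution of the martingale problem. -/
lemma IsSIP.dynkin [IsProbabilityMeasure P] (h : IsSIP m μ P η) {f : Config → ℝ} (hf : IsLocalPoly f) (t : ℝ≥0) :
    Integrable (fun ω => f (η t ω)) P ∧
    (∀ T : ℝ, IntegrableOn (fun s => ∫ ω, generator m f (η s.toNNReal ω) ∂P) (Set.Icc 0 T)) ∧
    ∫ ω, f (η t ω) ∂P = (∫ ω, f (η 0 ω) ∂P) +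
      ∫ s in (0 : ℝ)..t, ∫ ω, generator m f (η s.toNNReal ω) ∂P := by
  obtain ⟨ℱ, hℱ, hmp⟩ := h.martingale_problem
  obtain ⟨hint, hmart⟩ := hmp f hf
  have e : ∀ (t : ℝ≥0) (ω : Ω), ∫ s in (0 : ℝ)..t, generator m f (η s.toNNReal ω) =
      ∫ s, generator m f (η s.toNNReal ω) ∂(volume.restrict (Set.Icc 0 (t : ℝ))) := by
    intro t ω
    rw [intervalIntegral.integral_of_le t.coe_nonneg, integral_Icc_eq_integral_Ioc]
  have hI : ∀ t : ℝ≥0, Integrable (fun ω => ∫ s in (0 : ℝ)..t, generator m f (η s.toNNReal ω)) P := by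
    intro t
    simp only [e]
    exact (hint t).integral_prod_right
  have hft : ∀ t, Integrable (fun ω => f (η t ω)) P := by
    intro t
    have := (hmart.integrable t).add (hI t)
    refine this.congr (ae_of_all _ fun ω => ?_)
    simp
  refine ⟨hft t, fun T => (hint T).integral_prod_left, ?_⟩
  have h1 := hmart.setIntegral_eq (zero_le : (0 : ℝ≥0) ≤ t) MeasurableSet.univ
  simp only [Measure.restrict_univ, NNReal.coe_zero, intervalIntegral.integral_same, sub_zero] at h1
  rw [integral_sub (hft t) (hI t)] at h1
  have h2 : ∫ ω, (∫ s in (0 : ℝ)..t, generator m f (η s.toNNReal ω)) ∂P =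
      ∫ s in (0 : ℝ)..t, ∫ ω, generator m f (η s.toNNReal ω) ∂P := by
    simp only [e]
    rw [intervalIntegral.integral_of_le t.coe_nonneg, ← integral_Icc_eq_integral_Ioc]
    exact (integral_integral_swap (hint t)).symm
  rw [h2] at h1
  linarith

variable {n : ℕ}

lemma IsSIP.integrable_duality [IsProbabilityMeasure P] (hm : 0 < m)
    (h : IsSIP m μ P η) (t : ℝ≥0) (x : Fin n → ℤ) :
    Integrable (fun ω => duality m (pointConfig x) (η t ω)) P :=
  (h.dynkin (isLocalPoly_duality hm _) t).1

/-- Duality moves the generator from the configuration to the labels, where it is a finite sum and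
commutes with the expectation. -/
lemma IsSIP.integral_generator [IsProbabilityMeasure P] (hm : 0 < m)
    (h : IsSIP m μ P η) (s : ℝ) (x : Fin n → ℤ) :
    ∫ ω, generator m (duality m (pointConfig x)) (η s.toNNReal ω) ∂P =
      jumpOp (dualRate m) dualMove (correlation m P η s) x := by
  simp only [generator_duality hm, jumpOp]
  have hi : ∀ y : Fin n → ℤ, Integrable (fun ω => duality m (pointConfig y) (η s.toNNReal ω)) P :=
    fun y => h.integrable_duality hm _ y
  rw [integral_finsetSum _ fun i _ => ((hi (dualMove i x)).sub' (hi x)).const_mul (dualRate m i x)]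
  refine Finset.sum_congr rfl fun i _ => ?_
  rw [integral_const_mul, integral_sub (hi _) (hi _)]
  rfl

/-- By duality, the correlation functions of the inclusion process solve the evolution equation
of the labelled finite inclusion process. -/
theorem IsSIP.isNonnegSolution [IsProbabilityMeasure P] (hm : 0 < m)
    (h : IsSIP m μ P η) (n : ℕ) :
    IsNonnegSolution (dualRate m) dualMove
      (fun s (x : Fin n → ℤ) => correlation m P η s x) := by
  have hnn : ∀ s (x : Fin n → ℤ), 0 ≤ correlation m P η s x := fun s x =>
    integral_nonneg fun ω => duality_nonneg hm _ _
  set g : (Fin n → ℤ) → ℝ → ℝ :=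
    fun x s => jumpOp (dualRate m) dualMove (correlation m P η s) x with hg
  have hgi : ∀ x T, IntegrableOn (g x) (Set.Icc 0 T) := by
    intro x T
    have := (h.dynkin (isLocalPoly_duality hm (pointConfig x)) 0).2.1 T
    simpa only [h.integral_generator hm] using this
  have hgI : ∀ x {T}, 0 ≤ T → IntervalIntegrable (g x) volume 0 T := by
    intro x T hT
    rw [intervalIntegrable_iff_integrableOn_Icc_of_le hT]
    exact hgi x T
  -- A bootstrap: Dynkin's formula makes the correlations continuous; the integrand is a finite
  -- linear combination of correlations and is then continuous too, so the primitive is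
  -- differentiable.
  have hF : ∀ x s, 0 ≤ s → correlation m P η s x = correlation m P η 0 x +
      ∫ r in (0 : ℝ)..s, g x r := by
    intro x s hs
    have := (h.dynkin (isLocalPoly_duality hm (pointConfig x)) s.toNNReal).2.2
    simp only [h.integral_generator hm, Real.coe_toNNReal s hs] at this
    simpa [correlation] using this
  have hcont : ∀ x : Fin n → ℤ, ContinuousOn (fun s => correlation m P η s x) (Set.Ici 0) := by
    intro x s hs
    have hs0 : (0 : ℝ) ≤ s := hs
    have h1 : ContinuousOn (fun s => correlation m P η s x) (Set.Icc 0 (s + 1)) := by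
      have h2 : ContinuousOn (fun s => correlation m P η 0 x + ∫ r in (0 : ℝ)..s, g x r)
          (Set.Icc 0 (s + 1)) :=
        continuousOn_const.add (intervalIntegral.continuousOn_primitive_interval
          (b := s + 1) (by rw [Set.uIcc_of_le (by linarith)]; exact hgi x (s + 1)) |>.mono
            (by rw [Set.uIcc_of_le (by linarith)]))
      exact h2.congr fun r hr => hF x r hr.1
    refine (h1 s ⟨hs, by linarith⟩).mono_of_mem_nhdsWithin ?_
    rw [mem_nhdsWithin]
    exact ⟨Set.Iio (s + 1), isOpen_Iio, by simp, fun r hr => ⟨hr.2, hr.1.le⟩⟩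
  refine ⟨hnn, hcont, fun x s hs => ?_⟩
  have hgc : ContinuousOn (g x) (Set.Ici 0) := by
    simp only [hg, jumpOp]
    exact continuousOn_finsetSum _ fun i _ =>
      continuousOn_const.mul ((hcont _).sub (hcont _))
  have hgat : ContinuousAt (g x) s := hgc.continuousAt (Ici_mem_nhds hs)
  have h1 : HasDerivAt (fun s => correlation m P η 0 x + ∫ r in (0 : ℝ)..s, g x r) (g x s) s := by
    refine (intervalIntegral.integral_hasDerivAt_right (hgI x hs.le) ?_ hgat).const_add _
    refine ContinuousOn.stronglyMeasurableAtFilter isOpen_Ioi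
      (hgc.mono Set.Ioi_subset_Ici_self) s hs
  refine h1.congr_of_eventuallyEq ?_
  filter_upwards [lt_mem_nhds hs] with r hr
  exact hF x r hr.le

lemma IsSIP.correlation_zero {l : ℤ → ℝ} (hm : 0 < m) (hl : ∀ i, l i ∈ Set.Ico (0 : ℝ) 1)
    (h : IsSIP m (localGamma m l) P η) (x : Fin n → ℤ) :
    correlation m P η 0 x = ∏ k, l (x k) / (1 - l (x k)) := by
  have h1 := integral_duality_localGamma hm hl x
  rw [← h1.2, ← h.initial, integral_map (h.measurable 0).aemeasurable]
  · simp [correlation]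
  · rw [h.initial]
    exact h1.1.aestronglyMeasurable

end martingale

/-- A nonnegative solution is dominated by every nonnegative supersolution which dominates it at
time zero. -/
theorem IsNonnegSolution.le_supersolution {X I : Type*} [Fintype I] {r : I → X → ℝ} {σ : I → X → X}
    {R c : ℝ} {F Φ : ℝ → X → ℝ} (hc : 0 < c) (hr : ∀ i x, c ≤ r i x) (hR : ∀ x, ∑ i, r i x ≤ R)
    (hF : IsNonnegSolution r σ F) (hΦ0 : ∀ s x, 0 ≤ s → 0 ≤ Φ s x)
    (hΦc : ∀ x, ContinuousOn (fun s => Φ s x) (Set.Ici 0))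
    (hΦ : ∀ x s, 0 < s → ∃ Φ', HasDerivAt (fun s => Φ s x) Φ' s ∧ jumpOp r σ (Φ s) x ≤ Φ')
    (hinit : ∀ x, F 0 x ≤ Φ 0 x) {s : ℝ} (hs : 0 ≤ s) (x : X) : F s x ≤ Φ s x := by
  have hsub : IsSubsolution r σ s (fun s x => F s x - Φ s x) := by
    constructor
    · intro x
      exact ((hF.cont x).sub (hΦc x)).mono fun t ht => ht.1
    · intro x t ht
      obtain ⟨Φ', h1, h2⟩ := hΦ x t ht.1
      refine ⟨_, (hF.deriv x t ht.1).sub h1, ?_⟩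
      have : jumpOp r σ (fun x => F t x - Φ t x) x = jumpOp r σ (F t) x - jumpOp r σ (Φ t) x := by
        simp only [jumpOp, ← Finset.sum_sub_distrib]
        exact Finset.sum_congr rfl fun i _ => by ring
      rw [this]
      linarith
  -- Because `Φ ≥ 0`, the a priori growth of `F` alone places `F - Φ` in the comparison class with
  -- `B = e / c`; `Φ` needs no growth condition.
  have h := hsub.nonpos (fun i x => hc.le.trans (hr i x)) hR (fun x => by linarith [hinit x])
    (B := Real.exp 1 / c) (by positivity) (fun x => ?_) x (s := s) ⟨hs, le_rfl⟩
  · linarith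
  · obtain ⟨A, hA⟩ := hF.growth hc hr hR s x
    exact ⟨A, fun l t ht => (sub_le_self _ (hΦ0 t _ ht.1)).trans (hA l t ht)⟩

/-! ### One particle: the discrete heat equation -/

section walk

/-- The jump rates of a random walk. -/
noncomputable def walkRate (m : ℝ) (_ : Bool) (_ : ℤ) : ℝ := m / 2

/-- The jumps of a nearest neighbour walk. -/
def walkMove (e : Bool) (a : ℤ) : ℤ := a + stepZ e

/-- The discrete Laplacian. -/
def lap (f : ℤ → ℝ) (a : ℤ) : ℝ := f (a + 1) + f (a - 1) - 2 * f a

lemma jumpOp_walk (m : ℝ) (f : ℤ → ℝ) (a : ℤ) :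
    jumpOp (walkRate m) walkMove f a = m / 2 * lap f a := by
  simp only [jumpOp, walkRate, walkMove, Fintype.sum_bool, stepZ, lap, if_true, Bool.false_eq_true,
    if_false, ← sub_eq_add_neg]
  ring

lemma sum_walkRate (m : ℝ) (a : ℤ) : ∑ e, walkRate m e a ≤ m := by
  simp only [Fintype.sum_bool, walkRate]; linarith

variable {m : ℝ}

/-- The one-particle function of the labelled process solves the discrete heat equation. -/
lemma IsNonnegSolution.walk {F : ℝ → (Fin 1 → ℤ) → ℝ}
    (hF : IsNonnegSolution (dualRate m) dualMove F) :
    IsNonnegSolution (walkRate m) walkMove (fun s a => F s (fun _ => a)) := by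
  refine ⟨fun s a => hF.nonneg s _, fun a => hF.cont _, fun a s hs => ?_⟩
  refine (hF.deriv (fun _ => a) s hs).congr_deriv ?_
  simp only [jumpOp, Fintype.sum_prod_type, Finset.univ_unique, Finset.sum_singleton]
  refine Finset.sum_congr rfl fun e _ => ?_
  have h1 : dualRate m ((default : Fin 1), e) (fun _ => a) = walkRate m e a := by
    simp [dualRate, walkRate, stepZ_ne_zero]
  have h2 : dualMove ((default : Fin 1), e) (fun _ => a) = fun _ => walkMove e a := by
    funext j
    simp [dualMove, walkMove, Subsingleton.elim j 0]
  rw [h1, h2]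

lemma abs_stepZ (e : Bool) : |stepZ e| = 1 := by cases e <;> simp [stepZ]

lemma abs_pathEnd_walk_le (l : List Bool) : ∀ a : ℤ,
    |((pathEnd walkMove l a : ℤ) : ℝ)| ≤ |(a : ℝ)| + l.length := by
  induction l with
  | nil => intro a; simp
  | cons e l ih =>
    intro a
    have h1 : |((walkMove e a : ℤ) : ℝ)| ≤ |(a : ℝ)| + 1 := by
      have h3 : |((stepZ e : ℤ) : ℝ)| = 1 := by exact_mod_cast abs_stepZ e
      simp only [walkMove, Int.cast_add]
      exact (abs_add_le _ _).trans_eq (by rw [h3])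
    have h2 := ih (walkMove e a)
    have h4 : pathEnd walkMove (e :: l) a = pathEnd walkMove l (walkMove e a) := rfl
    rw [h4, List.length_cons]
    push_cast
    linarith

/-- After `k` jumps the position has moved by at most `k`, so an exponential bound in space becomes
the geometric bound `exp b ^ k` along paths, well inside the comparison class. -/
lemma IsSubsolution.nonpos_walk (hm : 0 < m) {T : ℝ} {w : ℝ → ℤ → ℝ}
    (hw : IsSubsolution (walkRate m) walkMove T w) (h0 : ∀ a, w 0 a ≤ 0) {A b : ℝ} (hA : 0 ≤ A)
    (hb : 0 ≤ b) (hg : ∀ s ∈ Set.Icc 0 T, ∀ a : ℤ, w s a ≤ A * Real.exp (b * |(a : ℝ)|))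
    {s : ℝ} (hs : s ∈ Set.Icc 0 T) (a : ℤ) : w s a ≤ 0 := by
  refine hw.nonpos (R := m) (fun _ _ => by simp only [walkRate]; positivity) (sum_walkRate m) h0
    (B := Real.exp b) (Real.exp_pos b).le (fun a => ⟨A * Real.exp (b * |(a : ℝ)|), ?_⟩) a hs
  intro l s hs
  refine (hg s hs _).trans ?_
  have h1 := abs_pathEnd_walk_le l a
  have h2 : (1 : ℝ) ≤ (l.length.factorial : ℝ) := by exact_mod_cast Nat.factorial_pos _
  calc A * Real.exp (b * |((pathEnd walkMove l a : ℤ) : ℝ)|)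
      ≤ A * Real.exp (b * (|(a : ℝ)| + l.length)) := by gcongr
    _ = A * Real.exp (b * |(a : ℝ)|) * Real.exp b ^ l.length := by
        rw [mul_add, Real.exp_add, ← Real.exp_nat_mul, mul_comm b (l.length : ℝ)]; ring
    _ ≤ _ := le_mul_of_one_le_right (by positivity) h2

/-- Positive eigenfunctions of the discrete Laplacian; they serve as exponential weights in all
lattice comparisons below. -/
lemma lap_cosh (β : ℝ) (a : ℤ) : lap (fun a => Real.cosh (β * a)) a =
    2 * (Real.cosh β - 1) * Real.cosh (β * a) := by
  simp only [lap]
  push_cast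
  rw [mul_add, mul_sub, mul_one, Real.cosh_add, Real.cosh_sub]
  ring

lemma cosh_le_exp_abs (x : ℝ) : Real.cosh x ≤ Real.exp |x| := by
  rw [← Real.cosh_abs, Real.cosh_eq]
  have : Real.exp (-|x|) ≤ Real.exp |x| := Real.exp_le_exp.2 (by linarith [abs_nonneg x])
  linarith

lemma exp_abs_le_two_cosh (x : ℝ) : Real.exp |x| ≤ 2 * Real.cosh x := by
  rw [← Real.cosh_abs, Real.cosh_eq]
  have := Real.exp_pos (-|x|)
  linarith

/-- A solution of the discrete heat equation inherits exponential bounds. -/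
theorem IsNonnegSolution.le_cosh (hm : 0 < m) {u : ℝ → ℤ → ℝ}
    (hu : IsNonnegSolution (walkRate m) walkMove u) {C β : ℝ} (hC : 0 ≤ C)
    (h0 : ∀ a, u 0 a ≤ C * Real.cosh (β * a)) {s : ℝ} (hs : 0 ≤ s) (a : ℤ) :
    u s a ≤ C * Real.exp (m * (Real.cosh β - 1) * s) * Real.cosh (β * a) := by
  refine hu.le_supersolution (r := walkRate m) (Φ := fun s a =>
    C * Real.exp (m * (Real.cosh β - 1) * s) * Real.cosh (β * a)) (c := m / 2) (R := m)
    (by positivity) (fun _ _ => le_rfl) (sum_walkRate m) ?_ ?_ ?_ ?_ hs a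
  · intro s a _
    have := Real.cosh_pos (β * a)
    positivity
  · intro a; fun_prop
  · intro a s _
    have h1 : HasDerivAt (fun s => Real.exp (m * (Real.cosh β - 1) * s))
        (Real.exp (m * (Real.cosh β - 1) * s) * (m * (Real.cosh β - 1))) s := by
      simpa using ((hasDerivAt_id s).const_mul (m * (Real.cosh β - 1))).exp
    refine ⟨_, (h1.const_mul C).mul_const _, le_of_eq ?_⟩
    rw [jumpOp_walk]
    have h2 := lap_cosh β a
    simp only [lap] at h2 ⊢
    linear_combination (m / 2 * (C * Real.exp (m * (Real.cosh β - 1) * s))) * h2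
  · intro a; simpa using h0 a

/-- Bernstein's gradient estimate for the discrete heat equation. -/
theorem IsNonnegSolution.gradient_sq_le (hm : 0 < m) {u : ℝ → ℤ → ℝ}
    (hu : IsNonnegSolution (walkRate m) walkMove u) {C β : ℝ} (hC : 0 ≤ C)
    (h0 : ∀ a, u 0 a ≤ C * Real.cosh (β * a)) {s : ℝ} (hs : 0 ≤ s) (a : ℤ) :
    m / 2 * s * (u s (a + 1) - u s a) ^ 2 ≤
      C ^ 2 * Real.exp (m * (Real.cosh (2 * β) - 1) * s) * Real.cosh (2 * β * a) := by
  set κ := m * (Real.cosh (2 * β) - 1) with hκ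
  set Φ : ℝ → ℤ → ℝ := fun s a => C ^ 2 * Real.exp (κ * s) * Real.cosh (2 * β * a) with hΦ
  -- In the equation for `u ^ 2` the carré du champ contains `m / 2` times the squared forward
  -- gradient, which pays for the time derivative of the weight `m / 2 * s`. The rest has a sign:
  -- `p1` below is the backward gradient term and `p2` the carré du champ of the gradient itself.
  set Z : ℝ → ℤ → ℝ := fun s a => u s a ^ 2 + m / 2 * s * (u s (a + 1) - u s a) ^ 2 with hZ
  have hΦ0 : ∀ s a, 0 ≤ Φ s a := by
    intro s a
    have := Real.cosh_pos (2 * β * a)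
    simp only [hΦ]; positivity
  have hsub : IsSubsolution (walkRate m) walkMove s (fun s a => Z s a - Φ s a) := by
    constructor
    · intro a
      have hc : ∀ a, ContinuousOn (fun s => u s a) (Set.Icc 0 s) := fun a =>
        (hu.cont a).mono fun t ht => ht.1
      refine ContinuousOn.sub (((hc a).pow 2).add (ContinuousOn.mul (by fun_prop)
        (((hc (a + 1)).sub (hc a)).pow 2))) ?_
      simp only [hΦ]; fun_prop
    · intro a t ht
      have hd : ∀ a, HasDerivAt (fun s => u s a) (m / 2 * lap (u t) a) t := fun a => by
        rw [← jumpOp_walk]; exact hu.deriv a t ht.1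
      have h1 : HasDerivAt (fun s => Real.exp (κ * s)) (Real.exp (κ * t) * κ) t := by
        simpa using ((hasDerivAt_id t).const_mul κ).exp
      have hΦd := (h1.const_mul (C ^ 2)).mul_const (Real.cosh (2 * β * a))
      have hZd := ((hd a).pow 2).add (((hasDerivAt_id t).const_mul (m / 2)).mul
        (((hd (a + 1)).sub (hd a)).pow 2))
      refine ⟨_, hZd.sub hΦd, ?_⟩
      rw [jumpOp_walk]
      have h2 := lap_cosh (2 * β) a
      simp only [lap, hZ, hΦ, id, add_sub_cancel_right, sub_add_cancel, Pi.pow_apply,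
        Pi.sub_apply] at h2 ⊢
      have h3 : κ * Real.cosh (2 * β * a) = m / 2 * (Real.cosh (2 * β * ((a + 1 : ℤ) : ℝ)) +
        Real.cosh (2 * β * ((a - 1 : ℤ) : ℝ)) - 2 * Real.cosh (2 * β * a)) := by
        rw [h2, hκ]; ring
      have h4 : C ^ 2 * (Real.exp (κ * t) * κ) * Real.cosh (2 * β * a) = C ^ 2 * Real.exp (κ * t) *
        (m / 2 * (Real.cosh (2 * β * ((a + 1 : ℤ) : ℝ)) +
        Real.cosh (2 * β * ((a - 1 : ℤ) : ℝ)) - 2 * Real.cosh (2 * β * a))) := by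
        rw [← h3]; ring
      rw [h4]
      set A := u t (a + 1 + 1)
      set B := u t (a + 1)
      set D := u t a
      set E := u t (a - 1)
      have p1 : 0 ≤ m / 2 * (E - D) ^ 2 := by positivity
      have p2 : 0 ≤ m / 2 * (m / 2) * t * ((A - 2 * B + D) ^ 2 + (B - 2 * D + E) ^ 2) := by
        have := ht.1.le
        positivity
      ring_nf at p1 p2 ⊢
      linarith
  have hcosh : ∀ a : ℤ, Real.cosh (β * a) ^ 2 ≤ Real.cosh (2 * β * a) := by
    intro a
    rw [mul_assoc, Real.cosh_two_mul, Real.cosh_sq]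
    have := sq_nonneg (Real.sinh (β * a))
    linarith
  have hb1 : ∀ t ∈ Set.Icc 0 s, ∀ a : ℤ, u t a ≤
      C * Real.exp (m * (Real.cosh β - 1) * s) * Real.exp (|β| * |(a : ℝ)|) := by
    intro t ht a
    refine (hu.le_cosh hm hC h0 ht.1 a).trans ?_
    have h1 := cosh_le_exp_abs (β * a)
    rw [abs_mul] at h1
    have h2 : 0 ≤ Real.cosh β - 1 := by linarith [Real.one_le_cosh β]
    have := ht.2
    gcongr
  set M := C * Real.exp (m * (Real.cosh β - 1) * s) * Real.exp |β| with hM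
  have hM0 : 0 ≤ M := by positivity
  have hb2 : ∀ t ∈ Set.Icc 0 s, ∀ a : ℤ, u t a ≤ M * Real.exp (|β| * |(a : ℝ)|) ∧
      u t (a + 1) ≤ M * Real.exp (|β| * |(a : ℝ)|) := by
    intro t ht a
    constructor
    · refine (hb1 t ht a).trans ?_
      have : 1 ≤ Real.exp |β| := Real.one_le_exp (abs_nonneg β)
      have h0 : C * Real.exp (m * (Real.cosh β - 1) * s) ≤ M :=
        le_mul_of_one_le_right (by positivity) this
      gcongr
    · refine (hb1 t ht (a + 1)).trans ?_
      have h1 : |((a + 1 : ℤ) : ℝ)| ≤ |(a : ℝ)| + 1 := by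
        push_cast
        exact (abs_add_le _ _).trans_eq (by simp)
      rw [hM, mul_assoc _ (Real.exp |β|), ← Real.exp_add]
      have h2 : |β| * |((a + 1 : ℤ) : ℝ)| ≤ |β| + |β| * |(a : ℝ)| := by
        have := mul_le_mul_of_nonneg_left h1 (abs_nonneg β)
        linarith
      gcongr
  have h := hsub.nonpos_walk hm (A := M ^ 2 * (1 + m / 2 * s)) (b := 2 * |β|) ?_ (by positivity)
    (by positivity) ?_ (s := s) ⟨hs, le_rfl⟩ a
  · have hp : 0 ≤ u s a ^ 2 := sq_nonneg _
    simp only [hZ, hΦ] at h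
    linarith
  · intro a
    simp only [hZ, hΦ, mul_zero, zero_mul, Real.exp_zero, mul_one, add_zero, sub_nonpos]
    calc u 0 a ^ 2 ≤ (C * Real.cosh (β * a)) ^ 2 := by
          have := hu.nonneg 0 a
          gcongr
          exact h0 a
      _ ≤ _ := by rw [mul_pow]; exact mul_le_mul_of_nonneg_left (hcosh a) (sq_nonneg C)
  · intro t ht a
    obtain ⟨h1, h2⟩ := hb2 t ht a
    have n1 := hu.nonneg t a
    have n2 := hu.nonneg t (a + 1)
    set W := M * Real.exp (|β| * |(a : ℝ)|) with hW
    have hW2 : W ^ 2 = M ^ 2 * Real.exp (2 * |β| * |(a : ℝ)|) := by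
      rw [hW, mul_pow, ← Real.exp_nat_mul]; push_cast; ring_nf
    have e1 : u t a ^ 2 ≤ W ^ 2 := by gcongr
    have e2 : (u t (a + 1) - u t a) ^ 2 ≤ W ^ 2 := by
      apply sq_le_sq'
      · linarith
      · linarith
    have e3 : m / 2 * t * (u t (a + 1) - u t a) ^ 2 ≤ m / 2 * s * W ^ 2 := by
      have := ht.1
      have := ht.2
      gcongr
    calc Z t a - Φ t a ≤ Z t a := sub_le_self _ (hΦ0 t a)
      _ ≤ W ^ 2 + m / 2 * s * W ^ 2 := add_le_add e1 e3
      _ = _ := by rw [hW2]; ring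

end walk

/-! ### Labelled particles: free walks and attraction -/

section labelled

variable {n : ℕ} {m : ℝ}

/-- The indicator of neighbouring sites. -/
noncomputable def adj (a b : ℤ) : ℝ := if |a - b| = 1 then 1 else 0

lemma adj_nonneg (a b : ℤ) : 0 ≤ adj a b := by unfold adj; split_ifs <;> norm_num

lemma adj_le_one (a b : ℤ) : adj a b ≤ 1 := by unfold adj; split_ifs <;> norm_num

lemma adj_comm (a b : ℤ) : adj a b = adj b a := by unfold adj; rw [abs_sub_comm]

lemma adj_self (a : ℤ) : adj a a = 0 := by simp [adj]

lemma adj_iff {a b : ℤ} : |a - b| = 1 ↔ b = a + 1 ∨ b = a - 1 := by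
  rw [abs_eq (by norm_num)]; omega

/-- The part of the labelled generator which describes independent walks. -/
def freeOp (f : (Fin n → ℤ) → ℝ) (x : Fin n → ℤ) : ℝ :=
  ∑ k, (f (Function.update x k (x k + 1)) + f (Function.update x k (x k - 1)) - 2 * f x)

/-- The part of the labelled generator which describes the inclusion interaction. -/
noncomputable def attractOp (f : (Fin n → ℤ) → ℝ) (x : Fin n → ℤ) : ℝ :=
  ∑ k, ∑ l, adj (x k) (x l) * (f (Function.update x k (x l)) - f x)

/-- The occupation-dependent part of a rate counts the labels on the target site, so it is a sum
over `l` of jumps of `k`, at rate one, onto the site of a neighbouring `l`. -/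
lemma jumpOp_dual (f : (Fin n → ℤ) → ℝ) (x : Fin n → ℤ) :
    jumpOp (dualRate m) dualMove f x = m / 2 * freeOp f x + attractOp f x := by
  have e : ∀ k l : Fin n, adj (x k) (x l) * (f (Function.update x k (x l)) - f x) =
      (if x l = x k + 1 then (f (Function.update x k (x k + 1)) - f x) else 0) +
      (if x l = x k - 1 then (f (Function.update x k (x k - 1)) - f x) else 0) := by
    intro k l
    unfold adj
    by_cases h1 : x l = x k + 1
    · rw [if_pos (adj_iff.2 (Or.inl h1)), if_pos h1, if_neg (by omega), h1]; ring
    · by_cases h2 : x l = x k - 1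
      · rw [if_pos (adj_iff.2 (Or.inr h2)), if_neg h1, if_pos h2, h2]; ring
      · rw [if_neg (fun h => (adj_iff.1 h).elim h1 h2), if_neg h1, if_neg h2]; ring
  simp only [jumpOp, freeOp, attractOp, Fintype.sum_prod_type, Fintype.sum_bool, dualRate, dualMove,
    stepZ, if_true, Bool.false_eq_true, if_false, ← sub_eq_add_neg, e]
  rw [Finset.mul_sum, ← Finset.sum_add_distrib]
  refine Finset.sum_congr rfl fun k _ => ?_
  have h : ∀ (c : ℤ) (v : ℝ), ∑ l, (if x l = c then v else 0) =
      (∑ l, if x l = c then (1 : ℝ) else 0) * v := by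
    intro c v; rw [Finset.sum_mul]; simp
  rw [Finset.sum_add_distrib, h _ (f (Function.update x k (x k + 1)) - f x),
    h _ (f (Function.update x k (x k - 1)) - f x)]
  ring

/-- The product of `u (x i)` over all particles except those in `s`. -/
def prodExcept (u : ℤ → ℝ) (x : Fin n → ℤ) (s : Finset (Fin n)) : ℝ := ∏ i ∈ sᶜ, u (x i)

lemma prod_update (u : ℤ → ℝ) (x : Fin n → ℤ) (k : Fin n) (b : ℤ) :
    ∏ i, u (Function.update x k b i) = u b * prodExcept u x {k} := by
  have h : ∀ i ∈ ({k}ᶜ : Finset (Fin n)), u (Function.update x k b i) = u (x i) := by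
    intro i hi
    rw [Function.update_of_ne (by simpa using hi)]
  rw [← Finset.prod_compl_mul_prod {k}, Finset.prod_congr rfl h]
  simp [prodExcept, mul_comm]

lemma prodExcept_singleton (u : ℤ → ℝ) (x : Fin n → ℤ) {k l : Fin n} (h : k ≠ l) :
    prodExcept u x {k} = u (x l) * prodExcept u x {k, l} := by
  have : ({k}ᶜ : Finset (Fin n)) = insert l ({k, l}ᶜ : Finset (Fin n)) := by
    ext i
    simp only [Finset.mem_compl, Finset.mem_singleton, Finset.mem_insert, not_or]
    by_cases hi : i = l
    · subst hi; simp [h.symm]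
    · simp [hi]
  unfold prodExcept
  rw [this, Finset.prod_insert (by simp)]

lemma freeOp_prod (u : ℤ → ℝ) (x : Fin n → ℤ) : freeOp (fun x => ∏ i, u (x i)) x =
    ∑ k, lap u (x k) * prodExcept u x {k} := by
  unfold freeOp
  refine Finset.sum_congr rfl fun k _ => ?_
  have h := prod_update u x k (x k)
  rw [Function.update_eq_self] at h
  simp only [prod_update, h, lap]
  ring

/-- The action of the interaction on a product function. -/
lemma attractOp_prod (u : ℤ → ℝ) (x : Fin n → ℤ) : attractOp (fun x => ∏ i, u (x i)) x =
    1 / 2 * ∑ k, ∑ l, adj (x k) (x l) * (u (x l) - u (x k)) ^ 2 * prodExcept u x {k, l} := by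
  have h0 : attractOp (fun x => ∏ i, u (x i)) x =
      ∑ k, ∑ l, adj (x k) (x l) * ((u (x l) - u (x k)) * prodExcept u x {k}) := by
    unfold attractOp
    refine Finset.sum_congr rfl fun k _ => Finset.sum_congr rfl fun l _ => ?_
    have h := prod_update u x k (x k)
    rw [Function.update_eq_self] at h
    simp only [prod_update, h]
    ring
  -- The names of `k` and `l` are exchanged. In the sum of both forms the differences `u (x l) - u
  -- (x k)` and `u (x k) - u (x l)` carry the factors `u (x l)` and `u (x k)`, and they combine to a
  -- square.
  have h1 : attractOp (fun x => ∏ i, u (x i)) x =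
      ∑ k, ∑ l, adj (x k) (x l) * ((u (x k) - u (x l)) * prodExcept u x {l}) := by
    rw [h0, Finset.sum_comm]
    refine Finset.sum_congr rfl fun k _ => Finset.sum_congr rfl fun l _ => ?_
    rw [adj_comm]
  have h2 : attractOp (fun x => ∏ i, u (x i)) x + attractOp (fun x => ∏ i, u (x i)) x =
      ∑ k, ∑ l, adj (x k) (x l) * (u (x l) - u (x k)) ^ 2 * prodExcept u x {k, l} := by
    nth_rewrite 1 [h0]
    rw [h1, ← Finset.sum_add_distrib]
    refine Finset.sum_congr rfl fun k _ => ?_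
    rw [← Finset.sum_add_distrib]
    refine Finset.sum_congr rfl fun l _ => ?_
    by_cases hkl : k = l
    · subst hkl; simp
    · rw [prodExcept_singleton u x hkl, prodExcept_singleton u x (Ne.symm hkl),
        Finset.pair_comm l k]
      ring
  linarith

/-- The attraction vanishes on sums of one-particle functions: the jump of `k` onto `l` is balanced
by that of `l` onto `k`, which has the same rate. One-particle weights hence evolve as under free
walks. -/
lemma jumpOp_dual_sum (w : ℤ → ℝ) (x : Fin n → ℤ) :
    jumpOp (dualRate m) dualMove (fun x => ∑ i, w (x i)) x = m / 2 * ∑ k, lap w (x k) := by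
  have hu : ∀ k b, ∑ i, w (Function.update x k b i) = w b + ∑ i ∈ ({k}ᶜ : Finset (Fin n)), w (x i) := by
    intro k b
    have h : ∀ i ∈ ({k}ᶜ : Finset (Fin n)), w (Function.update x k b i) = w (x i) := by
      intro i hi
      rw [Function.update_of_ne (by simpa using hi)]
    rw [← Finset.sum_compl_add_sum {k}, Finset.sum_congr rfl h]
    simp [add_comm]
  have hx : ∀ k, ∑ i, w (x i) = w (x k) + ∑ i ∈ ({k}ᶜ : Finset (Fin n)), w (x i) := by
    intro k
    have := hu k (x k)
    rwa [Function.update_eq_self] at this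
  have h1 : freeOp (fun x => ∑ i, w (x i)) x = ∑ k, lap w (x k) := by
    unfold freeOp
    refine Finset.sum_congr rfl fun k _ => ?_
    simp only [hu, hx k, lap]
    ring
  have h2 : attractOp (fun x => ∑ i, w (x i)) x =
      ∑ k, ∑ l, adj (x k) (x l) * (w (x l) - w (x k)) := by
    unfold attractOp
    refine Finset.sum_congr rfl fun k _ => Finset.sum_congr rfl fun l _ => ?_
    simp only [hu, hx k]
    ring
  have h3 : attractOp (fun x => ∑ i, w (x i)) x =
      - ∑ k, ∑ l, adj (x k) (x l) * (w (x l) - w (x k)) := by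
    rw [h2, ← Finset.sum_neg_distrib]
    refine Finset.sum_comm.trans ?_
    refine Finset.sum_congr rfl fun k _ => ?_
    rw [← Finset.sum_neg_distrib]
    refine Finset.sum_congr rfl fun l _ => ?_
    rw [adj_comm]
    ring
  rw [jumpOp_dual, h1]
  linarith

/-- The sum of `g` over the differences of the positions of all pairs. -/
def pairSum (g : ℤ → ℝ) (x : Fin n → ℤ) : ℝ := ∑ i, ∑ j, if i = j then 0 else g (x i - x j)

/-- The generator of the difference of the positions of two inclusion particles. -/
noncomputable def pairOp (m : ℝ) (g : ℤ → ℝ) (d : ℤ) : ℝ :=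
  m * lap g d + if |d| = 1 then 2 * (g 0 - g d) else 0

/-- The moved particle occurs in both positions of an ordered pair, and evenness of `g` makes the
two contributions equal. -/
lemma pairSum_update {g : ℤ → ℝ} (hg : ∀ d, g (-d) = g d) (x : Fin n → ℤ) (k : Fin n) (b : ℤ) :
    pairSum g (Function.update x k b) - pairSum g x =
      2 * ∑ j, if k = j then 0 else (g (b - x j) - g (x k - x j)) := by
  have e : ∀ i j, ((if i = j then 0 else g (Function.update x k b i - Function.update x k b j)) -
      if i = j then 0 else g (x i - x j)) =
      (if i = k then (if k = j then 0 else (g (b - x j) - g (x k - x j))) else 0) +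
      (if j = k then (if k = i then 0 else (g (b - x i) - g (x k - x i))) else 0) := by
    intro i j
    by_cases hij : i = j
    · subst hij
      by_cases hik : i = k
      · subst hik; simp
      · simp [hik]
    · by_cases hik : i = k
      · subst hik
        simp [hij, Ne.symm hij]
      · by_cases hjk : j = k
        · subst hjk
          have h1 := hg (b - x i)
          have h2 := hg (x j - x i)
          rw [neg_sub] at h1 h2
          simp [hij, Ne.symm hij, h1, h2]
        · simp [hij, hik, hjk]
  unfold pairSum
  rw [← Finset.sum_sub_distrib]
  simp only [← Finset.sum_sub_distrib, e, Finset.sum_add_distrib]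
  have h2 : ∑ i, ∑ j, (if j = k then (if k = i then 0 else (g (b - x i) - g (x k - x i))) else 0) =
      ∑ i, if k = i then 0 else (g (b - x i) - g (x k - x i)) := by
    refine Finset.sum_congr rfl fun i _ => ?_
    rw [Finset.sum_ite_eq' Finset.univ k, if_pos (Finset.mem_univ k)]
  have h1 : ∑ i, ∑ j, (if i = k then (if k = j then 0 else (g (b - x j) - g (x k - x j))) else 0) =
      ∑ i, if k = i then 0 else (g (b - x i) - g (x k - x i)) := by
    rw [Finset.sum_comm, ← h2]
  rw [h1, h2]
  ring

/-- The labelled generator acts on pair sums through the two-particle generator. -/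
lemma jumpOp_dual_pairSum {g : ℤ → ℝ} (hg : ∀ d, g (-d) = g d) (x : Fin n → ℤ) :
    jumpOp (dualRate m) dualMove (pairSum g) x = pairSum (pairOp m g) x := by
  have h1 : freeOp (pairSum g) x = 2 * ∑ k, ∑ j, if k = j then 0 else lap g (x k - x j) := by
    unfold freeOp
    rw [Finset.mul_sum]
    refine Finset.sum_congr rfl fun k _ => ?_
    have a1 := pairSum_update hg x k (x k + 1)
    have a2 := pairSum_update hg x k (x k - 1)
    have a3 : ∑ j, (if k = j then 0 else lap g (x k - x j)) =
        (∑ j, if k = j then 0 else (g (x k + 1 - x j) - g (x k - x j))) +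
        ∑ j, if k = j then 0 else (g (x k - 1 - x j) - g (x k - x j)) := by
      rw [← Finset.sum_add_distrib]
      refine Finset.sum_congr rfl fun j _ => ?_
      split_ifs
      · simp
      · simp only [lap]
        rw [show x k + 1 - x j = x k - x j + 1 by ring, show x k - 1 - x j = x k - x j - 1 by ring]
        ring
    rw [a3]
    linarith
  set B : Fin n → Fin n → ℝ := fun k l =>
    ∑ j, if k = j then 0 else (g (x l - x j) - g (x k - x j)) with hB
  have h2 : attractOp (pairSum g) x = ∑ k, ∑ l, adj (x k) (x l) * (2 * B k l) := by
    unfold attractOp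
    refine Finset.sum_congr rfl fun k _ => Finset.sum_congr rfl fun l _ => ?_
    rw [pairSum_update hg]
  have h3 : attractOp (pairSum g) x = ∑ k, ∑ l, adj (x k) (x l) * (2 * B l k) := by
    rw [h2, Finset.sum_comm]
    refine Finset.sum_congr rfl fun k _ => Finset.sum_congr rfl fun l _ => ?_
    rw [adj_comm]
  -- A third particle sees `k` take the place of `l` and `l` that of `k`; these contributions cancel
  -- and only the pair itself remains. This is why two-particle functions form a closed class.
  have hBB : ∀ k l, k ≠ l → B k l + B l k = 2 * (g 0 - g (x k - x l)) := by
    intro k l hkl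
    have hs : g (x l - x k) = g (x k - x l) := by rw [← hg, neg_sub]
    have e : ∀ j, ((if k = j then 0 else (g (x l - x j) - g (x k - x j))) +
        if l = j then 0 else (g (x k - x j) - g (x l - x j))) =
        (if k = j then (g 0 - g (x k - x l)) else 0) +
        (if l = j then (g 0 - g (x k - x l)) else 0) := by
      intro j
      by_cases hk : k = j
      · subst hk; simp [Ne.symm hkl, hs]
      · by_cases hl : l = j
        · subst hl; simp [hkl]
        · simp [hk, hl]
    simp only [hB]
    rw [← Finset.sum_add_distrib]
    simp only [e]
    rw [Finset.sum_add_distrib, Finset.sum_ite_eq, Finset.sum_ite_eq, if_pos (Finset.mem_univ _),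
      if_pos (Finset.mem_univ _)]
    ring
  have h4 : attractOp (pairSum g) x =
      ∑ k, ∑ l, if k = l then 0 else adj (x k) (x l) * (2 * (g 0 - g (x k - x l))) := by
    have : attractOp (pairSum g) x + attractOp (pairSum g) x = 2 *
        ∑ k, ∑ l, if k = l then 0 else adj (x k) (x l) * (2 * (g 0 - g (x k - x l))) := by
      nth_rewrite 1 [h2]
      rw [h3, ← Finset.sum_add_distrib, Finset.mul_sum]
      refine Finset.sum_congr rfl fun k _ => ?_
      rw [← Finset.sum_add_distrib, Finset.mul_sum]
      refine Finset.sum_congr rfl fun l _ => ?_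
      split_ifs with h
      · subst h; simp [adj_self]
      · rw [← mul_add, ← mul_add, hBB k l h]; ring
    linarith
  rw [jumpOp_dual, h1, h4, ← mul_assoc, Finset.mul_sum, ← Finset.sum_add_distrib]
  unfold pairSum
  refine Finset.sum_congr rfl fun k _ => ?_
  rw [Finset.mul_sum, ← Finset.sum_add_distrib]
  refine Finset.sum_congr rfl fun l _ => ?_
  split_ifs with h
  · simp
  · simp only [pairOp, adj, ite_mul, one_mul, zero_mul]
    ring

end labelled

/-! ### Barrier for the distance of two particles -/

section pairBarrier

/-- The square, modified at zero. -/
noncomputable def sqMod (θ : ℝ) (d : ℤ) : ℝ := if d = 0 then 1 - θ else (d : ℝ) ^ 2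

/-- The absolute value, modified at zero. -/
noncomputable def absMod (θ : ℝ) (d : ℤ) : ℝ := if d = 0 then 1 - θ else |(d : ℝ)|

lemma sqMod_neg (θ : ℝ) (d : ℤ) : sqMod θ (-d) = sqMod θ d := by simp [sqMod]

lemma absMod_neg (θ : ℝ) (d : ℤ) : absMod θ (-d) = absMod θ d := by simp [absMod]

lemma pairOp_eq (m : ℝ) (g : ℤ → ℝ) (d : ℤ) : pairOp m g d =
    (m + if d = -1 then 2 else 0) * (g (d + 1) - g d) +
      (m + if d = 1 then 2 else 0) * (g (d - 1) - g d) := by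
  unfold pairOp lap
  by_cases h1 : d = 1
  · subst h1; norm_num; ring
  · by_cases h2 : d = -1
    · subst h2; norm_num; ring
    · have : ¬ |d| = 1 := by rw [abs_eq (by norm_num)]; tauto
      simp only [h1, h2, this, if_false]; ring

lemma int_cases_small (d : ℤ) : d = 0 ∨ d = 1 ∨ d = -1 ∨ 2 ≤ d ∨ d ≤ -2 := by omega

variable {m θ : ℝ}

/-- At distance one the rate towards zero is `m + 2`, against `m` outwards. The value `1 - θ` at
zero makes the inward loss only `(m + 2) * θ = m / 2`, and still leaves a gain at zero itself: the
values are `2 m θ` at zero, `5 m / 2` at distance one and `2 m` beyond. -/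
lemma le_pairOp_sqMod (hm : 0 < m) (hθ : 2 * ((m + 2) * θ) = m) (hθ0 : 0 < θ) (d : ℤ) :
    m * θ ≤ pairOp m (sqMod θ) d := by
  have hmθ : 2 * (m * θ) ≤ m := by nlinarith
  rw [pairOp_eq]
  rcases int_cases_small d with h | h | h | h | h
  · subst h; norm_num [sqMod]; nlinarith
  · subst h; norm_num [sqMod]; nlinarith
  · subst h; norm_num [sqMod]; nlinarith
  · have h0 : d ≠ 0 := by omega
    have h1 : d + 1 ≠ 0 := by omega
    have h2 : d - 1 ≠ 0 := by omega
    have h3 : d ≠ 1 := by omega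
    have h4 : d ≠ -1 := by omega
    simp only [sqMod, h0, h1, h2, h3, h4, if_false]
    push_cast; nlinarith
  · have h0 : d ≠ 0 := by omega
    have h1 : d + 1 ≠ 0 := by omega
    have h2 : d - 1 ≠ 0 := by omega
    have h3 : d ≠ 1 := by omega
    have h4 : d ≠ -1 := by omega
    simp only [sqMod, h0, h1, h2, h3, h4, if_false]
    push_cast; nlinarith

/-- Beyond distance one the absolute value is harmonic. The dip at zero makes it strictly
subharmonic at distance one, with value `m - m / 2`; inside a reciprocal this becomes a sink located
exactly where the source acts. -/
lemma le_pairOp_absMod (hm : 0 < m) (hθ : 2 * ((m + 2) * θ) = m) (hθ0 : 0 < θ) (d : ℤ) :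
    (if |d| = 1 then m * θ else 0) ≤ pairOp m (absMod θ) d := by
  have hmθ : 2 * (m * θ) ≤ m := by nlinarith
  have hmθ0 : 0 < m * θ := by positivity
  rw [pairOp_eq]
  rcases int_cases_small d with h | h | h | h | h
  · subst h; norm_num [absMod]; nlinarith
  · subst h; norm_num [absMod]; nlinarith
  · subst h; norm_num [absMod]; nlinarith
  · have h0 : d ≠ 0 := by omega
    have h1 : d + 1 ≠ 0 := by omega
    have h2 : d - 1 ≠ 0 := by omega
    have h3 : d ≠ 1 := by omega
    have h4 : d ≠ -1 := by omega
    have h5 : |d| ≠ 1 := by rw [abs_of_pos (by omega)]; omega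
    have h6 : (2 : ℝ) ≤ d := by exact_mod_cast h
    simp only [absMod, h0, h1, h2, h3, h4, h5, if_false]
    push_cast
    rw [abs_of_nonneg (by linarith), abs_of_nonneg (by linarith), abs_of_nonneg (by linarith)]
    linarith
  · have h0 : d ≠ 0 := by omega
    have h1 : d + 1 ≠ 0 := by omega
    have h2 : d - 1 ≠ 0 := by omega
    have h3 : d ≠ 1 := by omega
    have h4 : d ≠ -1 := by omega
    have h5 : |d| ≠ 1 := by rw [abs_of_neg (by omega)]; omega
    have h6 : (d : ℝ) ≤ -2 := by exact_mod_cast h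
    simp only [absMod, h0, h1, h2, h3, h4, h5, if_false]
    push_cast
    rw [abs_of_nonpos (by linarith), abs_of_nonpos (by linarith), abs_of_nonpos (by linarith)]
    linarith

lemma sqMod_nonneg (hθ : θ ≤ 1) (d : ℤ) : 0 ≤ sqMod θ d := by
  unfold sqMod; split_ifs
  · linarith
  · positivity

lemma absMod_nonneg (hθ : θ ≤ 1) (d : ℤ) : 0 ≤ absMod θ d := by
  unfold absMod; split_ifs
  · linarith
  · positivity

lemma sqMod_step_sq_le (hθ0 : 0 ≤ θ) (hθ : θ ≤ 1) (d : ℤ) (e : ℤ) (he : |e| = 1) :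
    (sqMod θ (d + e) - sqMod θ d) ^ 2 ≤ 8 * sqMod θ d + 2 := by
  have he' : (e : ℝ) ^ 2 = 1 := by
    have : e ^ 2 = 1 := by rw [← sq_abs, he]; norm_num
    exact_mod_cast this
  unfold sqMod
  by_cases h0 : d = 0
  · subst h0
    have : e ≠ 0 := by rintro rfl; simp at he
    simp only [zero_add, this, if_false, if_true, he']
    nlinarith
  · by_cases h1 : d + e = 0
    · simp only [h0, h1, if_true, if_false]
      have : (d : ℝ) ^ 2 = 1 := by
        have : d = -e := by omega
        rw [this]; push_cast; rw [neg_sq, he']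
      rw [this]; nlinarith
    · simp only [h0, h1, if_false]
      push_cast
      have : ((d : ℝ) + e) ^ 2 - (d : ℝ) ^ 2 = 2 * (d * e) + 1 := by rw [← he']; ring
      rw [this]
      have h2 : ((d : ℝ) * e) ^ 2 = (d : ℝ) ^ 2 := by rw [mul_pow, he', mul_one]
      nlinarith [sq_nonneg ((d : ℝ) * e * 2 - 1)]

lemma absMod_step_sq_le (hθ0 : 0 ≤ θ) (hθ : θ ≤ 1) (d : ℤ) (e : ℤ) (he : |e| = 1) :
    (absMod θ (d + e) - absMod θ d) ^ 2 ≤ 1 := by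
  have he' : |(e : ℝ)| = 1 := by exact_mod_cast he
  unfold absMod
  by_cases h0 : d = 0
  · subst h0
    have : e ≠ 0 := by rintro rfl; simp at he
    simp only [zero_add, this, if_false, if_true, he']
    nlinarith
  · by_cases h1 : d + e = 0
    · simp only [h0, h1, if_true, if_false]
      have : |(d : ℝ)| = 1 := by
        have : d = -e := by omega
        rw [this]; push_cast; rw [abs_neg, he']
      rw [this]; nlinarith
    · simp only [h0, h1, if_false]
      push_cast
      have h2 : |(d : ℝ) + e| ≤ |(d : ℝ)| + 1 := (abs_add_le _ _).trans_eq (by rw [he'])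
      have h3 : |(d : ℝ)| ≤ |(d : ℝ) + e| + 1 := by
        have := abs_add_le ((d : ℝ) + e) (-e)
        rwa [add_neg_cancel_right, abs_neg, he'] at this
      rw [sq_le_one_iff_abs_le_one, abs_le]
      constructor <;> linarith

/-- An exact second-order expansion of the reciprocal: the linear part reproduces the generator of
the denominator, the quadratic part is an error to be absorbed. -/
lemma inv_sub_inv_eq {q q' : ℝ} (hq : 0 < q) (hq' : 0 < q') :
    q'⁻¹ - q⁻¹ = (-(q' - q) + (q' - q) ^ 2 / q') / q ^ 2 := by
  field_simp
  ring

/-- The denominator of the barrier for the two-particle generator. -/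
noncomputable def barrierDen (θ A b σ : ℝ) (d : ℤ) : ℝ :=
  σ + sqMod θ d / A + b * √σ * absMod θ d

lemma le_barrierDen {A b σ : ℝ} (hθ : θ ≤ 1) (hA : 0 < A) (hb : 0 ≤ b) (d : ℤ) :
    σ ≤ barrierDen θ A b σ d := by
  have h1 := sqMod_nonneg hθ d
  have h2 := absMod_nonneg hθ d
  have h3 : 0 ≤ sqMod θ d / A := by positivity
  have h4 : 0 ≤ b * √σ * absMod θ d := by positivity
  unfold barrierDen
  linarith

/-- Control of the quadratic error: a step changes the square by the order of its root and the
absolute value by at most one, and the denominator after the step is at least `σ`. -/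
lemma barrierDen_step {A b σ : ℝ} (hθ0 : 0 ≤ θ) (hθ : θ ≤ 1) (hA : 0 < A) (hb : 0 ≤ b)
    (hσ : 0 < σ) (d e : ℤ) (he : |e| = 1) :
    (barrierDen θ A b σ (d + e) - barrierDen θ A b σ d) ^ 2 / barrierDen θ A b σ (d + e) ≤
      16 / A * (sqMod θ d / (A * σ)) + 4 / (A ^ 2 * σ) + 2 * b ^ 2 := by
  have h1 := sqMod_step_sq_le hθ0 hθ d e he
  have h2 := absMod_step_sq_le hθ0 hθ d e he
  have h3 : σ ≤ barrierDen θ A b σ (d + e) := le_barrierDen hθ hA hb _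
  have h4 : barrierDen θ A b σ (d + e) - barrierDen θ A b σ d =
      (sqMod θ (d + e) - sqMod θ d) / A + b * √σ * (absMod θ (d + e) - absMod θ d) := by
    unfold barrierDen; ring
  set x := sqMod θ (d + e) - sqMod θ d
  set y := absMod θ (d + e) - absMod θ d
  have h5 : (x / A + b * √σ * y) ^ 2 ≤ 2 * ((8 * sqMod θ d + 2) / A ^ 2) + 2 * (b ^ 2 * σ) := by
    have e1 : (x / A) ^ 2 ≤ (8 * sqMod θ d + 2) / A ^ 2 := by rw [div_pow]; gcongr
    have e2 : (b * √σ * y) ^ 2 ≤ b ^ 2 * σ := by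
      rw [mul_pow, mul_pow, Real.sq_sqrt hσ.le]
      exact mul_le_of_le_one_right (by positivity) h2
    nlinarith [sq_nonneg (x / A - b * √σ * y)]
  rw [h4]
  calc (x / A + b * √σ * y) ^ 2 / barrierDen θ A b σ (d + e)
      ≤ (x / A + b * √σ * y) ^ 2 / σ := by gcongr
    _ ≤ (2 * ((8 * sqMod θ d + 2) / A ^ 2) + 2 * (b ^ 2 * σ)) / σ := by gcongr
    _ = _ := by field_simp; ring

/-- The basic differential inequality for the barrier. -/
lemma barrier_ineq (hm : 0 < m) (hθ : 2 * ((m + 2) * θ) = m) (hθ0 : 0 < θ) (hθ1 : θ ≤ 1)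
    {A b a σ : ℝ} (hA : A = 128 * (m + 2)) (hb0 : 0 < b) (hb1 : b ≤ 1)
    (hb : 16 * (m + 2) * A * b ≤ m * θ) (ha : 4 * A * a ≤ m * θ) (ha' : a ≤ 1 / 4)
    (hσ1 : 1 ≤ σ) (hσ : 1 ≤ 4 * (m * θ) * σ) (d : ℤ) :
    pairOp m (fun d => (barrierDen θ A b σ d)⁻¹) d +
      (if |d| = 1 then b * √σ * (m * θ) / barrierDen θ A b σ d ^ 2 else 0) ≤
      ((1 - a) * (barrierDen θ A b σ d / σ) - (1 + b * absMod θ d / (2 * √σ))) /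
        barrierDen θ A b σ d ^ 2 := by
  have hA0 : 0 < A := by rw [hA]; positivity
  have hσ0 : 0 < σ := by linarith
  have hQ : ∀ d, 0 < barrierDen θ A b σ d := fun d => hσ0.trans_le (le_barrierDen hθ1 hA0 hb0.le d)
  have hlin : pairOp m (barrierDen θ A b σ) d =
      pairOp m (sqMod θ) d / A + b * √σ * pairOp m (absMod θ) d := by
    simp only [pairOp_eq, barrierDen]; ring
  have hE := le_pairOp_sqMod hm hθ hθ0 d
  have hH := le_pairOp_absMod hm hθ hθ0 d
  set K := 16 / A * (sqMod θ d / (A * σ)) + 4 / (A ^ 2 * σ) + 2 * b ^ 2 with hK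
  have hs1 := barrierDen_step hθ0.le hθ1 hA0 hb0.le hσ0 d 1 (by norm_num)
  have hs2 := barrierDen_step hθ0.le hθ1 hA0 hb0.le hσ0 d (-1) (by norm_num)
  rw [← sub_eq_add_neg] at hs2
  have hK0 : 0 ≤ K := le_trans (by have := hQ (d + 1); positivity) hs1
  set q := barrierDen θ A b σ d with hq
  have hsq : 0 < √σ := Real.sqrt_pos.2 hσ0
  have hss : √σ * √σ = σ := Real.mul_self_sqrt hσ0.le
  have hr1 : (m + if d = -1 then 2 else 0) ≤ m + 2 := by split_ifs <;> linarith
  have hr2 : (m + if d = 1 then 2 else 0) ≤ m + 2 := by split_ifs <;> linarith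
  have hr1' : 0 ≤ (m + if d = -1 then (2 : ℝ) else 0) := by split_ifs <;> linarith
  have hr2' : 0 ≤ (m + if d = 1 then (2 : ℝ) else 0) := by split_ifs <;> linarith
  -- There are two directions, each with rate at most `m + 2`; hence the factor in front of the
  -- quadratic error.
  have hinv : pairOp m (fun d => (barrierDen θ A b σ d)⁻¹) d ≤
      (-pairOp m (barrierDen θ A b σ) d + 2 * (m + 2) * K) / q ^ 2 := by
    rw [pairOp_eq, pairOp_eq, inv_sub_inv_eq (hQ d) (hQ _), inv_sub_inv_eq (hQ d) (hQ _), ← hq,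
      mul_div_assoc', mul_div_assoc', ← add_div]
    refine div_le_div_of_nonneg_right ?_ (sq_nonneg q)
    have e1 := mul_le_mul hr1 hs1 (by have := hQ (d + 1); positivity) (by positivity)
    have e2 := mul_le_mul hr2 hs2 (by have := hQ (d - 1); positivity) (by positivity)
    linarith
  have hqσ : q / σ = 1 + sqMod θ d / (A * σ) + b * absMod θ d / √σ := by
    rw [hq, barrierDen, add_div, add_div, div_self hσ0.ne', div_div]
    congr 1
    rw [div_eq_div_iff hσ0.ne' hsq.ne']
    linear_combination (b * absMod θ d) * hss
  -- All constants are balanced here. The square supplies a gain `m * θ / A` and the absolute value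
  -- the sink at distance one. The choice of `A` makes the error proportional to `X` equal to `X /
  -- 4`; largeness of `σ` and smallness of `b` and `a` keep three further errors below a quarter of
  -- `m * θ / A` each.
  have hmain : -pairOp m (barrierDen θ A b σ) d + 2 * (m + 2) * K +
      (if |d| = 1 then b * √σ * (m * θ) else 0) ≤
      (1 - a) * (q / σ) - (1 + b * absMod θ d / (2 * √σ)) := by
    rw [hqσ, hlin]
    set X := sqMod θ d / (A * σ) with hX
    have hX0 : 0 ≤ X := by have := sqMod_nonneg hθ1 d; positivity
    set Y := b * absMod θ d / √σ with hY
    have hY0 : 0 ≤ Y := by have := absMod_nonneg hθ1 d; positivity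
    have hY2 : b * absMod θ d / (2 * √σ) = Y / 2 := by rw [hY]; field_simp
    have e1 : m * θ / A ≤ pairOp m (sqMod θ) d / A := by gcongr
    have e2 : (if |d| = 1 then b * √σ * (m * θ) else 0) ≤ b * √σ * pairOp m (absMod θ) d := by
      have := mul_le_mul_of_nonneg_left hH (by positivity : 0 ≤ b * √σ)
      refine le_trans (le_of_eq ?_) this
      split_ifs <;> ring
    have e3 : 2 * (m + 2) * (16 / A * X) = X / 4 := by rw [hA]; field_simp; ring
    have e4 : 2 * (m + 2) * (4 / (A ^ 2 * σ)) ≤ m * θ / A / 4 := by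
      have : 2 * (m + 2) * (4 / (A ^ 2 * σ)) = 1 / (16 * A * σ) := by
        rw [hA]; field_simp; norm_num
      rw [this, div_div, div_le_div_iff₀ (by positivity) (by positivity)]
      nlinarith
    have e5 : 2 * (m + 2) * (2 * b ^ 2) ≤ m * θ / A / 4 := by
      rw [div_div, le_div_iff₀ (by positivity)]
      have : b ^ 2 ≤ b := by rw [sq]; exact mul_le_of_le_one_left hb0.le hb1
      calc 2 * (m + 2) * (2 * b ^ 2) * (A * 4) = 16 * (m + 2) * A * b ^ 2 := by ring
        _ ≤ 16 * (m + 2) * A * b := by gcongr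
        _ ≤ m * θ := hb
    have e6 : a ≤ m * θ / A / 4 := by
      rw [div_div, le_div_iff₀ (by positivity)]; linarith
    have e7 : a * (X + Y) ≤ 1 / 4 * (X + Y) := by gcongr
    rw [hY2, hK]
    have e8 : 2 * (m + 2) * (16 / A * X + 4 / (A ^ 2 * σ) + 2 * b ^ 2) =
      2 * (m + 2) * (16 / A * X) + 2 * (m + 2) * (4 / (A ^ 2 * σ)) + 2 * (m + 2) * (2 * b ^ 2) := by
      ring
    rw [e8]
    have e9 : 0 ≤ m * θ / A := by positivity
    linarith
  have hq2 : 0 < q ^ 2 := pow_pos (hQ d) 2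
  calc _ ≤ (-pairOp m (barrierDen θ A b σ) d + 2 * (m + 2) * K) / q ^ 2 +
      (if |d| = 1 then b * √σ * (m * θ) / q ^ 2 else 0) := by gcongr
    _ = (-pairOp m (barrierDen θ A b σ) d + 2 * (m + 2) * K +
      (if |d| = 1 then b * √σ * (m * θ) else 0)) / q ^ 2 := by
        split_ifs
        · rw [add_div _ (b * √σ * (m * θ))]
        · simp
    _ ≤ _ := by gcongr

lemma hasDerivAt_barrier {A b a σ : ℝ} (hθ1 : θ ≤ 1) (hA : 0 < A) (hb : 0 ≤ b) (hσ : 0 < σ)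
    (d : ℤ) : HasDerivAt (fun σ => σ ^ (1 - a) * (barrierDen θ A b σ d)⁻¹)
      (σ ^ (1 - a) * (((1 - a) * (barrierDen θ A b σ d / σ) - (1 + b * absMod θ d / (2 * √σ))) /
        barrierDen θ A b σ d ^ 2)) σ := by
  have hQ : 0 < barrierDen θ A b σ d := hσ.trans_le (le_barrierDen hθ1 hA hb d)
  have h1 : HasDerivAt (fun σ : ℝ => σ ^ (1 - a)) ((1 - a) * σ ^ (1 - a - 1)) σ :=
    Real.hasDerivAt_rpow_const (Or.inl hσ.ne')
  have h2 : HasDerivAt (fun σ => barrierDen θ A b σ d) (1 + b * (1 / (2 * √σ)) * absMod θ d) σ := by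
    unfold barrierDen
    exact ((hasDerivAt_id σ).add_const _).add
      (((Real.hasDerivAt_sqrt hσ.ne').const_mul b).mul_const _)
  refine (h1.mul (h2.inv hQ.ne')).congr_deriv ?_
  rw [Real.rpow_sub hσ (1 - a) 1, Real.rpow_one]
  simp only [Pi.inv_apply]
  have hsq : 0 < √σ := Real.sqrt_pos.2 hσ
  generalize barrierDen θ A b σ d = q at *
  generalize σ ^ (1 - a) = p
  field_simp
  ring

/-- A supersolution for the two-particle generator with a source at distance one. -/
theorem exists_pair_barrier (hm : 0 < m) : ∃ (a σ₀ C : ℝ) (Φ Φ' : ℝ → ℤ → ℝ), 0 < a ∧ 1 ≤ σ₀ ∧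
    0 ≤ C ∧ (∀ s d, Φ s (-d) = Φ s d) ∧ (∀ s d, 0 ≤ s → 0 ≤ Φ s d) ∧
    (∀ s d, 0 ≤ s → Φ s d ≤ C * (σ₀ + s) ^ (-a)) ∧
    (∀ s d, 0 ≤ s → HasDerivAt (fun s => Φ s d) (Φ' s d) s) ∧
    (∀ s d, 0 ≤ s → pairOp m (Φ s) d + (if |d| = 1 then (σ₀ + s) ^ (-(3 / 4) : ℝ) else 0) ≤
      Φ' s d) := by
  set θ := m / (2 * (m + 2)) with hθd
  have hθ : 2 * ((m + 2) * θ) = m := by rw [hθd]; field_simp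
  have hθ0 : 0 < θ := by positivity
  have hθ1 : θ ≤ 1 := by nlinarith
  set A := 128 * (m + 2) with hA
  have hA0 : 0 < A := by positivity
  have hA1 : 1 ≤ A := by linarith
  have hc : 0 < m * θ := by positivity
  set b := min 1 (m * θ / (16 * (m + 2) * A)) with hb
  have hb0 : 0 < b := lt_min one_pos (by positivity)
  have hb1 : b ≤ 1 := min_le_left _ _
  have hb2 : 16 * (m + 2) * A * b ≤ m * θ := by
    have := min_le_right 1 (m * θ / (16 * (m + 2) * A))
    rw [← hb, le_div_iff₀ (by positivity)] at this
    linarith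
  set a := min (1 / 4) (m * θ / (4 * A)) with ha
  have ha0 : 0 < a := lt_min (by norm_num) (by positivity)
  have ha1 : a ≤ 1 / 4 := min_le_left _ _
  have ha2 : 4 * A * a ≤ m * θ := by
    have := min_le_right (1 / 4) (m * θ / (4 * A))
    rw [← ha, le_div_iff₀ (by positivity)] at this
    linarith
  set σ₀ := max 1 (1 / (4 * (m * θ))) with hσd
  have hσ1 : 1 ≤ σ₀ := le_max_left _ _
  have hσ2 : 1 ≤ 4 * (m * θ) * σ₀ := by
    have := le_max_right 1 (1 / (4 * (m * θ)))
    rw [← hσd, div_le_iff₀ (by positivity)] at this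
    linarith
  -- The 9 compensates `q ^ 2 ≤ (3 σ) ^ 2`, valid for the denominator `q` at distance one.
  set c := 9 / (b * (m * θ)) with hcd
  have hc0 : 0 < c := by positivity
  -- With `σ = σ₀ + s`, the sink at distance one is of order `σ ^ (1 - a) * √σ / σ ^ 2 = σ ^ (-1/2 -
  -- a)`, which dominates the source because `a ≤ 1 / 4`. The decay `σ ^ (-a)` follows from `q ≥ σ`.
  refine ⟨a, σ₀, c, fun s d => c * ((σ₀ + s) ^ (1 - a) * (barrierDen θ A b (σ₀ + s) d)⁻¹),
    fun s d => c * ((σ₀ + s) ^ (1 - a) * (((1 - a) * (barrierDen θ A b (σ₀ + s) d / (σ₀ + s)) -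
      (1 + b * absMod θ d / (2 * √(σ₀ + s)))) / barrierDen θ A b (σ₀ + s) d ^ 2)),
    ha0, hσ1, hc0.le, ?_, ?_, ?_, ?_, ?_⟩
  · intro s d
    simp only [barrierDen, sqMod_neg, absMod_neg]
  · intro s d hs
    have h1 : 0 < σ₀ + s := by linarith
    have h2 : 0 < barrierDen θ A b (σ₀ + s) d := h1.trans_le (le_barrierDen hθ1 hA0 hb0.le d)
    positivity
  · intro s d hs
    have h1 : 0 < σ₀ + s := by linarith
    have h2 := le_barrierDen hθ1 hA0 hb0.le d (σ := σ₀ + s)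
    have h3 : (σ₀ + s) ^ (-a) = (σ₀ + s) ^ (1 - a) * (σ₀ + s)⁻¹ := by
      rw [← Real.rpow_neg_one (σ₀ + s), ← Real.rpow_add h1]; congr 1; ring
    rw [h3]
    exact mul_le_mul_of_nonneg_left (mul_le_mul_of_nonneg_left (inv_anti₀ h1 h2) (by positivity))
      hc0.le
  · intro s d hs
    have h1 : 0 < σ₀ + s := by linarith
    have h2 := (hasDerivAt_barrier (a := a) hθ1 hA0 hb0.le h1 d).comp_const_add σ₀ s
    exact h2.const_mul c
  · intro s d hs
    have h1 : 0 < σ₀ + s := by linarith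
    have h1' : 1 ≤ σ₀ + s := by linarith
    have h2 := barrier_ineq hm hθ hθ0 hθ1 hA hb0 hb1 hb2 ha2 ha1 h1'
      (hσ2.trans (by gcongr; linarith)) d
    set σ := σ₀ + s
    have hp : 0 < σ ^ (1 - a) := Real.rpow_pos_of_pos h1 _
    have h3 : pairOp m (fun d => c * (σ ^ (1 - a) * (barrierDen θ A b σ d)⁻¹)) d =
        c * (σ ^ (1 - a) * pairOp m (fun d => (barrierDen θ A b σ d)⁻¹) d) := by
      simp only [pairOp_eq]; ring
    rw [h3]
    have h4 : (if |d| = 1 then σ ^ (-(3 / 4) : ℝ) else 0) ≤ c * (σ ^ (1 - a) *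
        (if |d| = 1 then b * √σ * (m * θ) / barrierDen θ A b σ d ^ 2 else 0)) := by
      split_ifs with hd
      · have hd0 : d ≠ 0 := by rintro rfl; simp at hd
        have hdr : |(d : ℝ)| = 1 := by exact_mod_cast hd
        have hq : barrierDen θ A b σ d ≤ 3 * σ := by
          have e1 : √σ ≤ σ := Real.sqrt_le_iff.2 ⟨h1.le, by nlinarith⟩
          have e2 : b * √σ ≤ 1 * σ := by gcongr
          have e3 : 1 / A ≤ 1 := by rw [div_le_one hA0]; exact hA1
          simp only [barrierDen, sqMod, absMod, hd0, if_false, hdr, ← sq_abs (d : ℝ), one_pow,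
            mul_one]
          linarith
        have hq0 : 0 < barrierDen θ A b σ d := h1.trans_le (le_barrierDen hθ1 hA0 hb0.le d)
        have e4 : σ ^ (-(3 / 4) : ℝ) ≤ σ ^ (1 - a) * √σ / σ ^ 2 := by
          rw [Real.sqrt_eq_rpow, ← Real.rpow_natCast σ 2, ← Real.rpow_add h1, ← Real.rpow_sub h1]
          apply Real.rpow_le_rpow_of_exponent_le h1'
          push_cast
          linarith
        calc σ ^ (-(3 / 4) : ℝ) ≤ σ ^ (1 - a) * √σ / σ ^ 2 := e4
          _ = c * (σ ^ (1 - a) * (b * √σ * (m * θ) / (3 * σ) ^ 2)) := by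
            rw [hcd]; field_simp; norm_num
          _ ≤ _ := by gcongr
      · simp
    have h5 := mul_le_mul_of_nonneg_left h2 (mul_pos hc0 hp).le
    rw [mul_add] at h5
    simp only [mul_assoc] at h5 h4 ⊢
    linarith

end pairBarrier

/-! ### Decorrelation of the labelled particles -/

section chaos

variable {n : ℕ} {m : ℝ}

lemma le_dualRate (m : ℝ) (i : Fin n × Bool) (x : Fin n → ℤ) : m / 2 ≤ dualRate m i x := by
  unfold dualRate
  have : 0 ≤ ∑ j, if x j = x i.1 + stepZ i.2 then (1 : ℝ) else 0 :=
    Finset.sum_nonneg fun j _ => by split_ifs <;> norm_num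
  linarith

lemma sum_dualRate_le (m : ℝ) (x : Fin n → ℤ) :
    ∑ i, dualRate m i x ≤ ∑ _i : Fin n × Bool, (m / 2 + n) := by
  refine Finset.sum_le_sum fun i _ => ?_
  unfold dualRate
  gcongr
  calc (∑ j, if x j = x i.1 + stepZ i.2 then (1 : ℝ) else 0) ≤ ∑ _j : Fin n, (1 : ℝ) :=
        Finset.sum_le_sum fun j _ => by split_ifs <;> norm_num
    _ = n := by simp

lemma sum_abs_dualMove_le (i : Fin n × Bool) (x : Fin n → ℤ) :
    ∑ j, |(dualMove i x j : ℝ)| ≤ ∑ j, |(x j : ℝ)| + 1 := by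
  have h : ∀ j, |(dualMove i x j : ℝ)| ≤ |(x j : ℝ)| + if j = i.1 then 1 else 0 := by
    intro j
    unfold dualMove
    by_cases hj : j = i.1
    · subst hj
      simp only [Function.update_self, if_true]
      have h3 : |((stepZ i.2 : ℤ) : ℝ)| = 1 := by exact_mod_cast abs_stepZ i.2
      push_cast
      exact (abs_add_le _ _).trans_eq (by rw [h3])
    · rw [Function.update_of_ne hj]; simp [hj]
  refine (Finset.sum_le_sum fun j _ => h j).trans_eq ?_
  rw [Finset.sum_add_distrib]
  simp

lemma sum_abs_pathEnd_le (l : List (Fin n × Bool)) : ∀ x : Fin n → ℤ,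
    ∑ j, |(pathEnd dualMove l x j : ℝ)| ≤ ∑ j, |(x j : ℝ)| + l.length := by
  induction l with
  | nil => intro x; simp
  | cons i l ih =>
    intro x
    have h1 := ih (dualMove i x)
    have h2 := sum_abs_dualMove_le i x
    have h4 : pathEnd dualMove (i :: l) x = pathEnd dualMove l (dualMove i x) := rfl
    rw [h4, List.length_cons]
    push_cast
    linarith

lemma jumpOp_add {X I : Type*} [Fintype I] (r : I → X → ℝ) (σ : I → X → X) (f g : X → ℝ) (x : X) :
    jumpOp r σ (fun x => f x + g x) x = jumpOp r σ f x + jumpOp r σ g x := by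
  simp only [jumpOp, ← Finset.sum_add_distrib]
  exact Finset.sum_congr rfl fun i _ => by ring

lemma jumpOp_sub {X I : Type*} [Fintype I] (r : I → X → ℝ) (σ : I → X → X) (f g : X → ℝ) (x : X) :
    jumpOp r σ (fun x => f x - g x) x = jumpOp r σ f x - jumpOp r σ g x := by
  simp only [jumpOp, ← Finset.sum_sub_distrib]
  exact Finset.sum_congr rfl fun i _ => by ring

lemma jumpOp_const_mul {X I : Type*} [Fintype I] (r : I → X → ℝ) (σ : I → X → X) (c : ℝ)
    (f : X → ℝ) (x : X) : jumpOp r σ (fun x => c * f x) x = c * jumpOp r σ f x := by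
  simp only [jumpOp, Finset.mul_sum]
  exact Finset.sum_congr rfl fun i _ => by ring

variable {u : ℝ → ℤ → ℝ}

lemma hasDerivAt_prod_walk (hu : IsNonnegSolution (walkRate m) walkMove u) (x : Fin n → ℤ) {s : ℝ}
    (hs : 0 < s) : HasDerivAt (fun s => ∏ i, u s (x i))
      (m / 2 * freeOp (fun x => ∏ i, u s (x i)) x) s := by
  have h : ∀ i ∈ (Finset.univ : Finset (Fin n)), HasDerivAt (fun s => u s (x i))
      (m / 2 * lap (u s) (x i)) s := fun i _ => by
    rw [← jumpOp_walk]; exact hu.deriv (x i) s hs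
  refine (HasDerivAt.fun_finsetProd h).congr_deriv ?_
  rw [freeOp_prod, Finset.mul_sum]
  refine Finset.sum_congr rfl fun k _ => ?_
  rw [prodExcept, Finset.compl_singleton, smul_eq_mul]
  ring

lemma attractOp_prod_nonneg {v : ℤ → ℝ} (hv : ∀ a, 0 ≤ v a) (x : Fin n → ℤ) :
    0 ≤ attractOp (fun x => ∏ i, v (x i)) x := by
  rw [attractOp_prod]
  refine mul_nonneg (by norm_num) (Finset.sum_nonneg fun k _ => Finset.sum_nonneg fun l _ => ?_)
  exact mul_nonneg (mul_nonneg (adj_nonneg _ _) (sq_nonneg _)) (Finset.prod_nonneg fun i _ => hv _)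

/-- Correlation inequality: the correlation functions dominate the products of one-particle
functions. -/
theorem prod_le_correlation (hm : 0 < m) {F : ℝ → (Fin n → ℤ) → ℝ}
    (hF : IsNonnegSolution (dualRate m) dualMove F)
    (hu : IsNonnegSolution (walkRate m) walkMove u) (h0 : ∀ x, F 0 x = ∏ i, u 0 (x i))
    {S B β : ℝ} (hS : 0 ≤ S) (hB : 0 ≤ B) (hβ : 0 ≤ β)
    (huB : ∀ s ∈ Set.Icc 0 S, ∀ a : ℤ, u s a ≤ B * Real.exp (β * |(a : ℝ)|)) (x : Fin n → ℤ) :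
    ∏ i, u S (x i) ≤ F S x := by
  -- The product solves the equation without attraction; since the attraction is nonnegative on it,
  -- it is a subsolution of the full equation.
  have hsub : IsSubsolution (dualRate m) dualMove S (fun s x => ∏ i, u s (x i) - F s x) := by
    constructor
    · intro x
      refine ContinuousOn.sub (continuousOn_finsetProd _ fun i _ => (hu.cont _).mono ?_)
        ((hF.cont x).mono ?_) <;> exact fun t ht => ht.1
    · intro x t ht
      refine ⟨_, (hasDerivAt_prod_walk hu x ht.1).sub (hF.deriv x t ht.1), ?_⟩
      rw [jumpOp_sub, jumpOp_dual (fun x => ∏ i, u t (x i))]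
      have := attractOp_prod_nonneg (hu.nonneg t) x
      linarith
  have h := hsub.nonpos (fun i x => (by positivity : 0 ≤ m / 2).trans (le_dualRate m i x))
    (sum_dualRate_le m) (fun x => by simp [h0]) (B := Real.exp β) (Real.exp_pos β).le
    (fun x => ⟨B ^ n * Real.exp (β * ∑ j, |(x j : ℝ)|), fun l s hs => ?_⟩) x (s := S) ⟨hS, le_rfl⟩
  · linarith
  · set y := pathEnd dualMove l x
    have h1 := sum_abs_pathEnd_le l x
    have h2 : (1 : ℝ) ≤ (l.length.factorial : ℝ) := by exact_mod_cast Nat.factorial_pos _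
    calc ∏ i, u s (y i) - F s y ≤ ∏ i, u s (y i) := sub_le_self _ (hF.nonneg s y)
      _ ≤ ∏ i, (B * Real.exp (β * |(y i : ℝ)|)) :=
        Finset.prod_le_prod (fun i _ => hu.nonneg s _) fun i _ => huB s hs _
      _ = B ^ n * Real.exp (β * ∑ j, |(y j : ℝ)|) := by
        rw [Finset.prod_mul_distrib, ← Real.exp_sum, ← Finset.mul_sum]; simp
      _ ≤ B ^ n * Real.exp (β * (∑ j, |(x j : ℝ)| + l.length)) := by gcongr
      _ = B ^ n * Real.exp (β * ∑ j, |(x j : ℝ)|) * Real.exp β ^ l.length := by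
        rw [mul_add, Real.exp_add, ← Real.exp_nat_mul, mul_comm β (l.length : ℝ)]; ring
      _ ≤ _ := le_mul_of_one_le_right (by positivity) h2

/-- A pointwise bound of the interaction term of a product function. -/
lemma interaction_term_le {v : ℤ → ℝ} (hv : ∀ a, 0 ≤ v a) {B β ε : ℝ} (hB : 0 ≤ B) (hβ : 0 ≤ β)
    (hvB : ∀ a : ℤ, v a ≤ B * Real.exp (β * |(a : ℝ)|))
    (hvg : ∀ a : ℤ, (v (a + 1) - v a) ^ 2 ≤ ε * (B ^ 2 * Real.exp (2 * β * |(a : ℝ)|)))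
    (hε : 0 ≤ ε) (x : Fin n → ℤ) {X : ℝ} (hX : ∀ i, |(x i : ℝ)| ≤ X) (k l : Fin n) :
    adj (x k) (x l) * (v (x l) - v (x k)) ^ 2 * prodExcept v x {k, l} ≤
      adj (x k) (x l) * (ε * (B ^ n * Real.exp (n * β * X))) := by
  by_cases hkl : k = l
  · subst hkl; simp [adj_self]
  by_cases hadj : |x k - x l| = 1
  swap
  · simp [adj, hadj]
  rw [mul_assoc]
  refine mul_le_mul_of_nonneg_left ?_ (adj_nonneg _ _)
  have h1 : (v (x l) - v (x k)) ^ 2 ≤ ε * (B ^ 2 * Real.exp (2 * β * X)) := by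
    have hmono : ∀ i, ε * (B ^ 2 * Real.exp (2 * β * |(x i : ℝ)|)) ≤
        ε * (B ^ 2 * Real.exp (2 * β * X)) := by
      intro i
      have := hX i
      gcongr
    rcases adj_iff.1 hadj with h | h
    · rw [h]; exact (hvg (x k)).trans (hmono k)
    · have h' : x k = x l + 1 := by omega
      have := (hvg (x l)).trans (hmono l)
      rw [← h'] at this
      rw [← neg_sub, neg_sq]
      exact this
  have hcard : (({k, l} : Finset (Fin n))ᶜ).card = n - 2 := by
    rw [Finset.card_compl, Finset.card_pair hkl, Fintype.card_fin]
  have hn : 2 ≤ n := by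
    have := Finset.card_le_univ ({k, l} : Finset (Fin n))
    rwa [Finset.card_pair hkl, Fintype.card_fin] at this
  have h2 : prodExcept v x {k, l} ≤ (B * Real.exp (β * X)) ^ (n - 2) := by
    rw [← hcard, ← Finset.prod_const]
    refine Finset.prod_le_prod (fun i _ => hv _) fun i _ => (hvB _).trans ?_
    have := hX i
    gcongr
  calc (v (x l) - v (x k)) ^ 2 * prodExcept v x {k, l}
      ≤ ε * (B ^ 2 * Real.exp (2 * β * X)) * (B * Real.exp (β * X)) ^ (n - 2) :=
        mul_le_mul h1 h2 (Finset.prod_nonneg fun i _ => hv _) (by positivity)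
    _ = ε * ((B * Real.exp (β * X)) ^ 2 * (B * Real.exp (β * X)) ^ (n - 2)) := by
        rw [mul_pow B _ 2, ← Real.exp_nat_mul]; push_cast; ring_nf
    _ = ε * (B ^ n * Real.exp (n * β * X)) := by
        rw [← pow_add, Nat.add_sub_cancel' hn, mul_pow, ← Real.exp_nat_mul]
        ring_nf

/-- Weighted Young inequality based on `σ⁻¹ = σ ^ (-3/8) * σ ^ (-5/8)`. The first part has no
spatial growth and is a source for the pair barrier; the second carries the growth `Y ^ 2` but is
integrable in time. The parameter `κ` shifts cost between them. -/
lemma young_rpow {σ κ Y : ℝ} (hσ : 0 < σ) (hκ : 0 < κ) :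
    Y / σ ≤ 1 / 2 * (κ⁻¹ * σ ^ (-(3 / 4) : ℝ) + κ * (Y ^ 2 * σ ^ (-(5 / 4) : ℝ))) := by
  set p := σ ^ (-(3 / 8) : ℝ) with hp
  set q := σ ^ (-(5 / 8) : ℝ) with hq
  have h1 : σ ^ (-(3 / 4) : ℝ) = p * p := by rw [hp, ← Real.rpow_add hσ]; norm_num
  have h2 : σ ^ (-(5 / 4) : ℝ) = q * q := by rw [hq, ← Real.rpow_add hσ]; norm_num
  have h3 : σ⁻¹ = p * q := by
    rw [hp, hq, ← Real.rpow_add hσ, ← Real.rpow_neg_one]; norm_num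
  rw [h1, h2, div_eq_mul_inv, h3]
  have h4 : 0 ≤ κ⁻¹ * (p - κ * (Y * q)) ^ 2 := by positivity
  have h5 : κ⁻¹ * (p - κ * (Y * q)) ^ 2 =
      κ⁻¹ * (p * p) + κ * (Y ^ 2 * (q * q)) - 2 * (Y * (p * q)) := by
    field_simp
    ring
  linarith

lemma pairSum_nonneg {g : ℤ → ℝ} (hg : ∀ d, 0 ≤ g d) (x : Fin n → ℤ) : 0 ≤ pairSum g x :=
  Finset.sum_nonneg fun i _ => Finset.sum_nonneg fun j _ => by
    split_ifs
    · exact le_rfl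
    · exact hg _

lemma pairSum_mono {g h : ℤ → ℝ} (hg : ∀ d, g d ≤ h d) (x : Fin n → ℤ) :
    pairSum g x ≤ pairSum h x :=
  Finset.sum_le_sum fun i _ => Finset.sum_le_sum fun j _ => by
    split_ifs
    · exact le_rfl
    · exact hg _

lemma pairSum_le {g : ℤ → ℝ} {c : ℝ} (hc : 0 ≤ c) (hg : ∀ d, g d ≤ c) (x : Fin n → ℤ) :
    pairSum g x ≤ n ^ 2 * c := by
  calc pairSum g x ≤ ∑ _i : Fin n, ∑ _j : Fin n, c :=
        Finset.sum_le_sum fun i _ => Finset.sum_le_sum fun j _ => by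
          split_ifs
          · exact hc
          · exact hg _
    _ = n ^ 2 * c := by simp; ring

lemma pairSum_add (g h : ℤ → ℝ) (x : Fin n → ℤ) :
    pairSum (fun d => g d + h d) x = pairSum g x + pairSum h x := by
  simp only [pairSum, ← Finset.sum_add_distrib]
  refine Finset.sum_congr rfl fun i _ => Finset.sum_congr rfl fun j _ => ?_
  split_ifs <;> simp

lemma pairSum_adj (c : ℝ) (x : Fin n → ℤ) :
    pairSum (fun d => if |d| = 1 then c else 0) x = ∑ k, ∑ l, adj (x k) (x l) * c := by
  refine Finset.sum_congr rfl fun i _ => Finset.sum_congr rfl fun j _ => ?_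
  by_cases h : i = j
  · subst h; simp [adj_self]
  · simp [h, adj]

lemma hasDerivAt_pairSum {Φ Φ' : ℝ → ℤ → ℝ} {s : ℝ}
    (h : ∀ d, HasDerivAt (fun s => Φ s d) (Φ' s d) s) (x : Fin n → ℤ) :
    HasDerivAt (fun s => pairSum (Φ s) x) (pairSum (Φ' s) x) s := by
  unfold pairSum
  refine HasDerivAt.fun_sum fun i _ => HasDerivAt.fun_sum fun j _ => ?_
  split_ifs
  · exact hasDerivAt_const _ _
  · exact h _

/-- Decorrelation: the correlation functions are close to products of one-particle functions at
large times. -/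
theorem exists_decorrelation (hm : 0 < m) (n : ℕ) : ∃ (a σ₀ K : ℝ), 0 < a ∧ 1 ≤ σ₀ ∧ 0 ≤ K ∧
    ∀ (F : ℝ → (Fin n → ℤ) → ℝ) (u : ℝ → ℤ → ℝ), IsNonnegSolution (dualRate m) dualMove F →
    IsNonnegSolution (walkRate m) walkMove u → (∀ x, F 0 x = ∏ i, u 0 (x i)) →
    ∀ S B β κ : ℝ, 0 ≤ S → 0 ≤ B → 0 ≤ β → 0 < κ →
    (∀ s ∈ Set.Icc 0 S, ∀ a : ℤ, u s a ≤ B * Real.exp (β * |(a : ℝ)|)) →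
    (∀ s ∈ Set.Icc 0 S, ∀ a : ℤ, (1 + s) * (u s (a + 1) - u s a) ^ 2 ≤
      B ^ 2 * Real.exp (2 * β * |(a : ℝ)|)) →
    ∀ x : Fin n → ℤ, F S x - ∏ i, u S (x i) ≤ K * B ^ n * (κ⁻¹ * (σ₀ + S) ^ (-a) +
      κ * Real.exp (m * (Real.cosh (2 * n * β) - 1) * S) *
        ∑ j, Real.cosh (2 * n * β * x j)) := by
  obtain ⟨a, σ₀, C, Φ, Φ', ha, hσ₀, hC, hsymm, hpos, hle, hder, hsup⟩ := exists_pair_barrier hm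
  have hσpos : 0 < σ₀ := by linarith
  refine ⟨a, σ₀, σ₀ * n ^ 2 * (C + 4), ha, hσ₀, by positivity, ?_⟩
  intro F u hF hu h0 S B β κ hS hB hβ hκ huB hug
  set lam := m * (Real.cosh (2 * n * β) - 1) with hlam
  have hlam0 : 0 ≤ lam := by
    have := Real.one_le_cosh (2 * n * β)
    exact mul_nonneg hm.le (by linarith)
  -- An eigenfunction of the whole labelled generator with eigenvalue `lam`. The exponent `2 n β` is
  -- needed to dominate `Y ^ 2`, where `Y` stands for the growth of a product of `n` factors.
  set Om : (Fin n → ℤ) → ℝ := fun x => ∑ j, Real.cosh (2 * n * β * x j) with hOm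
  have hOm0 : ∀ x, 0 ≤ Om x := fun x => Finset.sum_nonneg fun j _ => (Real.cosh_pos _).le
  -- The primitive of `(σ₀ + s) ^ (-5/4)` that is nonnegative from time zero on (as `σ₀ ≥ 1`) and
  -- never exceeds 4.
  set J : ℝ → ℝ := fun s => 4 - 4 * (σ₀ + s) ^ (-(1 / 4) : ℝ) with hJ
  have hJ0 : ∀ s, 0 ≤ s → 0 ≤ J s := by
    intro s hs
    have : (σ₀ + s) ^ (-(1 / 4) : ℝ) ≤ 1 := Real.rpow_le_one_of_one_le_of_nonpos (by linarith)
      (by norm_num)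
    simp only [hJ]; linarith
  have hJ4 : ∀ s, 0 ≤ s → J s ≤ 4 := by
    intro s hs
    have : 0 ≤ (σ₀ + s) ^ (-(1 / 4) : ℝ) := Real.rpow_nonneg (by linarith) _
    simp only [hJ]; linarith
  have hJd : ∀ s, 0 ≤ s → HasDerivAt J ((σ₀ + s) ^ (-(5 / 4) : ℝ)) s := by
    intro s hs
    have h1 : HasDerivAt (fun s => (σ₀ + s) ^ (-(1 / 4) : ℝ))
        (-(1 / 4) * (σ₀ + s) ^ (-(1 / 4) - 1 : ℝ)) s :=
      (Real.hasDerivAt_rpow_const (x := σ₀ + s) (p := -(1 / 4))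
        (Or.inl (by linarith))).comp_const_add σ₀ s
    refine ((h1.const_mul 4).const_sub 4).congr_deriv ?_
    rw [show (-(1 / 4) - 1 : ℝ) = -(5 / 4) by norm_num]
    ring
  set D := σ₀ * B ^ n / 2 with hD
  have hD0 : 0 ≤ D := by positivity
  -- Supersolution for the error: the pair barrier pays for the first part of Young's inequality,
  -- the weight `Om` with the time factor `J` for the second.
  set Ψ : ℝ → (Fin n → ℤ) → ℝ := fun s x => D * (κ⁻¹ / 2 * pairSum (Φ s) x) +
    D * (κ * n ^ 2 * (J s * Real.exp (lam * s)) * Om x) with hΨ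
  have hΨ0 : ∀ s x, 0 ≤ s → 0 ≤ Ψ s x := by
    intro s x hs
    have h1 := pairSum_nonneg (fun d => hpos s d hs) x
    have h2 := hJ0 s hs
    have h3 := hOm0 x
    simp only [hΨ]; positivity
  have hΨd : ∀ s x, 0 ≤ s → HasDerivAt (fun s => Ψ s x)
      (D * (κ⁻¹ / 2 * pairSum (Φ' s) x) + D * (κ * n ^ 2 * ((σ₀ + s) ^ (-(5 / 4) : ℝ) *
        Real.exp (lam * s) + J s * (Real.exp (lam * s) * lam)) * Om x)) s := by
    intro s x hs
    have h1 : HasDerivAt (fun s => Real.exp (lam * s)) (Real.exp (lam * s) * lam) s := by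
      simpa using ((hasDerivAt_id s).const_mul lam).exp
    exact (((hasDerivAt_pairSum (fun d => hder s d hs) x).const_mul _).const_mul D).add
      (((((hJd s hs).mul h1).const_mul _).mul_const _).const_mul D)
  have hOmL : ∀ x, jumpOp (dualRate m) dualMove Om x = lam * Om x := by
    intro x
    have := jumpOp_dual_sum (m := m) (fun a : ℤ => Real.cosh (2 * n * β * a)) x
    simp only [hOm]
    rw [this]
    simp only [lap_cosh]
    rw [← Finset.mul_sum, hlam]
    ring
  have hΨL : ∀ s x, jumpOp (dualRate m) dualMove (Ψ s) x =
      D * (κ⁻¹ / 2 * pairSum (pairOp m (Φ s)) x) +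
      D * (κ * n ^ 2 * (J s * Real.exp (lam * s)) * (lam * Om x)) := by
    intro s x
    simp only [hΨ]
    rw [jumpOp_add, jumpOp_const_mul, jumpOp_const_mul, jumpOp_const_mul, jumpOp_const_mul, hOmL,
      jumpOp_dual_pairSum (hsymm s)]
  have hkey : ∀ s ∈ Set.Icc 0 S, ∀ x, attractOp (fun x => ∏ i, u s (x i)) x +
      jumpOp (dualRate m) dualMove (Ψ s) x ≤ D * (κ⁻¹ / 2 * pairSum (Φ' s) x) +
      D * (κ * n ^ 2 * ((σ₀ + s) ^ (-(5 / 4) : ℝ) *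
        Real.exp (lam * s) + J s * (Real.exp (lam * s) * lam)) * Om x) := by
    intro s hs x
    have hs0 := hs.1
    have hσ : 0 < σ₀ + s := by linarith
    rw [hΨL]
    have h1 : pairSum (pairOp m (Φ s)) x + ∑ k, ∑ l, adj (x k) (x l) * (σ₀ + s) ^ (-(3 / 4) : ℝ) ≤
        pairSum (Φ' s) x := by
      rw [← pairSum_adj, ← pairSum_add]
      exact pairSum_mono (fun d => hsup s d hs0) x
    have h2 : attractOp (fun x => ∏ i, u s (x i)) x ≤ D * (κ⁻¹ / 2 *
        ∑ k, ∑ l, adj (x k) (x l) * (σ₀ + s) ^ (-(3 / 4) : ℝ)) +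
        D * (κ * n ^ 2 * ((σ₀ + s) ^ (-(5 / 4) : ℝ) * Real.exp (lam * s)) * Om x) := by
      rcases Nat.eq_zero_or_pos n with hn | hn
      · subst hn; simp [attractOp]
      have : Nonempty (Fin n) := ⟨⟨0, hn⟩⟩
      obtain ⟨j₀, hj₀⟩ := Finite.exists_max fun i => |(x i : ℝ)|
      set Y := Real.exp (n * β * |(x j₀ : ℝ)|) with hY
      have hY2 : Y ^ 2 ≤ 2 * Om x := by
        have e1 : Y ^ 2 = Real.exp |2 * n * β * x j₀| := by
          rw [hY, ← Real.exp_nat_mul, abs_mul, abs_of_nonneg (by positivity : 0 ≤ 2 * n * β)]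
          push_cast; ring_nf
        rw [e1]
        refine (exp_abs_le_two_cosh _).trans ?_
        gcongr
        exact Finset.single_le_sum (f := fun j => Real.cosh (2 * n * β * x j))
          (fun j _ => (Real.cosh_pos _).le) (Finset.mem_univ j₀)
      have hterm : ∀ k l, adj (x k) (x l) * (u s (x l) - u s (x k)) ^ 2 *
          prodExcept (u s) x {k, l} ≤ adj (x k) (x l) * (σ₀ / (σ₀ + s) * (B ^ n * Y)) := by
        intro k l
        refine interaction_term_le (hu.nonneg s) hB hβ (huB s hs) ?_ (by positivity) x hj₀ k l
        intro a
        have e1 := hug s hs a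
        have e2 : 1 / (1 + s) ≤ σ₀ / (σ₀ + s) := by
          rw [div_le_div_iff₀ (by linarith) hσ]; nlinarith
        calc (u s (a + 1) - u s a) ^ 2 ≤ 1 / (1 + s) * (B ^ 2 * Real.exp (2 * β * |(a : ℝ)|)) := by
              rw [div_mul_eq_mul_div, one_mul, le_div_iff₀ (by linarith)]; linarith
          _ ≤ _ := by gcongr
      have hyoung := young_rpow (Y := Y) hσ hκ
      have hbound : ∀ k l, adj (x k) (x l) * (σ₀ / (σ₀ + s) * (B ^ n * Y)) ≤
          D * (κ⁻¹ * (adj (x k) (x l) * (σ₀ + s) ^ (-(3 / 4) : ℝ))) +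
          D * (2 * κ * ((σ₀ + s) ^ (-(5 / 4) : ℝ) * Real.exp (lam * s)) * Om x) := by
        intro k l
        have e1 : σ₀ / (σ₀ + s) * (B ^ n * Y) = 2 * D * (Y / (σ₀ + s)) := by rw [hD]; field_simp
        have e2 : 1 ≤ Real.exp (lam * s) := Real.one_le_exp (by positivity)
        have e3 : 0 < (σ₀ + s) ^ (-(5 / 4) : ℝ) := Real.rpow_pos_of_pos hσ _
        have e4 : Y ^ 2 * (σ₀ + s) ^ (-(5 / 4) : ℝ) ≤
            2 * ((σ₀ + s) ^ (-(5 / 4) : ℝ) * Real.exp (lam * s)) * Om x := by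
          calc Y ^ 2 * (σ₀ + s) ^ (-(5 / 4) : ℝ) ≤ 2 * Om x * (σ₀ + s) ^ (-(5 / 4) : ℝ) := by gcongr
            _ ≤ 2 * Om x * (σ₀ + s) ^ (-(5 / 4) : ℝ) * Real.exp (lam * s) :=
              le_mul_of_one_le_right (by have := hOm0 x; positivity) e2
            _ = _ := by ring
        have e5 := mul_le_mul_of_nonneg_left e4 hκ.le
        have e6 := adj_nonneg (x k) (x l)
        have e7 := adj_le_one (x k) (x l)
        set w := 2 * ((σ₀ + s) ^ (-(5 / 4) : ℝ) * Real.exp (lam * s)) * Om x with hw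
        have hw0 : 0 ≤ w := by have := hOm0 x; positivity
        rw [e1]
        calc adj (x k) (x l) * (2 * D * (Y / (σ₀ + s)))
            ≤ adj (x k) (x l) * (2 * D * (1 / 2 * (κ⁻¹ * (σ₀ + s) ^ (-(3 / 4) : ℝ) + κ * w))) := by
              gcongr
              linarith
          _ = D * (κ⁻¹ * (adj (x k) (x l) * (σ₀ + s) ^ (-(3 / 4) : ℝ))) +
              adj (x k) (x l) * (D * (κ * w)) := by ring
          _ ≤ D * (κ⁻¹ * (adj (x k) (x l) * (σ₀ + s) ^ (-(3 / 4) : ℝ))) + 1 * (D * (κ * w)) := by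
              gcongr
          _ = _ := by rw [hw]; ring
      rw [attractOp_prod]
      have hsum : ∑ k, ∑ l, adj (x k) (x l) * (u s (x l) - u s (x k)) ^ 2 *
          prodExcept (u s) x {k, l} ≤ ∑ k : Fin n, ∑ l : Fin n,
          (D * (κ⁻¹ * (adj (x k) (x l) * (σ₀ + s) ^ (-(3 / 4) : ℝ))) +
          D * (2 * κ * ((σ₀ + s) ^ (-(5 / 4) : ℝ) * Real.exp (lam * s)) * Om x)) :=
        Finset.sum_le_sum fun k _ => Finset.sum_le_sum fun l _ => (hterm k l).trans (hbound k l)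
      simp only [Finset.sum_add_distrib, ← Finset.mul_sum, Finset.sum_const, Finset.card_univ,
        Fintype.card_fin, nsmul_eq_mul] at hsum
      calc _ ≤ 1 / 2 * _ := mul_le_mul_of_nonneg_left hsum (by norm_num)
        _ = _ := by
          simp only [← Finset.sum_mul]
          ring
    have h3 := mul_le_mul_of_nonneg_left h1 (by positivity : 0 ≤ D * (κ⁻¹ / 2))
    linarith
  have hsub : IsSubsolution (dualRate m) dualMove S
      (fun s x => F s x - ∏ i, u s (x i) - Ψ s x) := by
    constructor
    · intro x
      refine ContinuousOn.sub (ContinuousOn.sub ((hF.cont x).mono fun t ht => ht.1)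
        (continuousOn_finsetProd _ fun i _ => (hu.cont _).mono fun t ht => ht.1)) ?_
      intro t ht
      exact (hΨd t x ht.1).continuousAt.continuousWithinAt
    · intro x t ht
      refine ⟨_, ((hF.deriv x t ht.1).sub (hasDerivAt_prod_walk hu x ht.1)).sub
        (hΨd t x ht.1.le), ?_⟩
      rw [jumpOp_sub _ _ (fun x => F t x - ∏ i, u t (x i)), jumpOp_sub,
        jumpOp_dual (fun x => ∏ i, u t (x i))]
      have := hkey t ⟨ht.1.le, ht.2.le⟩ x
      linarith
  intro x
  -- Both subtracted terms are nonnegative, so the Harnack growth of `F`, with all rates at least `m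
  -- / 2`, suffices for comparison.
  have h := hsub.nonpos (fun i x => (by positivity : 0 ≤ m / 2).trans (le_dualRate m i x))
    (sum_dualRate_le m) (fun x => by have := hΨ0 0 x le_rfl; simp only [h0]; linarith)
    (B := Real.exp 1 / (m / 2)) (by positivity) (fun x => ?_) x (s := S) ⟨hS, le_rfl⟩
  · have e1 := pairSum_le (x := x) (by have := Real.rpow_nonneg (by linarith : 0 ≤ σ₀ + S) (-a)
                                       positivity) (fun d => hle S d hS)
    have e2 := hJ4 S hS
    have e3 := hOm0 x
    set Ex := Real.exp (lam * S) with hEx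
    have e4 : 0 < Ex := Real.exp_pos _
    have e5 : 0 ≤ (σ₀ + S) ^ (-a) := Real.rpow_nonneg (by linarith) _
    have e6 : Ψ S x ≤ D * (κ⁻¹ / 2 * (n ^ 2 * (C * (σ₀ + S) ^ (-a)))) +
        D * (κ * n ^ 2 * (4 * Ex) * Om x) := by
      simp only [hΨ]
      gcongr
    have e7 : D * (κ⁻¹ / 2 * (n ^ 2 * (C * (σ₀ + S) ^ (-a)))) ≤
        σ₀ * n ^ 2 * (C + 4) * B ^ n * (κ⁻¹ * (σ₀ + S) ^ (-a)) := by
      rw [hD]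
      have : 0 ≤ σ₀ * n ^ 2 * B ^ n * (κ⁻¹ * (σ₀ + S) ^ (-a)) := by positivity
      nlinarith [mul_nonneg this hC]
    have e8 : D * (κ * n ^ 2 * (4 * Ex) * Om x) ≤
        σ₀ * n ^ 2 * (C + 4) * B ^ n * (κ * Ex * Om x) := by
      rw [hD]
      have : 0 ≤ σ₀ * n ^ 2 * B ^ n * (κ * Ex * Om x) := by positivity
      nlinarith [mul_nonneg this hC]
    rw [mul_add]
    linarith
  · obtain ⟨A, hA⟩ := hF.growth (by positivity : 0 < m / 2) (le_dualRate m) (sum_dualRate_le m) S x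
    refine ⟨A, fun l t ht => le_trans ?_ (hA l t ht)⟩
    have e1 := hΨ0 t (pathEnd dualMove l x) ht.1
    have e2 : 0 ≤ ∏ i, u t (pathEnd dualMove l x i) := Finset.prod_nonneg fun i _ => hu.nonneg t _
    linarith

end chaos

/-! ### Maximum principle and uniqueness for the diffusion equation -/

section maximumPrinciple

/-- A negative second derivative would make the point a local maximum as well; the function would be
locally constant and the second derivative zero. -/
lemma deriv_deriv_nonneg_of_isLocalMin {f : ℝ → ℝ} {y : ℝ} (hf : ContinuousAt f y)
    (h : IsLocalMin f y) : 0 ≤ deriv (deriv f) y := by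
  by_contra hneg
  have hmax : IsLocalMax f y := isLocalMax_of_deriv_deriv_neg (not_le.1 hneg) h.deriv_eq_zero hf
  have hc : f =ᶠ[𝓝 y] fun _ => f y := by
    filter_upwards [h, hmax] with z h1 h2
    exact le_antisymm h2 h1
  have h1 : deriv f =ᶠ[𝓝 y] deriv (fun _ => f y) := hc.deriv
  rw [h1.deriv_eq] at hneg
  simp at hneg

/-- Only earlier times are compared, since the minimum to which this is applied may lie on the final
time slice. -/
lemma deriv_nonpos_of_le_left {f : ℝ → ℝ} {f' s : ℝ} (hs : 0 < s) (hf : HasDerivAt f f' s)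
    (h : ∀ r ∈ Set.Icc 0 s, f s ≤ f r) : f' ≤ 0 := by
  have h1 := (hasDerivWithinAt_iff_tendsto_slope' (s := Set.Iio s) (by simp)).1
    hf.hasDerivWithinAt
  refine le_of_tendsto h1 ?_
  have h2 : ∀ᶠ r in 𝓝[<] s, r ∈ Set.Ioo 0 s := Ioo_mem_nhdsLT hs
  filter_upwards [h2] with r hr
  rw [slope_def_field]
  exact div_nonpos_of_nonneg_of_nonpos (by linarith [h r ⟨hr.1.le, hr.2.le⟩]) (by linarith [hr.2])

lemma hasDerivAt_cosh_mul (b y : ℝ) :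
    HasDerivAt (fun y => Real.cosh (b * y)) (b * Real.sinh (b * y)) y := by
  have := (((hasDerivAt_id y).const_mul b).cosh)
  simpa [mul_comm] using this

lemma hasDerivAt_sinh_mul (b y : ℝ) :
    HasDerivAt (fun y => Real.sinh (b * y)) (b * Real.cosh (b * y)) y := by
  have := (((hasDerivAt_id y).const_mul b).sinh)
  simpa [mul_comm] using this

/-- Maximum principle for the diffusion equation. -/
theorem IsDiffusionSolution.nonneg {κ : ℝ} (hκ : 0 < κ) {φ : ℝ → ℝ} {w : ℝ → ℝ → ℝ}
    (hw : IsDiffusionSolution κ φ w) (hφ : ∀ y, 0 ≤ φ y) {T : ℝ} (hT : 0 ≤ T) (y₁ : ℝ) :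
    0 ≤ w T y₁ := by
  obtain ⟨C, a, hg⟩ := hw.growth T
  set b := |a| + 1 with hb
  -- With `b = |a| + 1` the function `cosh (b y)` outgrows the solution; the `+ 1` makes `exp (K s)
  -- * cosh (b y)` a strict supersolution, which is what contradicts a negative minimum.
  set K := κ * b ^ 2 + 1 with hK
  have key : ∀ ε > 0, 0 ≤ w T y₁ + ε * (Real.exp (K * T) * Real.cosh (b * y₁)) := by
    intro ε hε
    set V : ℝ × ℝ → ℝ := fun q => w q.1 q.2 + ε * (Real.exp (K * q.1) * Real.cosh (b * q.2)) with hV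
    -- Large enough that the perturbed function is positive on the lateral boundary and that the
    -- window contains `y₁`.
    set R := max (|y₁| + 1) (2 * |C| / ε) with hR
    have hR1 : |y₁| + 1 ≤ R := le_max_left _ _
    have hR0 : 0 < R := by linarith [abs_nonneg y₁]
    have hRC : |C| * Real.exp (a * R) < ε * Real.cosh (b * R) := by
      have h1 : 2 * |C| / ε ≤ R := le_max_right _ _
      have h2 : R + 1 ≤ Real.exp R := Real.add_one_le_exp R
      have h3 : 2 * |C| < ε * Real.exp R := by
        rw [div_le_iff₀ hε] at h1
        nlinarith
      have h4 : Real.exp (b * R) ≤ 2 * Real.cosh (b * R) := by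
        have := exp_abs_le_two_cosh (b * R)
        exact (Real.exp_le_exp.2 (le_abs_self _)).trans this
      have h5 : Real.exp (a * R) ≤ Real.exp (|a| * R) := by
        gcongr
        exact le_abs_self a
      have h6 : Real.exp (b * R) = Real.exp (|a| * R) * Real.exp R := by
        rw [← Real.exp_add, hb]; ring_nf
      have h7 := Real.exp_pos (|a| * R)
      calc |C| * Real.exp (a * R) ≤ |C| * Real.exp (|a| * R) := by gcongr
        _ < ε * Real.exp R / 2 * Real.exp (|a| * R) := by
            apply mul_lt_mul_of_pos_right _ h7; linarith
        _ = ε * (Real.exp (b * R) / 2) := by rw [h6]; ring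
        _ ≤ _ := by gcongr; linarith
    have hcont : ContinuousOn V (Set.Icc 0 T ×ˢ Set.Icc (-R) R) := by
      refine ContinuousOn.add (hw.continuousOn.mono ?_) (Continuous.continuousOn (by fun_prop))
      exact Set.prod_mono Set.Icc_subset_Ici_self (Set.subset_univ _)
    obtain ⟨⟨s₀, y₀⟩, ⟨hs₀, hy₀⟩, hmin⟩ := (isCompact_Icc.prod isCompact_Icc).exists_isMinOn
      ⟨(0, 0), ⟨le_rfl, hT⟩, by simp [hR0.le]⟩ hcont
    have hmem : ((T, y₁) : ℝ × ℝ) ∈ Set.Icc 0 T ×ˢ Set.Icc (-R) R :=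
      ⟨⟨hT, le_rfl⟩, abs_le.1 (by linarith)⟩
    refine le_trans ?_ (hmin hmem)
    by_contra hneg
    rw [not_le] at hneg
    simp only at hs₀ hy₀
    have hK0 : 0 ≤ K := by positivity
    have hE1 : ∀ s, 0 ≤ s → 1 ≤ Real.exp (K * s) := fun s hs => Real.one_le_exp (by positivity)
    have hs0 : 0 < s₀ := by
      refine lt_of_le_of_ne hs₀.1 fun h => ?_
      subst h
      have h1 : 0 ≤ V (0, y₀) := by
        simp only [hV, hw.initial]
        have := hφ y₀
        have := Real.cosh_pos (b * y₀)
        positivity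
      linarith
    have hy0 : |y₀| < R := by
      refine lt_of_le_of_ne (abs_le.2 hy₀) fun h => ?_
      have h1 := hg s₀ hs₀ y₀
      rw [h] at h1
      have h2 : Real.cosh (b * y₀) = Real.cosh (b * R) := by
        rw [← Real.cosh_abs, abs_mul, h, ← abs_of_pos hR0, ← abs_mul, Real.cosh_abs, abs_of_pos hR0]
      have h3 : ε * Real.cosh (b * R) ≤ ε * (Real.exp (K * s₀) * Real.cosh (b * R)) := by
        gcongr
        exact le_mul_of_one_le_left (Real.cosh_pos _).le (hE1 s₀ hs0.le)
      have h4 : C * Real.exp (a * R) ≤ |C| * Real.exp (a * R) := by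
        gcongr
        exact le_abs_self C
      simp only [hV, h2] at hneg
      have := (abs_le.1 h1).1
      linarith
    rw [abs_lt] at hy0
    -- the space derivatives at the minimum
    have hC2 := hw.contDiff_space s₀ hs0
    have hd1 : Differentiable ℝ (w s₀) := hC2.differentiable (by norm_num)
    have hd2 : Differentiable ℝ (deriv (w s₀)) :=
      ((contDiff_succ_iff_deriv (n := 1)).1 hC2).2.2.differentiable (by norm_num)
    set E := Real.exp (K * s₀) with hE
    have hloc : IsLocalMin (fun y => V (s₀, y)) y₀ := by
      filter_upwards [Ioo_mem_nhds hy0.1 hy0.2] with y hy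
      exact hmin (show ((s₀, y) : ℝ × ℝ) ∈ _ from ⟨hs₀, hy.1.le, hy.2.le⟩)
    have hV1 : deriv (fun y => V (s₀, y)) = fun y => deriv (w s₀) y +
        ε * (E * (b * Real.sinh (b * y))) := by
      funext y
      exact ((hd1 y).hasDerivAt.add (((hasDerivAt_cosh_mul b y).const_mul E).const_mul ε)).deriv
    have hV2 : deriv (deriv (fun y => V (s₀, y))) y₀ = deriv (deriv (w s₀)) y₀ +
        ε * (E * (b * (b * Real.cosh (b * y₀)))) := by
      rw [hV1]
      exact ((hd2 y₀).hasDerivAt.add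
        ((((hasDerivAt_sinh_mul b y₀).const_mul b).const_mul E).const_mul ε)).deriv
    have hnn := deriv_deriv_nonneg_of_isLocalMin
      (f := fun y => V (s₀, y)) (by
        have : Continuous fun y => V (s₀, y) :=
          hd1.continuous.add (by fun_prop)
        exact this.continuousAt) hloc
    rw [hV2] at hnn
    -- the time derivative at the minimum
    have hEd : HasDerivAt (fun s => Real.exp (K * s)) (E * K) s₀ := by
      simpa using ((hasDerivAt_id s₀).const_mul K).exp
    have htd := (hw.equation s₀ y₀ hs0).add ((hEd.mul_const (Real.cosh (b * y₀))).const_mul ε)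
    have hle := deriv_nonpos_of_le_left (f := fun s => V (s, y₀)) hs0 htd (fun r hr =>
      hmin (show ((r, y₀) : ℝ × ℝ) ∈ _ from ⟨⟨hr.1, hr.2.trans hs₀.2⟩, hy₀⟩))
    rw [show iteratedDeriv 2 (w s₀) y₀ = deriv (deriv (w s₀)) y₀ by
      rw [iteratedDeriv_succ, iteratedDeriv_one]] at hle
    have h5 := mul_le_mul_of_nonneg_left hnn hκ.le
    have h6 : 0 < ε * (E * Real.cosh (b * y₀)) := by
      have := Real.cosh_pos (b * y₀)
      have := Real.exp_pos (K * s₀)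
      positivity
    have h7 : ε * (E * K * Real.cosh (b * y₀)) = κ * (ε * (E * (b * (b * Real.cosh (b * y₀))))) +
        ε * (E * Real.cosh (b * y₀)) := by rw [hK]; ring
    rw [h7] at hle
    linarith
  have hlim : Tendsto (fun ε : ℝ => w T y₁ + ε * (Real.exp (K * T) * Real.cosh (b * y₁))) (𝓝[>] 0)
      (𝓝 (w T y₁ + 0 * (Real.exp (K * T) * Real.cosh (b * y₁)))) :=
    (Continuous.tendsto (by fun_prop) 0).mono_left nhdsWithin_le_nhds
  rw [zero_mul, add_zero] at hlim
  exact ge_of_tendsto hlim (by filter_upwards [self_mem_nhdsWithin] with ε hε using key ε hε)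

lemma IsDiffusionSolution.sub {κ : ℝ} {φ₁ φ₂ : ℝ → ℝ} {w₁ w₂ : ℝ → ℝ → ℝ}
    (h₁ : IsDiffusionSolution κ φ₁ w₁) (h₂ : IsDiffusionSolution κ φ₂ w₂) :
    IsDiffusionSolution κ (fun y => φ₁ y - φ₂ y) (fun t y => w₁ t y - w₂ t y) := by
  refine ⟨h₁.continuousOn.sub h₂.continuousOn, fun y => by rw [h₁.initial, h₂.initial],
    fun t ht => (h₁.contDiff_space t ht).sub (h₂.contDiff_space t ht), fun t y ht => ?_, fun T => ?_⟩
  · refine ((h₁.equation t y ht).sub (h₂.equation t y ht)).congr_deriv ?_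
    have := iteratedDeriv_fun_sub (n := 2) (x := y) (h₁.contDiff_space t ht).contDiffAt
      (h₂.contDiff_space t ht).contDiffAt
    rw [this, mul_sub]
  · obtain ⟨C₁, a₁, hg₁⟩ := h₁.growth T
    obtain ⟨C₂, a₂, hg₂⟩ := h₂.growth T
    refine ⟨|C₁| + |C₂|, max a₁ a₂, fun t ht y => (abs_sub _ _).trans ?_⟩
    rw [add_mul]
    refine add_le_add ((hg₁ t ht y).trans ?_) ((hg₂ t ht y).trans ?_)
    · gcongr
      · exact le_abs_self _
      · exact le_max_left _ _
    · gcongr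
      · exact le_abs_self _
      · exact le_max_right _ _

/-- Uniqueness for the diffusion equation. -/
theorem IsDiffusionSolution.unique {κ : ℝ} (hκ : 0 < κ) {φ : ℝ → ℝ} {w₁ w₂ : ℝ → ℝ → ℝ}
    (h₁ : IsDiffusionSolution κ φ w₁) (h₂ : IsDiffusionSolution κ φ w₂) {t : ℝ} (ht : 0 ≤ t)
    (y : ℝ) : w₁ t y = w₂ t y := by
  have e1 := (h₁.sub h₂).nonneg hκ (fun y => by simp) ht y
  have e2 := (h₂.sub h₁).nonneg hκ (fun y => by simp) ht y
  linarith

end maximumPrinciple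

/-! ### The Gaussian solution and its derivatives -/

section heat

/-- The solution of the diffusion equation, as a Gaussian average of the initial condition. -/
noncomputable def heatSol (m : ℝ) (φ : ℝ → ℝ) (t y : ℝ) : ℝ :=
  ∫ z, φ (y + √(m * t) * z) ∂(gaussianReal 0 1)

variable {m : ℝ} {φ : ℝ → ℝ} {C a : ℝ}

lemma integrable_exp_mul_abs_gaussian (c : ℝ) :
    Integrable (fun z => Real.exp (c * |z|)) (gaussianReal 0 1) := by
  have h := (integrable_exp_mul_gaussianReal (μ := 0) (v := 1) c).add
    (integrable_exp_mul_gaussianReal (μ := 0) (v := 1) (-c))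
  refine h.mono' (by fun_prop) (ae_of_all _ fun z => ?_)
  rw [Real.norm_of_nonneg (Real.exp_pos _).le]
  simp only [Pi.add_apply]
  have h1 := Real.exp_pos (c * z)
  have h2 := Real.exp_pos (-c * z)
  rcases abs_cases z with ⟨h, -⟩ | ⟨h, -⟩ <;> rw [h]
  · linarith
  · rw [mul_neg, ← neg_mul]; linarith

lemma abs_comp_affine_le (ha : 0 ≤ a) (hC : 0 ≤ C) (hφ : ∀ y, |φ y| ≤ C * Real.exp (a * |y|))
    {r S : ℝ} (hr : 0 ≤ r) (hrS : r ≤ S) (y z : ℝ) :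
    |φ (y + r * z)| ≤ C * Real.exp (a * |y|) * Real.exp (a * S * |z|) := by
  refine (hφ _).trans ?_
  rw [mul_assoc, ← Real.exp_add]
  have h1 : |y + r * z| ≤ |y| + S * |z| := by
    refine (abs_add_le _ _).trans ?_
    rw [abs_mul, abs_of_nonneg hr]
    gcongr
  have h2 : a * |y + r * z| ≤ a * |y| + a * S * |z| := by
    calc a * |y + r * z| ≤ a * (|y| + S * |z|) := by gcongr
      _ = _ := by ring
  gcongr

/-- Time enters only through the argument of `φ`, so dominated convergence also works at time zero.
Since `√` vanishes on negative numbers, no restriction to nonnegative times is needed. -/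
lemma continuous_heatSol (hφc : Continuous φ) (ha : 0 ≤ a) (hC : 0 ≤ C)
    (hφ : ∀ y, |φ y| ≤ C * Real.exp (a * |y|)) :
    Continuous (fun q : ℝ × ℝ => heatSol m φ q.1 q.2) := by
  rw [continuous_iff_continuousAt]
  rintro ⟨t₀, y₀⟩
  unfold heatSol
  have hs : Continuous fun q : ℝ × ℝ => √(m * q.1) := by fun_prop
  have h1 : ∀ᶠ q : ℝ × ℝ in 𝓝 (t₀, y₀), √(m * q.1) < √(m * t₀) + 1 :=
    hs.continuousAt.eventually_lt continuousAt_const (by simp)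
  have h2 : ∀ᶠ q : ℝ × ℝ in 𝓝 (t₀, y₀), |q.2| < |y₀| + 1 :=
    (by fun_prop : Continuous fun q : ℝ × ℝ => |q.2|).continuousAt.eventually_lt
      continuousAt_const (by simp)
  refine continuousAt_of_dominated (bound := fun z => C * Real.exp (a * (|y₀| + 1)) *
    Real.exp (a * (√(m * t₀) + 1) * |z|)) ?_ ?_ ?_ ?_
  · exact Eventually.of_forall fun q => (by fun_prop : Continuous _).aestronglyMeasurable
  · filter_upwards [h1, h2] with q hq1 hq2
    refine ae_of_all _ fun z => ?_
    rw [Real.norm_eq_abs]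
    refine (abs_comp_affine_le ha hC hφ (Real.sqrt_nonneg _) hq1.le q.2 z).trans ?_
    gcongr
  · exact (integrable_exp_mul_abs_gaussian _).const_mul _
  · exact ae_of_all _ fun z => (by fun_prop : Continuous _).continuousAt

lemma heatSol_zero (y : ℝ) : heatSol m φ 0 y = φ y := by simp [heatSol]

lemma exists_heatSol_growth (hm : 0 < m) (ha : 0 ≤ a) (hC : 0 ≤ C)
    (hφ : ∀ y, |φ y| ≤ C * Real.exp (a * |y|)) (T : ℝ) : ∃ K, 0 ≤ K ∧ ∀ t ≤ T, ∀ y,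
      |heatSol m φ t y| ≤ K * Real.exp (a * |y|) := by
  refine ⟨C * ∫ z, Real.exp (a * √(m * T) * |z|) ∂(gaussianReal 0 1),
    mul_nonneg hC (integral_nonneg fun z => (Real.exp_pos _).le), fun t ht y => ?_⟩
  unfold heatSol
  rw [← Real.norm_eq_abs]
  have h1 := norm_integral_le_of_norm_le (f := fun z => φ (y + √(m * t) * z))
    (((integrable_exp_mul_abs_gaussian (a * √(m * T))).const_mul (C * Real.exp (a * |y|))))
    (ae_of_all _ fun z => by
      rw [Real.norm_eq_abs]
      exact abs_comp_affine_le ha hC hφ (Real.sqrt_nonneg _)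
        (Real.sqrt_le_sqrt (by gcongr)) y z)
  refine h1.trans_eq ?_
  rw [integral_const_mul]
  ring

/-- The integrand of the Gaussian moments. -/
noncomputable def momInt (φ : ℝ → ℝ) (j : ℕ) (v y z : ℝ) : ℝ :=
  φ z * ((z - y) ^ j * Real.exp (-(z - y) ^ 2 / (2 * v)))

/-- Unnormalized Gaussian moments of `φ`. -/
noncomputable def gaussMom (φ : ℝ → ℝ) (j : ℕ) (v y : ℝ) : ℝ := ∫ z, momInt φ j v y z

/-- Half of the Gaussian exponent absorbs the polynomial and the exponential factor, by completing
the square. -/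
lemma exists_poly_exp_gauss_le (j : ℕ) (a : ℝ) {c : ℝ} (hc : 0 < c) : ∃ K, 0 ≤ K ∧ ∀ w : ℝ,
    (1 + |w|) ^ j * Real.exp (a * |w|) * Real.exp (-(2 * c) * w ^ 2) ≤ K * Real.exp (-c * w ^ 2) := by
  refine ⟨(j.factorial : ℝ) * Real.exp (1 + (a + 1) ^ 2 / (4 * c)), by positivity, fun w => ?_⟩
  have h1 := Real.pow_div_factorial_le_exp (1 + |w|) (by positivity) j
  rw [div_le_iff₀ (by positivity)] at h1
  have h2 : 1 + |w| + a * |w| + -(2 * c) * w ^ 2 ≤ 1 + (a + 1) ^ 2 / (4 * c) + -c * w ^ 2 := by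
    have h3 : (a + 1) * |w| ≤ (a + 1) ^ 2 / (4 * c) + c * w ^ 2 := by
      have h4 : 0 ≤ (a + 1 - 2 * c * |w|) ^ 2 / (4 * c) := by positivity
      have h5 : (a + 1 - 2 * c * |w|) ^ 2 / (4 * c) =
          (a + 1) ^ 2 / (4 * c) + c * |w| ^ 2 - (a + 1) * |w| := by field_simp; ring
      rw [sq_abs] at h5
      linarith
    linarith
  calc (1 + |w|) ^ j * Real.exp (a * |w|) * Real.exp (-(2 * c) * w ^ 2)
      ≤ Real.exp (1 + |w|) * (j.factorial : ℝ) * Real.exp (a * |w|) *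
        Real.exp (-(2 * c) * w ^ 2) := by gcongr
    _ = (j.factorial : ℝ) * Real.exp (1 + |w| + a * |w| + -(2 * c) * w ^ 2) := by
      simp only [Real.exp_add]; ring
    _ ≤ (j.factorial : ℝ) * Real.exp (1 + (a + 1) ^ 2 / (4 * c) + -c * w ^ 2) := by gcongr
    _ = _ := by rw [Real.exp_add]; ring

lemma exp_growth_shift (ha : 0 ≤ a) (hC : 0 ≤ C) (hφ : ∀ y, |φ y| ≤ C * Real.exp (a * |y|))
    (y z : ℝ) : |φ z| ≤ C * Real.exp (a * |y|) * Real.exp (a * |z - y|) := by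
  refine (hφ z).trans ?_
  rw [mul_assoc, ← Real.exp_add, ← mul_add]
  have : |z| ≤ |y| + |z - y| := by
    have := abs_add_le y (z - y)
    rwa [add_sub_cancel] at this
  gcongr

/-- Domination of the integrands, locally uniformly in the parameters. -/
lemma exists_momInt_le (ha : 0 ≤ a) (hC : 0 ≤ C) (hφ : ∀ y, |φ y| ≤ C * Real.exp (a * |y|))
    (j : ℕ) {V : ℝ} (hV : 0 < V) (y₀ : ℝ) : ∃ K, 0 ≤ K ∧ ∀ v ∈ Set.Ioc 0 V, ∀ y,
      |y - y₀| ≤ 1 → ∀ z, |momInt φ j v y z| ≤ K * Real.exp (-(1 / (8 * V)) * (z - y₀) ^ 2) := by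
  obtain ⟨K, hK, hKw⟩ := exists_poly_exp_gauss_le j a (show 0 < 1 / (8 * V) by positivity)
  refine ⟨C * Real.exp (a * |y₀|) * Real.exp (1 / (2 * V)) * K, by positivity,
    fun v hv y hy z => ?_⟩
  have hv0 := hv.1
  have h1 : |z - y| ≤ 1 + |z - y₀| := by
    have h := abs_add_le (y₀ - y) (z - y₀)
    rw [show y₀ - y + (z - y₀) = z - y by ring, abs_sub_comm y₀ y] at h
    linarith
  have h2 : -(z - y) ^ 2 / (2 * v) ≤ 1 / (2 * V) + -(2 * (1 / (8 * V))) * (z - y₀) ^ 2 := by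
    have h3 : (z - y₀) ^ 2 ≤ 2 * (z - y) ^ 2 + 2 := by
      have h4 : (y - y₀) ^ 2 ≤ 1 := by rw [sq_le_one_iff_abs_le_one]; exact hy
      nlinarith [sq_nonneg ((z - y) - (y - y₀))]
    have h5 : -(z - y) ^ 2 / (2 * v) ≤ -(z - y) ^ 2 / (2 * V) := by
      rw [neg_div, neg_div, neg_le_neg_iff]
      have := hv.2
      gcongr
    have h6 : 1 / (2 * V) + -(2 * (1 / (8 * V))) * (z - y₀) ^ 2 =
        (2 - (z - y₀) ^ 2) / (4 * V) := by field_simp; ring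
    have h7 : -(z - y) ^ 2 / (2 * V) = (-2 * (z - y) ^ 2) / (4 * V) := by field_simp; ring
    rw [h6]
    refine h5.trans ?_
    rw [h7]
    gcongr
    linarith
  unfold momInt
  rw [abs_mul, abs_mul, abs_pow, abs_of_pos (Real.exp_pos _)]
  calc |φ z| * (|z - y| ^ j * Real.exp (-(z - y) ^ 2 / (2 * v)))
      ≤ (C * Real.exp (a * |y₀|) * Real.exp (a * |z - y₀|)) * ((1 + |z - y₀|) ^ j *
        (Real.exp (1 / (2 * V)) * Real.exp (-(2 * (1 / (8 * V))) * (z - y₀) ^ 2))) := by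
        rw [← Real.exp_add (1 / (2 * V))]
        gcongr
        exact exp_growth_shift ha hC hφ y₀ z
    _ = C * Real.exp (a * |y₀|) * Real.exp (1 / (2 * V)) * ((1 + |z - y₀|) ^ j *
        Real.exp (a * |z - y₀|) * Real.exp (-(2 * (1 / (8 * V))) * (z - y₀) ^ 2)) := by ring
    _ ≤ C * Real.exp (a * |y₀|) * Real.exp (1 / (2 * V)) *
        (K * Real.exp (-(1 / (8 * V)) * (z - y₀) ^ 2)) :=
        mul_le_mul_of_nonneg_left (hKw _) (by positivity)
    _ = _ := by ring

lemma integrable_gauss_shift {c : ℝ} (hc : 0 < c) (K y₀ : ℝ) :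
    Integrable fun z : ℝ => K * Real.exp (-c * (z - y₀) ^ 2) :=
  ((integrable_exp_neg_mul_sq hc).comp_sub_right y₀).const_mul K

lemma continuous_momInt (hφc : Continuous φ) (j : ℕ) (v y : ℝ) :
    Continuous (momInt φ j v y) := by
  unfold momInt
  fun_prop

lemma integrable_momInt (hφc : Continuous φ) (ha : 0 ≤ a) (hC : 0 ≤ C)
    (hφ : ∀ y, |φ y| ≤ C * Real.exp (a * |y|)) (j : ℕ) {v : ℝ} (hv : 0 < v) (y : ℝ) :
    Integrable (momInt φ j v y) := by
  obtain ⟨K, -, hK⟩ := exists_momInt_le ha hC hφ j hv y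
  exact (integrable_gauss_shift (by positivity) K y).mono' (continuous_momInt hφc j v y).aestronglyMeasurable
    (ae_of_all _ fun z => hK v ⟨hv, le_rfl⟩ y (by simp) z)

/-- In kernel form the derivative never falls on `φ`, and the family of moments is closed under it.
For `j = 0` the truncated `j - 1` has coefficient zero. -/
lemma hasDerivAt_gaussMom_space (hφc : Continuous φ) (ha : 0 ≤ a) (hC : 0 ≤ C)
    (hφ : ∀ y, |φ y| ≤ C * Real.exp (a * |y|)) (j : ℕ) {v : ℝ} (hv : 0 < v) (y : ℝ) :
    HasDerivAt (gaussMom φ j v) (-(j * gaussMom φ (j - 1) v y) + gaussMom φ (j + 1) v y / v) y := by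
  obtain ⟨K₁, -, hK₁⟩ := exists_momInt_le ha hC hφ (j - 1) hv y
  obtain ⟨K₂, -, hK₂⟩ := exists_momInt_le ha hC hφ (j + 1) hv y
  have hi := fun j => integrable_momInt hφc ha hC hφ j hv y
  have hder : ∀ y' z, HasDerivAt (fun y => momInt φ j v y z)
      (-(j * momInt φ (j - 1) v y' z) + momInt φ (j + 1) v y' z / v) y' := by
    intro y' z
    have h1 : HasDerivAt (fun y => z - y) (-1) y' := by
      simpa using (hasDerivAt_id y').const_sub z
    have h2 := (h1.pow j).mul ((h1.pow 2).neg.div_const (2 * v)).exp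
    refine (h2.const_mul (φ z)).congr_deriv ?_
    simp only [momInt, Pi.pow_apply, Pi.neg_apply]
    field_simp
    ring
  have key := hasDerivAt_integral_of_dominated_loc_of_deriv_le (μ := volume)
    (F := fun y z => momInt φ j v y z)
    (F' := fun y' z => -(j * momInt φ (j - 1) v y' z) + momInt φ (j + 1) v y' z / v)
    (bound := fun z => j * (K₁ * Real.exp (-(1 / (8 * v)) * (z - y) ^ 2)) +
      K₂ * Real.exp (-(1 / (8 * v)) * (z - y) ^ 2) / v)
    (Metric.closedBall_mem_nhds y one_pos)
    (Eventually.of_forall fun y' => (continuous_momInt hφc j v y').aestronglyMeasurable) (hi j)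
    ((continuous_const.mul (continuous_momInt hφc _ v y)).neg.add
      ((continuous_momInt hφc _ v y).div_const _)).aestronglyMeasurable ?_ ?_ ?_
  · refine key.2.congr_deriv ?_
    have e1 : Integrable fun z => -(j * momInt φ (j - 1) v y z) :=
      ((hi (j - 1)).const_mul (j : ℝ)).neg
    rw [integral_add e1 ((hi _).div_const _), integral_neg, integral_const_mul, integral_div]
    rfl
  · refine ae_of_all _ fun z y' hy' => ?_
    rw [Metric.mem_closedBall, Real.dist_eq] at hy'
    have e1 := hK₁ v ⟨hv, le_rfl⟩ y' hy' z
    have e2 := hK₂ v ⟨hv, le_rfl⟩ y' hy' z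
    refine (norm_add_le _ _).trans ?_
    rw [norm_neg, norm_mul, norm_div, Real.norm_eq_abs, Real.norm_eq_abs, Real.norm_eq_abs,
      Real.norm_of_nonneg hv.le, abs_of_nonneg (Nat.cast_nonneg j)]
    gcongr
  · exact ((integrable_gauss_shift (by positivity) K₁ y).const_mul _).add
      ((integrable_gauss_shift (by positivity) K₂ y).div_const _)
  · exact ae_of_all _ fun z y' _ => hder y' z

/-- A derivative in the variance raises the order by two. With the derivative of the normalization
it becomes half the second space derivative, which is the heat equation. -/
lemma hasDerivAt_gaussMom_var (hφc : Continuous φ) (ha : 0 ≤ a) (hC : 0 ≤ C)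
    (hφ : ∀ y, |φ y| ≤ C * Real.exp (a * |y|)) (j : ℕ) {v : ℝ} (hv : 0 < v) (y : ℝ) :
    HasDerivAt (fun v => gaussMom φ j v y) (gaussMom φ (j + 2) v y / (2 * v ^ 2)) v := by
  obtain ⟨K, hK0, hK⟩ := exists_momInt_le ha hC hφ (j + 2) (show 0 < 2 * v by positivity) y
  have hder : ∀ v' z, 0 < v' → HasDerivAt (fun v => momInt φ j v y z)
      (momInt φ (j + 2) v' y z / (2 * v' ^ 2)) v' := by
    intro v' z hv'
    have h1 : HasDerivAt (fun v : ℝ => -(z - y) ^ 2 / (2 * v)) ((z - y) ^ 2 / (2 * v' ^ 2)) v' := by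
      have h2 := (((hasDerivAt_id v').const_mul 2).inv (by simpa using hv'.ne')).const_mul
        (-(z - y) ^ 2)
      refine h2.congr_deriv ?_
      simp only [id]
      field_simp
    refine ((h1.exp.const_mul ((z - y) ^ j)).const_mul (φ z)).congr_deriv ?_
    simp only [momInt]
    ring
  have key := hasDerivAt_integral_of_dominated_loc_of_deriv_le (μ := volume)
    (F := fun v z => momInt φ j v y z)
    (F' := fun v' z => momInt φ (j + 2) v' y z / (2 * v' ^ 2))
    (bound := fun z => K * Real.exp (-(1 / (8 * (2 * v))) * (z - y) ^ 2) / (2 * (v / 2) ^ 2))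
    (Ioo_mem_nhds (show v / 2 < v by linarith) (show v < 2 * v by linarith))
    (Eventually.of_forall fun v' => (continuous_momInt hφc j v' y).aestronglyMeasurable)
    (integrable_momInt hφc ha hC hφ j hv y)
    ((continuous_momInt hφc _ v y).div_const _).aestronglyMeasurable ?_ ?_ ?_
  · refine key.2.congr_deriv ?_
    rw [integral_div]
    rfl
  · refine ae_of_all _ fun z v' hv' => ?_
    have hv'0 : 0 < v' := by linarith [hv'.1]
    have e1 := hK v' ⟨hv'0, hv'.2.le⟩ y (by simp) z
    rw [norm_div, Real.norm_eq_abs, Real.norm_of_nonneg (by positivity : 0 ≤ 2 * v' ^ 2)]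
    have := hv'.1.le
    gcongr
  · exact (integrable_gauss_shift (by positivity) K y).div_const _
  · exact ae_of_all _ fun z v' hv' => hder v' z (by linarith [hv'.1])

lemma exists_gaussMom_le (ha : 0 ≤ a) (hC : 0 ≤ C)
    (hφ : ∀ y, |φ y| ≤ C * Real.exp (a * |y|)) (j : ℕ) {V : ℝ} (hV : 0 < V) : ∃ K, 0 ≤ K ∧
      ∀ v ∈ Set.Ioc 0 V, ∀ y, |gaussMom φ j v y| ≤ K * Real.exp (a * |y|) := by
  obtain ⟨K, hK, hKw⟩ := exists_poly_exp_gauss_le j a (show 0 < 1 / (4 * V) by positivity)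
  refine ⟨C * K * ∫ z : ℝ, Real.exp (-(1 / (4 * V)) * z ^ 2),
    mul_nonneg (by positivity) (integral_nonneg fun z => (Real.exp_pos _).le), fun v hv y => ?_⟩
  have hv0 := hv.1
  have h1 := norm_integral_le_of_norm_le (f := momInt φ j v y)
    (integrable_gauss_shift (show 0 < 1 / (4 * V) by positivity) (C * Real.exp (a * |y|) * K) y)
    (ae_of_all _ fun z => by
      rw [Real.norm_eq_abs]
      unfold momInt
      rw [abs_mul, abs_mul, abs_pow, abs_of_pos (Real.exp_pos _)]
      have e1 : -(z - y) ^ 2 / (2 * v) ≤ -(2 * (1 / (4 * V))) * (z - y) ^ 2 := by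
        have e3 : -(2 * (1 / (4 * V))) * (z - y) ^ 2 = -((z - y) ^ 2 / (2 * V)) := by
          field_simp; ring
        rw [e3, neg_div, neg_le_neg_iff]
        have := hv.2
        gcongr
      have e2 : |z - y| ≤ 1 + |z - y| := by linarith
      calc |φ z| * (|z - y| ^ j * Real.exp (-(z - y) ^ 2 / (2 * v)))
          ≤ (C * Real.exp (a * |y|) * Real.exp (a * |z - y|)) * ((1 + |z - y|) ^ j *
            Real.exp (-(2 * (1 / (4 * V))) * (z - y) ^ 2)) := by
            gcongr
            exact exp_growth_shift ha hC hφ y z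
        _ = C * Real.exp (a * |y|) * ((1 + |z - y|) ^ j * Real.exp (a * |z - y|) *
            Real.exp (-(2 * (1 / (4 * V))) * (z - y) ^ 2)) := by ring
        _ ≤ C * Real.exp (a * |y|) * (K * Real.exp (-(1 / (4 * V)) * (z - y) ^ 2)) :=
            mul_le_mul_of_nonneg_left (hKw _) (by positivity)
        _ = _ := by ring)
  rw [Real.norm_eq_abs] at h1
  refine h1.trans_eq ?_
  rw [integral_const_mul, integral_sub_right_eq_self (fun z => Real.exp (-(1 / (4 * V)) * z ^ 2)) y]
  ring

/-- Bridge from the averaged form, suited to continuity at time zero, to the kernel form, suited to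
derivatives at positive times. -/
lemma heatSol_eq (hm : 0 < m) {t : ℝ} (ht : 0 < t) (y : ℝ) :
    heatSol m φ t y = (√(2 * Real.pi * (m * t)))⁻¹ * gaussMom φ 0 (m * t) y := by
  have hv : 0 < m * t := by positivity
  have hsq : 0 < √(m * t) := Real.sqrt_pos.2 hv
  have h1 : (gaussianReal 0 1).map (fun z => y + √(m * t) * z) =
      gaussianReal y (m * t).toNNReal := by
    have e : (fun z => y + √(m * t) * z) = (fun z => y + z) ∘ (fun z => √(m * t) * z) := rfl
    rw [e, ← Measure.map_map (by fun_prop) (by fun_prop), gaussianReal_map_const_mul,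
      gaussianReal_map_const_add]
    congr 1
    · simp
    · ext
      simp [Real.sq_sqrt hv.le, hv.le]
  have hemb : MeasurableEmbedding (fun z => y + √(m * t) * z) :=
    (measurableEmbedding_addLeft y).comp (measurableEmbedding_mulLeft₀ hsq.ne')
  unfold heatSol
  rw [← hemb.integral_map (fun z => φ z), h1,
    integral_gaussianReal_eq_integral_smul (by simpa using hv), gaussMom, ← integral_const_mul]
  congr 1
  funext z
  simp only [gaussianPDFReal, smul_eq_mul, momInt, pow_zero, one_mul, Real.coe_toNNReal _ hv.le]
  ring

/-- Spatial derivatives of the heat solution of orders one, two and three. -/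
noncomputable def heatD1 (m : ℝ) (φ : ℝ → ℝ) (t y : ℝ) : ℝ :=
  (√(2 * Real.pi * (m * t)))⁻¹ * (gaussMom φ 1 (m * t) y / (m * t))

noncomputable def heatD2 (m : ℝ) (φ : ℝ → ℝ) (t y : ℝ) : ℝ :=
  (√(2 * Real.pi * (m * t)))⁻¹ *
    (gaussMom φ 2 (m * t) y / (m * t) ^ 2 - gaussMom φ 0 (m * t) y / (m * t))

noncomputable def heatD3 (m : ℝ) (φ : ℝ → ℝ) (t y : ℝ) : ℝ :=
  (√(2 * Real.pi * (m * t)))⁻¹ *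
    (gaussMom φ 3 (m * t) y / (m * t) ^ 3 - 3 * gaussMom φ 1 (m * t) y / (m * t) ^ 2)

lemma hasDerivAt_heatSol (hm : 0 < m) (hφc : Continuous φ) (ha : 0 ≤ a) (hC : 0 ≤ C)
    (hφ : ∀ y, |φ y| ≤ C * Real.exp (a * |y|)) {t : ℝ} (ht : 0 < t) (y : ℝ) :
    HasDerivAt (heatSol m φ t) (heatD1 m φ t y) y := by
  have hv : 0 < m * t := by positivity
  have h := (hasDerivAt_gaussMom_space hφc ha hC hφ 0 hv y).const_mul
    (√(2 * Real.pi * (m * t)))⁻¹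
  rw [show heatSol m φ t = fun y => (√(2 * Real.pi * (m * t)))⁻¹ * gaussMom φ 0 (m * t) y from
    funext fun y => heatSol_eq hm ht y]
  refine h.congr_deriv ?_
  simp [heatD1]

lemma hasDerivAt_heatD1 (hm : 0 < m) (hφc : Continuous φ) (ha : 0 ≤ a) (hC : 0 ≤ C)
    (hφ : ∀ y, |φ y| ≤ C * Real.exp (a * |y|)) {t : ℝ} (ht : 0 < t) (y : ℝ) :
    HasDerivAt (heatD1 m φ t) (heatD2 m φ t y) y := by
  have hv : 0 < m * t := by positivity
  have h := ((hasDerivAt_gaussMom_space hφc ha hC hφ 1 hv y).div_const (m * t)).const_mul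
    (√(2 * Real.pi * (m * t)))⁻¹
  refine h.congr_deriv ?_
  simp only [heatD2, Nat.cast_one, Nat.sub_self, one_mul]
  field_simp
  ring

lemma hasDerivAt_heatD2 (hm : 0 < m) (hφc : Continuous φ) (ha : 0 ≤ a) (hC : 0 ≤ C)
    (hφ : ∀ y, |φ y| ≤ C * Real.exp (a * |y|)) {t : ℝ} (ht : 0 < t) (y : ℝ) :
    HasDerivAt (heatD2 m φ t) (heatD3 m φ t y) y := by
  have hv : 0 < m * t := by positivity
  have h := (((hasDerivAt_gaussMom_space hφc ha hC hφ 2 hv y).div_const ((m * t) ^ 2)).sub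
    ((hasDerivAt_gaussMom_space hφc ha hC hφ 0 hv y).div_const (m * t))).const_mul
    (√(2 * Real.pi * (m * t)))⁻¹
  refine h.congr_deriv ?_
  simp only [heatD3, Nat.cast_ofNat, CharP.cast_eq_zero, zero_mul, neg_zero, zero_add,
    Nat.add_one_sub_one]
  field_simp
  ring

lemma hasDerivAt_heatSol_time (hm : 0 < m) (hφc : Continuous φ) (ha : 0 ≤ a) (hC : 0 ≤ C)
    (hφ : ∀ y, |φ y| ≤ C * Real.exp (a * |y|)) {t : ℝ} (ht : 0 < t) (y : ℝ) :
    HasDerivAt (fun t => heatSol m φ t y) (m / 2 * heatD2 m φ t y) t := by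
  have hv : 0 < m * t := by positivity
  have hpi : 0 < 2 * Real.pi * (m * t) := by have := Real.pi_pos; positivity
  have hmt : HasDerivAt (fun t => m * t) m t := by simpa using (hasDerivAt_id t).const_mul m
  have h1 := (((hmt.const_mul (2 * Real.pi)).sqrt hpi.ne').inv (Real.sqrt_pos.2 hpi).ne').mul
    ((hasDerivAt_gaussMom_var hφc ha hC hφ 0 hv y).comp t hmt)
  have h2 : (fun t => heatSol m φ t y) =ᶠ[𝓝 t] ((fun t => √(2 * Real.pi * (m * t)))⁻¹ *
      ((fun v => gaussMom φ 0 v y) ∘ fun t => m * t)) := by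
    filter_upwards [lt_mem_nhds ht] with s hs
    exact heatSol_eq hm hs y
  refine (h1.congr_of_eventuallyEq h2).congr_deriv ?_
  simp only [heatD2, Function.comp, Pi.inv_apply, zero_add]
  rw [Real.sq_sqrt hpi.le]
  have h3 := (Real.sqrt_pos.2 hpi).ne'
  have h4 := Real.pi_pos
  generalize √(2 * Real.pi * (m * t)) = r at *
  field_simp
  ring

theorem isDiffusionSolution_heatSol (hm : 0 < m) (hφc : Continuous φ) (ha : 0 ≤ a) (hC : 0 ≤ C)
    (hφ : ∀ y, |φ y| ≤ C * Real.exp (a * |y|)) :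
    IsDiffusionSolution (m / 2) φ (heatSol m φ) := by
  have hd1 : ∀ t, 0 < t → deriv (heatSol m φ t) = heatD1 m φ t := fun t ht =>
    funext fun y => (hasDerivAt_heatSol hm hφc ha hC hφ ht y).deriv
  have hd2 : ∀ t, 0 < t → deriv (heatD1 m φ t) = heatD2 m φ t := fun t ht =>
    funext fun y => (hasDerivAt_heatD1 hm hφc ha hC hφ ht y).deriv
  refine ⟨(continuous_heatSol hφc ha hC hφ).continuousOn, heatSol_zero, fun t ht => ?_,
    fun t y ht => ?_, fun T => ?_⟩
  · rw [show (2 : WithTop ℕ∞) = 1 + 1 by norm_num, contDiff_succ_iff_deriv, hd1 t ht,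
      contDiff_one_iff_deriv, hd2 t ht]
    refine ⟨fun y => (hasDerivAt_heatSol hm hφc ha hC hφ ht y).differentiableAt, by simp,
      fun y => (hasDerivAt_heatD1 hm hφc ha hC hφ ht y).differentiableAt, ?_⟩
    exact continuous_iff_continuousAt.2 fun y =>
      (hasDerivAt_heatD2 hm hφc ha hC hφ ht y).continuousAt
  · rw [iteratedDeriv_succ, iteratedDeriv_one, hd1 t ht, hd2 t ht]
    exact hasDerivAt_heatSol_time hm hφc ha hC hφ ht y
  · obtain ⟨K, -, hK⟩ := exists_heatSol_growth hm ha hC hφ T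
    exact ⟨K, a, fun t ht y => hK t ht.2 y⟩

/-- Uniform only away from time zero, because `φ` is never differentiated. It controls the
consistency error of the discrete Laplacian. -/
lemma exists_heatD3_le (hm : 0 < m) (ha : 0 ≤ a) (hC : 0 ≤ C)
    (hφ : ∀ y, |φ y| ≤ C * Real.exp (a * |y|)) {t₁ t₂ : ℝ} (h₁ : 0 < t₁) (h₂ : t₁ ≤ t₂) :
    ∃ K, 0 ≤ K ∧ ∀ t ∈ Set.Icc t₁ t₂, ∀ y, |heatD3 m φ t y| ≤ K * Real.exp (a * |y|) := by
  have hV : 0 < m * t₂ := by have := h₁.trans_le h₂; positivity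
  obtain ⟨K₁, hK₁0, hK₁⟩ := exists_gaussMom_le ha hC hφ 1 hV
  obtain ⟨K₃, hK₃0, hK₃⟩ := exists_gaussMom_le ha hC hφ 3 hV
  have hpi := Real.pi_pos
  refine ⟨(√(2 * Real.pi * (m * t₁)))⁻¹ * (K₃ / (m * t₁) ^ 3 + 3 * K₁ / (m * t₁) ^ 2),
    by positivity, fun t ht y => ?_⟩
  rw [mul_assoc (√(2 * Real.pi * (m * t₁)))⁻¹]
  have ht0 : 0 < t := h₁.trans_le ht.1
  have hmem : m * t ∈ Set.Ioc 0 (m * t₂) := ⟨by positivity, by have := ht.2; gcongr⟩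
  have e1 := hK₁ _ hmem y
  have e3 := hK₃ _ hmem y
  have hle := ht.1
  unfold heatD3
  rw [abs_mul, abs_inv, abs_of_nonneg (Real.sqrt_nonneg _)]
  have hs1 : 0 < √(2 * Real.pi * (m * t₁)) := Real.sqrt_pos.2 (by positivity)
  refine mul_le_mul ?_ ?_ (abs_nonneg _) (by positivity)
  · exact inv_anti₀ hs1 (Real.sqrt_le_sqrt (by gcongr))
  · refine (abs_sub _ _).trans ?_
    rw [abs_div, abs_div, abs_mul, abs_of_pos (by positivity : 0 < (m * t) ^ 3),
      abs_of_pos (by positivity : 0 < (m * t) ^ 2), abs_of_pos (by norm_num : (0 : ℝ) < 3)]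
    calc |gaussMom φ 3 (m * t) y| / (m * t) ^ 3 + 3 * |gaussMom φ 1 (m * t) y| / (m * t) ^ 2
        ≤ K₃ * Real.exp (a * |y|) / (m * t₁) ^ 3 +
          3 * (K₁ * Real.exp (a * |y|)) / (m * t₁) ^ 2 := by gcongr
      _ = _ := by ring

/-- Second-order Taylor estimate for symmetric differences. -/
lemma abs_symm_diff_sub_le {f f₁ f₂ f₃ : ℝ → ℝ} (h1 : ∀ y, HasDerivAt f (f₁ y) y)
    (h2 : ∀ y, HasDerivAt f₁ (f₂ y) y) (h3 : ∀ y, HasDerivAt f₂ (f₃ y) y) {M y h : ℝ}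
    (hh : 0 ≤ h) (hM : ∀ z, |z - y| ≤ h → |f₃ z| ≤ M) :
    |f (y + h) + f (y - h) - 2 * f y - h ^ 2 * f₂ y| ≤ 2 * M * h ^ 3 := by
  have hM0 : 0 ≤ M := (abs_nonneg _).trans (hM y (by simpa using hh))
  -- The mean value inequality in the increment is used three times, descending from the third
  -- derivative; every use gains one factor `h`.
  have mvt : ∀ (g g' : ℝ → ℝ) (L : ℝ), (∀ s, HasDerivAt g (g' s) s) → g 0 = 0 → 0 ≤ L →
      (∀ s ∈ Set.Icc 0 h, |g' s| ≤ L) → ∀ s ∈ Set.Icc 0 h, |g s| ≤ L * h := by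
    intro g g' L hg h0 hL hb s hs
    have := (convex_Icc 0 h).norm_image_sub_le_of_norm_hasDerivWithin_le
      (fun x _ => (hg x).hasDerivWithinAt) hb (⟨le_rfl, hh⟩ : (0 : ℝ) ∈ Set.Icc 0 h) hs
    rw [h0, sub_zero, sub_zero, Real.norm_eq_abs, Real.norm_of_nonneg hs.1] at this
    exact this.trans (by have := hs.2; gcongr)
  have hadd : ∀ s : ℝ, HasDerivAt (fun s => y + s) 1 s := fun s => (hasDerivAt_id s).const_add y
  have hsub : ∀ s : ℝ, HasDerivAt (fun s => y - s) (-1) s := fun s => (hasDerivAt_id s).const_sub y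
  have hc : ∀ {g g' : ℝ → ℝ}, (∀ y, HasDerivAt g (g' y) y) → ∀ s,
      HasDerivAt (fun s => g (y + s)) (g' (y + s)) s ∧
      HasDerivAt (fun s => g (y - s)) (-g' (y - s)) s := by
    intro g g' hg s
    exact ⟨by simpa [Function.comp_def] using (hg (y + s)).comp s (hadd s),
      by simpa [Function.comp_def] using (hg (y - s)).comp s (hsub s)⟩
  have b2 : ∀ s ∈ Set.Icc 0 h, |f₂ (y + s) + f₂ (y - s) - 2 * f₂ y| ≤ 2 * M * h := by
    refine mvt (fun s => f₂ (y + s) + f₂ (y - s) - 2 * f₂ y) (fun s => f₃ (y + s) + -f₃ (y - s))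
      (2 * M) (fun s => ((hc h3 s).1.add (hc h3 s).2).sub_const _) (by simp; ring)
      (by positivity) fun s hs => ?_
    have e1 := hM (y + s) (by rw [add_sub_cancel_left, abs_of_nonneg hs.1]; exact hs.2)
    have e2 := hM (y - s) (by rw [sub_sub_cancel_left, abs_neg, abs_of_nonneg hs.1]; exact hs.2)
    refine (abs_add_le _ _).trans ?_
    rw [abs_neg]; linarith
  have b1 : ∀ s ∈ Set.Icc 0 h, |f₁ (y + s) - f₁ (y - s) - 2 * s * f₂ y| ≤ 2 * M * h * h := by
    refine mvt (fun s => f₁ (y + s) - f₁ (y - s) - 2 * s * f₂ y)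
      (fun s => f₂ (y + s) + f₂ (y - s) - 2 * f₂ y) (2 * M * h) (fun s => ?_) (by simp)
      (by positivity) b2
    refine (((hc h2 s).1.sub (hc h2 s).2).sub
      (((hasDerivAt_id s).const_mul 2).mul_const (f₂ y))).congr_deriv ?_
    ring
  have b0 := mvt (fun s => f (y + s) + f (y - s) - 2 * f y - s ^ 2 * f₂ y)
      (fun s => f₁ (y + s) - f₁ (y - s) - 2 * s * f₂ y) (2 * M * h * h) (fun s => by
        refine ((((hc h1 s).1.add (hc h1 s).2).sub_const _).sub
          ((hasDerivAt_pow 2 s).mul_const (f₂ y))).congr_deriv ?_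
        simp; ring) (by simp; ring) (by positivity) b1 h ⟨hh, le_rfl⟩
  refine b0.trans_eq (by ring)

end heat

/-! ### Bounds for the discrete heat equation, uniform in the scaling -/

section scaling

variable {m : ℝ}

/-- A weight with rate `b / N` grows in time at a rate of order `N ^ (-2)`, so over times of order
`N ^ 2` the growth factor stays bounded. -/
lemma sq_mul_cosh_sub_one_le (b : ℝ) {N : ℕ} (hN : 1 ≤ N) :
    (N : ℝ) ^ 2 * (Real.cosh (b / N) - 1) ≤ b ^ 2 / 2 * Real.exp (b ^ 2 / 2) := by
  have hN1 : (1 : ℝ) ≤ N := by exact_mod_cast hN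
  have h1 := Real.cosh_le_exp_half_sq (b / N)
  set z := (b / N) ^ 2 / 2 with hz
  have hz0 : 0 ≤ z := by positivity
  have h2 : Real.exp z - 1 ≤ z * Real.exp z := by
    have h3 := Real.add_one_le_exp (-z)
    have h4 := Real.exp_pos z
    have h5 : Real.exp z * Real.exp (-z) = 1 := by rw [← Real.exp_add]; simp
    nlinarith
  have h6 : (N : ℝ) ^ 2 * z = b ^ 2 / 2 := by
    rw [hz]; field_simp
  have h7 : z ≤ b ^ 2 / 2 := by
    rw [← h6]
    exact le_mul_of_one_le_left hz0 (one_le_pow₀ hN1)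
  calc (N : ℝ) ^ 2 * (Real.cosh (b / N) - 1) ≤ (N : ℝ) ^ 2 * (z * Real.exp z) := by
        gcongr; linarith
    _ = b ^ 2 / 2 * Real.exp z := by rw [← mul_assoc, h6]
    _ ≤ _ := by gcongr

lemma exp_cosh_scaled_le (hm : 0 < m) (b : ℝ) {N : ℕ} (hN : 1 ≤ N) {s t : ℝ} (hs : 0 ≤ s)
    (ht : s ≤ N ^ 2 * t) : Real.exp (m * (Real.cosh (b / N) - 1) * s) ≤
      Real.exp (m * (b ^ 2 / 2 * Real.exp (b ^ 2 / 2)) * t) := by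
  have hN1 : (1 : ℝ) ≤ N := by exact_mod_cast hN
  have ht0 : 0 ≤ t := nonneg_of_mul_nonneg_right (hs.trans ht) (by positivity)
  have h1 := sq_mul_cosh_sub_one_le b hN
  have h2 := Real.one_le_cosh (b / N)
  refine Real.exp_le_exp.2 ?_
  calc m * (Real.cosh (b / N) - 1) * s ≤ m * (Real.cosh (b / N) - 1) * (N ^ 2 * t) :=
        mul_le_mul_of_nonneg_left ht (mul_nonneg hm.le (by linarith))
    _ = m * (N ^ 2 * (Real.cosh (b / N) - 1)) * t := by ring
    _ ≤ _ := by gcongr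

/-- Growth and gradient bounds for the discrete heat equation, uniform in the scaling. -/
theorem exists_scaled_walk_bounds (hm : 0 < m) {C a : ℝ} (hC : 0 ≤ C) (ha : 0 ≤ a) (t : ℝ) :
    ∃ B, 0 ≤ B ∧ ∀ N : ℕ, 1 ≤ N → ∀ u : ℝ → ℤ → ℝ, IsNonnegSolution (walkRate m) walkMove u →
      (∀ x : ℤ, u 0 x ≤ C * Real.exp (a / N * |(x : ℝ)|)) →
      ∀ s ∈ Set.Icc 0 ((N : ℝ) ^ 2 * t), ∀ x : ℤ, u s x ≤ B * Real.exp (a / N * |(x : ℝ)|) ∧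
        (1 + s) * (u s (x + 1) - u s x) ^ 2 ≤ B ^ 2 * Real.exp (2 * (a / N) * |(x : ℝ)|) := by
  set E₁ := Real.exp (m * (a ^ 2 / 2 * Real.exp (a ^ 2 / 2)) * t) with hE₁
  set E₂ := Real.exp (m * ((2 * a) ^ 2 / 2 * Real.exp ((2 * a) ^ 2 / 2)) * t) with hE₂
  set B₁ := 2 * C * E₁ * Real.exp a with hB₁
  set Q := 2 / m * ((2 * C) ^ 2 * E₂) with hQ
  have hQ0 : 0 ≤ Q := by positivity
  have hB₁0 : 0 ≤ B₁ := by positivity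
  refine ⟨B₁ + Q + 1, by positivity, fun N hN u hu h0 s hs x => ?_⟩
  have hN1 : (1 : ℝ) ≤ N := by exact_mod_cast hN
  have haN : a / N ≤ a := div_le_self ha hN1
  have haN0 : 0 ≤ a / N := by positivity
  have h0' : ∀ x : ℤ, u 0 x ≤ 2 * C * Real.cosh (a / N * x) := fun x => by
    have := exp_abs_le_two_cosh (a / N * x)
    rw [abs_mul, abs_of_nonneg haN0] at this
    nlinarith [h0 x]
  have hub : ∀ x : ℤ, u s x ≤ 2 * C * E₁ * Real.exp (a / N * |(x : ℝ)|) := fun x => by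
    refine (hu.le_cosh hm (by positivity) h0' hs.1 x).trans ?_
    have h1 := exp_cosh_scaled_le hm a hN hs.1 hs.2
    have h2 := cosh_le_exp_abs (a / N * x)
    rw [abs_mul, abs_of_nonneg haN0] at h2
    gcongr
  have hub1 : ∀ x' : ℤ, |(x' : ℝ)| ≤ |(x : ℝ)| + 1 →
      u s x' ≤ B₁ * Real.exp (a / N * |(x : ℝ)|) := fun x' hx' => by
    refine (hub x').trans ?_
    rw [hB₁, mul_assoc (2 * C * E₁), ← Real.exp_add]
    have : a / N * |(x' : ℝ)| ≤ a + a / N * |(x : ℝ)| := by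
      have := mul_le_mul_of_nonneg_left hx' haN0
      linarith
    gcongr
  have hx0 := hub1 x (by linarith)
  have hx1 := hub1 (x + 1) (by push_cast; exact (abs_add_le _ _).trans (by simp))
  refine ⟨hx0.trans (by gcongr; linarith), ?_⟩
  have hp0 := hu.nonneg s x
  have hp1 := hu.nonneg s (x + 1)
  set e := Real.exp (a / N * |(x : ℝ)|) with he
  have hee : Real.exp (2 * (a / N) * |(x : ℝ)|) = e ^ 2 := by
    rw [he, ← Real.exp_nat_mul]; congr 1; push_cast; ring
  -- The size of `u` bounds the gradient without any factor of time, Bernstein's estimate bounds it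
  -- with the factor `s`; together they give the weight `1 + s`.
  have g1 : (u s (x + 1) - u s x) ^ 2 ≤ (B₁ * e) ^ 2 := by
    refine sq_le_sq' ?_ ?_ <;> linarith
  have g2 : s * (u s (x + 1) - u s x) ^ 2 ≤ Q * e ^ 2 := by
    have h := hu.gradient_sq_le hm (by positivity) h0' hs.1 x
    rw [show 2 * (a / N) = 2 * a / N by ring] at h
    have h1 := exp_cosh_scaled_le hm (2 * a) hN hs.1 hs.2
    have h2 := cosh_le_exp_abs (2 * a / N * x)
    rw [abs_mul, abs_of_nonneg (by positivity), show 2 * a / N = 2 * (a / N) by ring, hee] at h2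
    rw [show 2 * (a / N) = 2 * a / N by ring] at h2
    have h3 : m / 2 * s * (u s (x + 1) - u s x) ^ 2 ≤ (2 * C) ^ 2 * E₂ * e ^ 2 :=
      h.trans (by gcongr)
    have h4 := mul_le_mul_of_nonneg_left h3 (by positivity : 0 ≤ 2 / m)
    calc s * (u s (x + 1) - u s x) ^ 2 = 2 / m * (m / 2 * s * (u s (x + 1) - u s x) ^ 2) := by
          field_simp
      _ ≤ _ := h4
      _ = _ := by rw [hQ]; ring
  rw [hee]
  have h5 : B₁ ^ 2 + Q ≤ (B₁ + Q + 1) ^ 2 := by nlinarith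
  nlinarith [mul_le_mul_of_nonneg_right h5 (sq_nonneg e)]

/-- An error estimate for approximate subsolutions of the discrete heat equation. -/
lemma le_of_approx_subsolution (hm : 0 < m) {d : ℝ → ℤ → ℝ} {T θ ρ β A b : ℝ} (hθ : 0 ≤ θ)
    (hρ : 0 ≤ ρ) (hβ : 0 ≤ β) (hA : 0 ≤ A) (hb : 0 ≤ b)
    (hc : ∀ x, ContinuousOn (fun s => d s x) (Set.Icc 0 T))
    (hd : ∀ x, ∀ s ∈ Set.Ioo 0 T, ∃ d', HasDerivAt (fun s => d s x) d' s ∧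
      d' ≤ m / 2 * lap (d s) x + θ * ρ * Real.exp (β * |(x : ℝ)|))
    (h0 : ∀ x, d 0 x ≤ θ * Real.exp (β * |(x : ℝ)|))
    (hg : ∀ s ∈ Set.Icc 0 T, ∀ x, d s x ≤ A * Real.exp (b * |(x : ℝ)|))
    {s : ℝ} (hs : s ∈ Set.Icc 0 T) (x : ℤ) : d s x ≤
      θ * (1 + ρ * s) * (2 * Real.exp (m * (Real.cosh β - 1) * s) * Real.cosh (β * x)) := by
  set κ := m * (Real.cosh β - 1) with hκ
  have hκ0 : 0 ≤ κ := mul_nonneg hm.le (by linarith [Real.one_le_cosh β])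
  have hexp : ∀ x : ℤ, Real.exp (β * |(x : ℝ)|) ≤ 2 * Real.cosh (β * x) := fun x => by
    have := exp_abs_le_two_cosh (β * x)
    rwa [abs_mul, abs_of_nonneg hβ] at this
  -- The factor `exp (κ s) * cosh (β x)` solves the discrete equation exactly, the growth of `1 + ρ
  -- s` pays for the source, and the 2 comes from `exp |z| ≤ 2 cosh z`.
  have key : IsSubsolution (walkRate m) walkMove T (fun s x => d s x -
      θ * (1 + ρ * s) * (2 * Real.exp (κ * s) * Real.cosh (β * x))) := by
    refine ⟨fun x => (hc x).sub (Continuous.continuousOn (by fun_prop)), fun x s hs => ?_⟩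
    obtain ⟨d', hd', hle⟩ := hd x s hs
    have h1 : HasDerivAt (fun s => Real.exp (κ * s)) (Real.exp (κ * s) * κ) s := by
      simpa using ((hasDerivAt_id s).const_mul κ).exp
    have h2 : HasDerivAt (fun s => θ * (1 + ρ * s)) (θ * ρ) s := by
      simpa using (((hasDerivAt_id s).const_mul ρ).const_add 1).const_mul θ
    refine ⟨_, hd'.sub (h2.mul ((h1.const_mul 2).mul_const (Real.cosh (β * x)))), ?_⟩
    rw [jumpOp_walk]
    have h3 := lap_cosh β x
    have h4 : 1 ≤ Real.exp (κ * s) := Real.one_le_exp (mul_nonneg hκ0 hs.1.le)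
    have h5 : θ * ρ * Real.exp (β * |(x : ℝ)|) ≤
        θ * ρ * (2 * Real.exp (κ * s) * Real.cosh (β * x)) := by
      have := hexp x
      have := Real.cosh_pos (β * x)
      refine mul_le_mul_of_nonneg_left ?_ (by positivity)
      nlinarith
    have h6 : m / 2 * lap (fun x => d s x -
        θ * (1 + ρ * s) * (2 * Real.exp (κ * s) * Real.cosh (β * x))) x =
        m / 2 * lap (d s) x - θ * (1 + ρ * s) * (2 * (Real.exp (κ * s) * κ) *
          Real.cosh (β * x)) := by
      simp only [lap] at h3 ⊢
      linear_combination (-(m / 2) * (θ * (1 + ρ * s) * (2 * Real.exp (κ * s)))) * h3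
    rw [h6]
    linarith
  have h := key.nonpos_walk hm ?_ hA hb ?_ hs x
  · linarith
  · intro x
    have := mul_le_mul_of_nonneg_left (hexp x) hθ
    have := h0 x
    simp only [mul_zero, add_zero, mul_one, Real.exp_zero]
    linarith
  · intro s hs x
    have h1 : 0 ≤ θ * (1 + ρ * s) * (2 * Real.exp (κ * s) * Real.cosh (β * x)) := by
      have := hs.1
      have := Real.cosh_pos (β * x)
      positivity
    linarith [hg s hs x]

/-- The average of `f` over `K` consecutive sites. -/
noncomputable def blockAvg (K : ℕ) (f : ℤ → ℝ) (x : ℤ) : ℝ :=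
  (∑ j ∈ Finset.range K, f (x + j)) / K

lemma abs_blockAvg_sub_le {K : ℕ} (hK : 0 < K) {f : ℤ → ℝ} {x : ℤ} {c L : ℝ}
    (h : ∀ j < K, |f (x + j) - c| ≤ L) : |blockAvg K f x - c| ≤ L := by
  have hK' : (0 : ℝ) < K := by exact_mod_cast hK
  have h1 : blockAvg K f x - c = (∑ j ∈ Finset.range K, (f (x + j) - c)) / K := by
    rw [blockAvg, Finset.sum_sub_distrib]
    simp
    field_simp
  rw [h1, abs_div, abs_of_pos hK', div_le_iff₀ hK']
  refine (Finset.abs_sum_le_sum_abs _ _).trans ?_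
  refine (Finset.sum_le_card_nsmul _ _ L fun j hj => h j (Finset.mem_range.1 hj)).trans_eq ?_
  simp [mul_comm]

lemma lap_blockAvg (K : ℕ) (f : ℤ → ℝ) (x : ℤ) :
    lap (blockAvg K f) x = (∑ j ∈ Finset.range K, lap f (x + j)) / K := by
  simp only [lap, blockAvg, Finset.sum_sub_distrib, Finset.sum_add_distrib, ← Finset.mul_sum]
  have e1 : ∀ j : ℕ, x + 1 + (j : ℤ) = x + j + 1 := fun j => by ring
  have e2 : ∀ j : ℕ, x - 1 + (j : ℤ) = x + j - 1 := fun j => by ring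
  simp only [e1, e2]
  ring

lemma abs_sub_le_of_gradient {f : ℤ → ℝ} {x : ℤ} {G : ℝ} {K : ℕ}
    (h : ∀ j < K, |f (x + j + 1) - f (x + j)| ≤ G) :
    ∀ j ≤ K, |f (x + j) - f x| ≤ j * G := by
  intro j
  induction j with
  | zero => intro _; simp
  | succ j ih =>
    intro hj
    have h1 := ih (by omega)
    have h2 := h j (by omega)
    push_cast
    rw [← add_assoc]
    have := abs_add_le (f (x + j + 1) - f (x + j)) (f (x + j) - f x)
    rw [sub_add_sub_cancel] at this
    linarith

end scaling

/-! ### From pointwise convergence to convergence of averages -/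

section riemann

lemma intervalIntegral_floor (q : ℤ → ℝ) (a : ℤ) :
    IntervalIntegrable (fun z : ℝ => q ⌊z⌋) volume a (a + 1) ∧
      ∫ z in (a : ℝ)..(a + 1), q ⌊z⌋ = q a := by
  have h : Set.EqOn (fun _ => q a) (fun z : ℝ => q ⌊z⌋) (Set.Ioo (a : ℝ) (a + 1)) := fun z hz => by
    have : ⌊z⌋ = a := Int.floor_eq_iff.2 ⟨hz.1.le, hz.2⟩
    simp [this]
  have hle : (a : ℝ) ≤ a + 1 := by linarith
  constructor
  · rw [intervalIntegrable_iff_integrableOn_Ioo_of_le hle]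
    exact (integrableOn_const (by simp)).congr_fun h measurableSet_Ioo
  · rw [intervalIntegral.integral_of_le hle, integral_Ioc_eq_integral_Ioo,
      ← setIntegral_congr_fun measurableSet_Ioo h]
    simp

/-- The normalized sum is exactly the integral of a step function, so the convergence theorems for
integrals apply to it directly. -/
lemma sum_div_eq_integral_floor (q : ℤ → ℝ) {N : ℕ} (hN : 1 ≤ N) (L : ℕ) :
    (∑ k ∈ Finset.range (2 * L * N), q (-(L * N : ℕ) + k)) / N =
      ∫ z in (-(L : ℝ))..L, q ⌊(N : ℝ) * z⌋ := by
  have hN0 : (N : ℝ) ≠ 0 := by positivity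
  have h1 := intervalIntegral.sum_integral_adjacent_intervals (μ := volume)
    (f := fun z : ℝ => q ⌊z⌋) (a := fun k : ℕ => (((-(L * N : ℕ) + k : ℤ)) : ℝ))
    (n := 2 * L * N) fun k _ => by
      have := (intervalIntegral_floor q (-(L * N : ℕ) + k)).1
      convert this using 1
      push_cast; ring
  have h2 : ∀ k : ℕ, (∫ z in (((-(L * N : ℕ) + k : ℤ)) : ℝ)..(((-(L * N : ℕ) + (k + 1 : ℕ) : ℤ)) : ℝ),
      q ⌊z⌋) = q (-(L * N : ℕ) + k) := fun k => by
    have := (intervalIntegral_floor q (-(L * N : ℕ) + k)).2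
    convert this using 2
    push_cast; ring
  simp only [h2] at h1
  rw [h1, intervalIntegral.integral_comp_mul_left (fun z => q ⌊z⌋) hN0, smul_eq_mul, div_eq_inv_mul]
  congr 2 <;> push_cast <;> ring

/-- Local Riemann sums of functions that vanish in the scaling limit. -/
lemma tendsto_riemann_sum {q : ℕ → ℤ → ℝ} {M : ℝ} {L : ℕ}
    (hM : ∀ N : ℕ, 1 ≤ N → ∀ a : ℤ, |(a : ℝ)| ≤ (L + 1) * N → |q N a| ≤ M)
    (hq : ∀ y : ℝ, Tendsto (fun N : ℕ => q N ⌊(N : ℝ) * y⌋) atTop (𝓝 0)) :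
    Tendsto (fun N : ℕ => (∑ k ∈ Finset.range (2 * L * N), q N (-(L * N : ℕ) + k)) / N) atTop
      (𝓝 0) := by
  have h1 : Tendsto (fun N : ℕ => ∫ z in (-(L : ℝ))..L, q N ⌊(N : ℝ) * z⌋) atTop
      (𝓝 (∫ z in (-(L : ℝ))..L, (0 : ℝ))) := by
    refine intervalIntegral.tendsto_integral_filter_of_dominated_convergence (fun _ => M)
      (Eventually.of_forall fun N => ?_) ?_ (by simp) (ae_of_all _ fun z _ => hq z)
    · exact ((measurable_from_top (f := q N)).comp
        (Int.measurable_floor.comp (measurable_const_mul (N : ℝ)))).aestronglyMeasurable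
    · filter_upwards [eventually_ge_atTop 1] with N hN
      refine ae_of_all _ fun z hz => ?_
      rw [Set.uIoc_of_le (by linarith [(Nat.cast_nonneg L : (0 : ℝ) ≤ L)])] at hz
      rw [Real.norm_eq_abs]
      refine hM N hN _ ?_
      have hN1 : (1 : ℝ) ≤ N := by exact_mod_cast hN
      have e1 := Int.floor_le ((N : ℝ) * z)
      have e2 := Int.lt_floor_add_one ((N : ℝ) * z)
      have e3 : (N : ℝ) * z ≤ N * L := by gcongr; exact hz.2
      have e4 : (N : ℝ) * -L ≤ N * z := by gcongr; exact hz.1.le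
      rw [abs_le]
      constructor <;> nlinarith
  rw [intervalIntegral.integral_zero] at h1
  refine h1.congr' ?_
  filter_upwards [eventually_ge_atTop 1] with N hN
  exact (sum_div_eq_integral_floor (q N) hN L).symm

/-- A block sum is at most the sum over a larger window. -/
lemma sum_block_le {q : ℤ → ℝ} (hq : ∀ a, 0 ≤ q a) {M K : ℕ} {x : ℤ} (h₁ : -(M : ℤ) ≤ x)
    (h₂ : x + K ≤ M) :
    ∑ j ∈ Finset.range K, q (x + j) ≤ ∑ k ∈ Finset.range (2 * M), q (-(M : ℤ) + k) := by
  obtain ⟨i, hi⟩ := Int.eq_ofNat_of_zero_le (by omega : 0 ≤ x + M)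
  have hx : x = -(M : ℤ) + i := by omega
  have h3 : ∑ j ∈ Finset.range K, q (x + j) =
      ∑ k ∈ (Finset.range K).map (addLeftEmbedding i), q (-(M : ℤ) + k) := by
    rw [Finset.sum_map]
    refine Finset.sum_congr rfl fun j _ => ?_
    rw [hx, addLeftEmbedding_apply]
    push_cast
    rw [add_assoc]
  rw [h3]
  refine Finset.sum_le_sum_of_subset_of_nonneg ?_ fun k _ _ => hq _
  intro k hk
  simp only [Finset.mem_map, Finset.mem_range, addLeftEmbedding_apply] at hk ⊢
  obtain ⟨j, hj, rfl⟩ := hk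
  omega

end riemann

/-! ### Convergence of the one-particle function to the heat flow -/

section limit

variable {m : ℝ} {φ : ℝ → ℝ} {C a : ℝ}

lemma tendsto_floor_mul_div (y : ℝ) :
    Tendsto (fun N : ℕ => ((⌊(N : ℝ) * y⌋ : ℤ) : ℝ) / N) atTop (𝓝 y) := by
  have h1 : Tendsto (fun N : ℕ => y - 1 / (N : ℝ)) atTop (𝓝 y) := by
    simpa using tendsto_one_div_atTop_nhds_zero_nat.const_sub y
  refine tendsto_of_tendsto_of_tendsto_of_le_of_le' h1 tendsto_const_nhds ?_ ?_
  · filter_upwards [eventually_ge_atTop 1] with N hN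
    have hN0 : (0 : ℝ) < N := by exact_mod_cast hN
    have := Int.lt_floor_add_one ((N : ℝ) * y)
    rw [le_div_iff₀ hN0, sub_mul, one_div_mul_cancel hN0.ne']
    linarith
  · filter_upwards [eventually_ge_atTop 1] with N hN
    have hN0 : (0 : ℝ) < N := by exact_mod_cast hN
    have := Int.floor_le ((N : ℝ) * y)
    rw [div_le_iff₀ hN0]
    linarith

/-- Convergence at `⌊N y⌋` for fixed `y` is not uniform over sites, but its averages are: the sum of
`|r - φ|` over a block is at most the sum over the whole window, which is `o(N)`, while the block
has at least `ε N` sites and `φ` hardly varies on it. -/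
lemma eventually_blockAvg_close (hφc : Continuous φ) (ha : 0 ≤ a) (hC : 0 ≤ C)
    (hφ : ∀ y, |φ y| ≤ C * Real.exp (a * |y|)) {r : ℕ → ℤ → ℝ}
    (hr : ∀ N : ℕ, 1 ≤ N → ∀ x : ℤ, |r N x| ≤ C * Real.exp (a / N * |(x : ℝ)|))
    (hlim : ∀ y : ℝ, Tendsto (fun N : ℕ => r N ⌊(N : ℝ) * y⌋) atTop (𝓝 (φ y)))
    (R : ℕ) {θ : ℝ} (hθ : 0 < θ) : ∃ ε₀ : ℝ, 0 < ε₀ ∧ ∀ ε ∈ Set.Ioc 0 ε₀, ∀ᶠ N : ℕ in atTop, ∀ x : ℤ,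
      |(x : ℝ)| ≤ R * N → |blockAvg ⌈ε * N⌉₊ (r N) x - φ (x / N)| ≤ θ := by
  obtain ⟨ε₁, hε₁, huc⟩ := Metric.uniformContinuousOn_iff.1
    ((isCompact_Icc (a := -((R : ℝ) + 1)) (b := R + 1)).uniformContinuousOn_of_continuous
      hφc.continuousOn) (θ / 2) (by positivity)
  have hsum := tendsto_riemann_sum (q := fun N x => |r N x - φ (x / N)|) (L := R + 1)
    (M := 2 * (C * Real.exp (a * (R + 2)))) ?_ ?_
  · refine ⟨min ε₁ (1 : ℝ), lt_min hε₁ one_pos, fun ε (hε : ε ∈ Set.Ioc (0 : ℝ) _) => ?_⟩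
    have hε0 := hε.1
    have hεθ : 0 < ε * (θ / 2) := by positivity
    filter_upwards [hsum.eventually_le_const hεθ, eventually_ge_atTop 1] with N hN hN1 x hx
    have hN0 : (0 : ℝ) < N := by exact_mod_cast hN1
    set K := ⌈ε * N⌉₊ with hK
    have hK1 : ε * N ≤ K := Nat.le_ceil _
    have hK2 : (K : ℝ) < ε * N + 1 := Nat.ceil_lt_add_one (by positivity)
    have hK0 : (0 : ℝ) < K := lt_of_lt_of_le (by positivity) hK1
    have hKN : K ≤ N := by
      refine Nat.ceil_le.2 ?_
      have := hε.2.trans (min_le_right _ _)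
      nlinarith
    have hx' : |x| ≤ R * N := by exact_mod_cast hx
    rw [abs_le] at hx hx'
    have hblock := sum_block_le (q := fun x => |r N x - φ (x / N)|) (fun _ => abs_nonneg _)
      (M := (R + 1) * N) (K := K) (x := x) (by push_cast; nlinarith) (by push_cast; nlinarith)
    rw [← mul_assoc] at hblock
    rw [div_le_iff₀ hN0] at hN
    have hsum' := hblock.trans hN
    have h1 : blockAvg K (r N) x - φ (x / N) =
        (∑ j ∈ Finset.range K, (r N (x + j) - φ (x / N))) / K := by
      rw [blockAvg, Finset.sum_sub_distrib]
      simp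
      field_simp
    rw [h1, abs_div, abs_of_pos hK0, div_le_iff₀ hK0]
    refine (Finset.abs_sum_le_sum_abs _ _).trans ?_
    have h2 : ∀ j ∈ Finset.range K, |r N (x + j) - φ (x / N)| ≤
        |r N (x + j) - φ ((x + j : ℤ) / N)| + θ / 2 := fun j hj => by
      have hjK : (j : ℝ) + 1 ≤ K := by exact_mod_cast Finset.mem_range.1 hj
      have hj0 : (0 : ℝ) ≤ j := Nat.cast_nonneg j
      have hjN : (j : ℝ) ≤ N := by
        have : (K : ℝ) ≤ N := by exact_mod_cast hKN
        linarith
      have e1 : (((x + j : ℤ) : ℝ)) / N ∈ Set.Icc (-((R : ℝ) + 1)) (R + 1) := by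
        push_cast
        constructor
        · rw [le_div_iff₀ hN0]; nlinarith [hx.1]
        · rw [div_le_iff₀ hN0]; nlinarith [hx.2]
      have e2 : (x : ℝ) / N ∈ Set.Icc (-((R : ℝ) + 1)) (R + 1) := by
        constructor
        · rw [le_div_iff₀ hN0]; nlinarith [hx.1]
        · rw [div_le_iff₀ hN0]; nlinarith [hx.2]
      have e3 := huc _ e1 _ e2 (by
        rw [Real.dist_eq]
        push_cast
        rw [← sub_div, add_sub_cancel_left, abs_of_nonneg (by positivity), div_lt_iff₀ hN0]
        have : ε * N ≤ ε₁ * N := by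
          gcongr
          exact hε.2.trans (min_le_left _ _)
        linarith)
      rw [Real.dist_eq] at e3
      have := abs_add_le (r N (x + j) - φ ((x + j : ℤ) / N)) (φ ((x + j : ℤ) / N) - φ (x / N))
      rw [sub_add_sub_cancel] at this
      linarith
    refine (Finset.sum_le_sum h2).trans ?_
    rw [Finset.sum_add_distrib, Finset.sum_const, Finset.card_range, nsmul_eq_mul]
    have h3 : ε * (θ / 2) * N ≤ K * (θ / 2) := by nlinarith
    linarith
  · intro N hN x hx
    have hN0 : (0 : ℝ) < N := by exact_mod_cast hN
    have hxN : |(x : ℝ)| / N ≤ R + 2 := by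
      rw [div_le_iff₀ hN0]
      push_cast at hx
      linarith
    rw [abs_abs]
    refine (abs_sub _ _).trans ?_
    have e1 := hr N hN x
    have e2 := hφ (x / N)
    rw [abs_div, abs_of_pos hN0] at e2
    have e3 : a / N * |(x : ℝ)| = a * (|(x : ℝ)| / N) := by ring
    rw [e3] at e1
    have e4 : C * Real.exp (a * (|(x : ℝ)| / N)) ≤ C * Real.exp (a * (R + 2)) := by gcongr
    linarith
  · intro y
    have h1 := (hlim y).sub ((hφc.tendsto y).comp (tendsto_floor_mul_div y))
    simpa using h1.abs

/-- Comparison of block averages of the discrete heat equation with a smooth solution. -/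
lemma abs_blockAvg_sub_heatSol_le (hm : 0 < m) (hφc : Continuous φ) (ha : 0 ≤ a) (hC : 0 ≤ C)
    (hφ : ∀ y, |φ y| ≤ C * Real.exp (a * |y|)) {t ε θ B K₃ K₀ : ℝ} (hε : 0 < ε)
    (hB : 0 ≤ B) (hK₀0 : 0 ≤ K₀)
    (hK₃ : ∀ τ ∈ Set.Icc ε (ε + t), ∀ y, |heatD3 m φ τ y| ≤ K₃ * Real.exp (a * |y|))
    (hK₀ : ∀ τ ≤ ε + t, ∀ y, |heatSol m φ τ y| ≤ K₀ * Real.exp (a * |y|))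
    {N : ℕ} (hN : 1 ≤ N) (hK₃0 : 0 ≤ K₃) (hθ : 0 ≤ θ) (hθN : m * K₃ * Real.exp a ≤ θ * N)
    {u : ℝ → ℤ → ℝ}
    (hu : IsNonnegSolution (walkRate m) walkMove u)
    (hub : ∀ s ∈ Set.Icc 0 ((N : ℝ) ^ 2 * t), ∀ x : ℤ, u s x ≤ B * Real.exp (a / N * |(x : ℝ)|))
    {K : ℕ} (hKN : K ≤ N) (hK : 0 < K)
    (h0 : ∀ x : ℤ, |blockAvg K (u 0) x - heatSol m φ ε (x / N)| ≤
      θ * Real.exp ((a + 1) / N * |(x : ℝ)|)) (ht : 0 ≤ t) (x : ℤ) :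
    |blockAvg K (u (N ^ 2 * t)) x - heatSol m φ (ε + t) (x / N)| ≤
      θ * (1 + t) * (2 * Real.exp (m * (Real.cosh ((a + 1) / N) - 1) * (N ^ 2 * t)) *
        Real.cosh ((a + 1) / N * x)) := by
  have hN1 : (1 : ℝ) ≤ N := by exact_mod_cast hN
  have hN0 : (0 : ℝ) < N := by linarith
  have hK' : (0 : ℝ) < K := by exact_mod_cast hK
  set T := (N : ℝ) ^ 2 * t with hT
  have hT0 : 0 ≤ T := by positivity
  -- The Gaussian solution is followed from time `ε` on, where its third derivative is under
  -- control; microscopic time `s` is macroscopic time `s / N ^ 2`.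
  set τ : ℝ → ℝ := fun s => ε + s / N ^ 2 with hτ
  have hτmem : ∀ s ∈ Set.Icc 0 T, τ s ∈ Set.Icc ε (ε + t) := fun s hs => by
    have h1 : s / N ^ 2 ≤ t := by rw [div_le_iff₀ (by positivity), mul_comm]; exact hs.2
    have h2 : 0 ≤ s / N ^ 2 := div_nonneg hs.1 (by positivity)
    simp only [hτ]
    constructor <;> linarith
  set d : ℝ → ℤ → ℝ := fun s x => blockAvg K (u s) x - heatSol m φ (τ s) (x / N) with hd
  have hcont : ∀ x, ContinuousOn (fun s => d s x) (Set.Icc 0 T) := fun x => by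
    refine ContinuousOn.sub ?_ ?_
    · unfold blockAvg
      exact (continuousOn_finsetSum (Finset.range K) fun (j : ℕ) _ =>
        (hu.cont (x + j)).mono Set.Icc_subset_Ici_self).div_const _
    · exact ((continuous_heatSol hφc ha hC hφ).comp
        (by fun_prop : Continuous fun s : ℝ => (τ s, (x : ℝ) / N))).continuousOn
  have hder : ∀ (x : ℤ), ∀ s ∈ Set.Ioo 0 T, ∃ d', HasDerivAt (fun s => d s x) d' s ∧
      |d' - m / 2 * lap (d s) x| ≤ θ * ((N : ℝ) ^ 2)⁻¹ * Real.exp ((a + 1) / N * |(x : ℝ)|) := by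
    intro x s hs
    have hmem := hτmem s ⟨hs.1.le, hs.2.le⟩
    have hτ0 : 0 < τ s := hε.trans_le hmem.1
    have e1 : HasDerivAt (fun s => blockAvg K (u s) x)
        ((∑ j ∈ Finset.range K, jumpOp (walkRate m) walkMove (u s) (x + j)) / K) s := by
      unfold blockAvg
      exact (HasDerivAt.fun_sum (u := Finset.range K) fun (j : ℕ) _ => hu.deriv (x + j) s hs.1).div_const _
    have e2 : HasDerivAt τ (1 / (N : ℝ) ^ 2) s := by
      simpa [hτ] using ((hasDerivAt_id s).div_const ((N : ℝ) ^ 2)).const_add ε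
    have e3 := (hasDerivAt_heatSol_time hm hφc ha hC hφ hτ0 (x / N)).comp s e2
    refine ⟨_, e1.sub e3, ?_⟩
    -- With mesh `1 / N` the consistency error is of order `N ^ (-3)`; `hθN` turns it into `θ * N ^
    -- (-2)` per unit of microscopic time, hence `θ * t` in total, up to the weight.
    have e4 := abs_symm_diff_sub_le (f := heatSol m φ (τ s))
      (fun y => hasDerivAt_heatSol hm hφc ha hC hφ hτ0 y)
      (fun y => hasDerivAt_heatD1 hm hφc ha hC hφ hτ0 y)
      (fun y => hasDerivAt_heatD2 hm hφc ha hC hφ hτ0 y)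
      (M := K₃ * Real.exp a * Real.exp (a / N * |(x : ℝ)|)) (y := x / N) (h := 1 / N)
      (by positivity) (fun z hz => by
        refine (hK₃ _ hmem z).trans ?_
        rw [mul_assoc, ← Real.exp_add]
        have h1 : |z| ≤ |(x : ℝ)| / N + 1 := by
          have h2 := abs_add_le ((x : ℝ) / N) (z - x / N)
          rw [add_sub_cancel, abs_div, abs_of_pos hN0] at h2
          have h3 : 1 / (N : ℝ) ≤ 1 := by rw [div_le_one hN0]; exact hN1
          linarith
        have h4 : a * |z| ≤ a + a / N * |(x : ℝ)| := by
          refine (mul_le_mul_of_nonneg_left h1 ha).trans_eq (by ring)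
        gcongr)
    have e5 : lap (d s) x = (∑ j ∈ Finset.range K, lap (u s) (x + j)) / K -
        (heatSol m φ (τ s) (x / N + 1 / N) + heatSol m φ (τ s) (x / N - 1 / N) -
          2 * heatSol m φ (τ s) (x / N)) := by
      rw [← lap_blockAvg]
      simp only [lap, hd]
      push_cast
      rw [add_div, sub_div]
      ring
    have e6 : (∑ j ∈ Finset.range K, jumpOp (walkRate m) walkMove (u s) (x + j)) / K -
        m / 2 * heatD2 m φ (τ s) (x / N) * (1 / (N : ℝ) ^ 2) - m / 2 * lap (d s) x =
        m / 2 * (heatSol m φ (τ s) (x / N + 1 / N) + heatSol m φ (τ s) (x / N - 1 / N) -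
          2 * heatSol m φ (τ s) (x / N) - (1 / N) ^ 2 * heatD2 m φ (τ s) (x / N)) := by
      rw [e5]
      simp only [jumpOp_walk, ← Finset.mul_sum]
      ring
    rw [e6, abs_mul, abs_of_pos (by positivity : 0 < m / 2)]
    have e7 : Real.exp (a / N * |(x : ℝ)|) ≤ Real.exp ((a + 1) / N * |(x : ℝ)|) := by
      gcongr; linarith
    calc _ ≤ m / 2 * (2 * (K₃ * Real.exp a * Real.exp (a / N * |(x : ℝ)|)) * (1 / N) ^ 3) := by
          gcongr
      _ = (m * K₃ * Real.exp a) * ((N : ℝ) ^ 3)⁻¹ * Real.exp (a / N * |(x : ℝ)|) := by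
          rw [one_div, inv_pow]; ring
      _ ≤ (θ * N) * ((N : ℝ) ^ 3)⁻¹ * Real.exp ((a + 1) / N * |(x : ℝ)|) := by gcongr
      _ = _ := by field_simp
  have hblock : ∀ s ∈ Set.Icc 0 T, ∀ x : ℤ, |blockAvg K (u s) x| ≤
      B * Real.exp a * Real.exp (a / N * |(x : ℝ)|) := fun s hs x => by
    have := abs_blockAvg_sub_le hK (f := u s) (x := x) (c := 0)
      (L := B * Real.exp a * Real.exp (a / N * |(x : ℝ)|)) fun j hj => by
        rw [sub_zero, abs_of_nonneg (hu.nonneg s _)]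
        refine (hub s hs _).trans ?_
        rw [mul_assoc, ← Real.exp_add]
        have h1 : |((x + j : ℤ) : ℝ)| ≤ |(x : ℝ)| + N := by
          push_cast
          refine (abs_add_le _ _).trans ?_
          rw [abs_of_nonneg (Nat.cast_nonneg j : (0 : ℝ) ≤ j)]
          have : (j : ℝ) ≤ N := by exact_mod_cast (hj.le.trans hKN)
          linarith
        have h2 : a / N * |((x + j : ℤ) : ℝ)| ≤ a + a / N * |(x : ℝ)| := by
          refine (mul_le_mul_of_nonneg_left h1 (by positivity)).trans_eq ?_
          field_simp
          ring
        gcongr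
    simpa using this
  have hgrow : ∀ s ∈ Set.Icc 0 T, ∀ x, |d s x| ≤
      (B * Real.exp a + K₀) * Real.exp (a / N * |(x : ℝ)|) := fun s hs x => by
    refine (abs_sub _ _).trans ?_
    have h1 := hblock s hs x
    have h2 := hK₀ (τ s) (hτmem s hs).2 (x / N)
    rw [abs_div, abs_of_pos hN0, show a * (|(x : ℝ)| / N) = a / N * |(x : ℝ)| by ring] at h2
    linarith
  have h0' : ∀ x, |d 0 x| ≤ θ * Real.exp ((a + 1) / N * |(x : ℝ)|) := fun x => by
    have := h0 x
    simpa [hd, hτ] using this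
  have hTmem : T ∈ Set.Icc 0 T := ⟨hT0, le_rfl⟩
  have hA : 0 ≤ B * Real.exp a + K₀ := by positivity
  have hup := le_of_approx_subsolution hm hθ (ρ := ((N : ℝ) ^ 2)⁻¹) (by positivity)
    (β := (a + 1) / N) (by positivity) hA (b := a / N) (by positivity) hcont
    (fun x s hs => by
      obtain ⟨d', h1, h2⟩ := hder x s hs
      exact ⟨d', h1, by linarith [(abs_le.1 h2).2]⟩)
    (fun x => (le_abs_self _).trans (h0' x)) (fun s hs x => (le_abs_self _).trans (hgrow s hs x))
    hTmem x
  have hdn := le_of_approx_subsolution (d := fun s x => -d s x) hm hθ (ρ := ((N : ℝ) ^ 2)⁻¹)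
    (by positivity) (β := (a + 1) / N) (by positivity) hA (b := a / N) (by positivity)
    (fun x => (hcont x).neg)
    (fun x s hs => by
      obtain ⟨d', h1, h2⟩ := hder x s hs
      refine ⟨-d', h1.neg, ?_⟩
      have h3 : lap (fun x => -d s x) x = -lap (d s) x := by simp only [lap]; ring
      rw [h3]
      linarith [(abs_le.1 h2).1])
    (fun x => (neg_le_abs _).trans (h0' x)) (fun s hs x => (neg_le_abs _).trans (hgrow s hs x))
    hTmem x
  have hρT : ((N : ℝ) ^ 2)⁻¹ * T = t := by rw [hT]; field_simp
  have hτT : τ T = ε + t := by simp only [hτ, hT]; field_simp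
  rw [hρT] at hup hdn
  simp only [hd, hτT] at hup hdn
  rw [abs_le]
  constructor <;> linarith

end limit

section limit

variable {m : ℝ} {φ : ℝ → ℝ} {C a : ℝ}

/-- Far from the origin an exponential bound is dominated by a small multiple of a larger one. -/
lemma exp_tail_le {A θ X : ℝ} {R N : ℕ} (hN : 1 ≤ N) (hR : A ≤ θ * R)
    (hθ : 0 ≤ θ) (hX : R * N ≤ X) : A * Real.exp (a / N * X) ≤ θ * Real.exp ((a + 1) / N * X) := by
  have hN0 : (0 : ℝ) < N := by exact_mod_cast hN
  have h1 : (R : ℝ) ≤ X / N := by rw [le_div_iff₀ hN0]; exact hX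
  have h2 : (R : ℝ) ≤ Real.exp (X / N) := by
    linarith [Real.add_one_le_exp (X / N)]
  calc A * Real.exp (a / N * X) ≤ (θ * Real.exp (X / N)) * Real.exp (a / N * X) := by
        gcongr
        exact hR.trans (by gcongr)
    _ = _ := by rw [mul_assoc, ← Real.exp_add]; congr 2; ring

set_option maxHeartbeats 1000000 in
/-- Convergence of the discrete heat equation to the diffusion equation. -/
theorem tendsto_scaled_walk (hm : 0 < m) (hφc : Continuous φ) (ha : 0 ≤ a) (hC : 0 ≤ C)
    (hφ : ∀ y, |φ y| ≤ C * Real.exp (a * |y|)) {u : ℕ → ℝ → ℤ → ℝ}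
    (hu : ∀ N : ℕ, 1 ≤ N → IsNonnegSolution (walkRate m) walkMove (u N))
    (h0 : ∀ N : ℕ, 1 ≤ N → ∀ x : ℤ, u N 0 x ≤ C * Real.exp (a / N * |(x : ℝ)|))
    (hlim : ∀ y : ℝ, Tendsto (fun N : ℕ => u N 0 ⌊(N : ℝ) * y⌋) atTop (𝓝 (φ y)))
    {t : ℝ} (ht : 0 < t) (y : ℝ) :
    Tendsto (fun N : ℕ => u N (N ^ 2 * t) ⌊(N : ℝ) * y⌋) atTop (𝓝 (heatSol m φ t y)) := by
  rw [Metric.tendsto_nhds]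
  intro δ hδ
  obtain ⟨B, hB0, hB⟩ := exists_scaled_walk_bounds hm hC ha t
  obtain ⟨K₀, hK₀0, hK₀⟩ := exists_heatSol_growth hm ha hC hφ (t + 1)
  -- The value, at sites near `N y`, of the comparison function divided by `θ`; with `θ = δ / (4 D)`
  -- the comparison error is `δ / 4`.
  set D := (1 + t) * (2 * Real.exp (m * ((a + 1) ^ 2 / 2 * Real.exp ((a + 1) ^ 2 / 2)) * t) *
    Real.exp ((a + 1) * (|y| + 1))) with hD
  have hD0 : 0 < D := by positivity
  set θ := δ / (4 * D) with hθ
  have hθ0 : 0 < θ := by positivity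
  -- Beyond `R * N` the crude exponential bounds are below `θ` times a faster exponential, so
  -- closeness of the initial data is needed only inside this window.
  obtain ⟨R, hR⟩ := exists_nat_ge ((C * Real.exp a + K₀) / θ)
  rw [div_le_iff₀ hθ0, mul_comm (R : ℝ)] at hR
  have hcont := continuous_heatSol (m := m) hφc ha hC hφ
  obtain ⟨r₁, hr₁, huc⟩ := Metric.uniformContinuousOn_iff.1
    (((isCompact_Icc (a := (0 : ℝ)) (b := 1)).prod
      (isCompact_Icc (a := -(R : ℝ)) (b := R))).uniformContinuousOn_of_continuous
      hcont.continuousOn) (θ / 2) (by positivity)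
  obtain ⟨r₂, hr₂, hca⟩ := Metric.continuousAt_iff.1 (hcont.continuousAt (x := (t, y))) (δ / 4)
    (by positivity)
  -- Two separate small parameters: `ε'` is the macroscopic time shift of the Gaussian solution, `ε`
  -- below is the macroscopic block length, limited by the gradient bound `G / N` at time `N ^ 2 *
  -- t`.
  set ε' := min (r₁ / 2) (min (r₂ / 2) 1) with hε'
  have hε'0 : 0 < ε' := by positivity
  have hε'1 : ε' ≤ 1 := (min_le_right _ _).trans (min_le_right _ _)
  have hε'r₁ : ε' < r₁ := (min_le_left _ _).trans_lt (by linarith)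
  have hε'r₂ : ε' < r₂ := ((min_le_right _ _).trans (min_le_left _ _)).trans_lt (by linarith)
  obtain ⟨K₃, hK₃0, hK₃⟩ := exists_heatD3_le hm ha hC hφ hε'0 (t₂ := ε' + t) (by linarith)
  obtain ⟨ε₀, hε₀, hclose⟩ := eventually_blockAvg_close hφc ha hC hφ (r := fun N => u N 0)
    (fun N hN x => by rw [abs_of_nonneg ((hu N hN).nonneg 0 x)]; exact h0 N hN x) hlim R
    (half_pos hθ0)
  set G := B * Real.exp (a * (|y| + 2)) / √t with hG
  have hst : 0 < √t := Real.sqrt_pos.2 ht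
  have hG0 : 0 ≤ G := by positivity
  set ε := min ε₀ (min 1 (δ / (8 * (G + 1)))) with hε
  have hε0 : 0 < ε := by positivity
  have hε1 : ε ≤ 1 := (min_le_right _ _).trans (min_le_left _ _)
  have hεG : ε * (G + 1) ≤ δ / 8 := by
    have : ε ≤ δ / (8 * (G + 1)) := (min_le_right _ _).trans (min_le_right _ _)
    rw [le_div_iff₀ (by positivity)] at this
    linarith
  filter_upwards [hclose ε ⟨hε0, min_le_left _ _⟩, eventually_ge_atTop 1,
    (tendsto_natCast_atTop_atTop (R := ℝ)).eventually_ge_atTop (1 / ε),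
    (tendsto_natCast_atTop_atTop (R := ℝ)).eventually_ge_atTop (m * K₃ * Real.exp a / θ),
    Metric.tendsto_nhds.1 (tendsto_floor_mul_div y) r₂ hr₂] with N hNc hN hNε hNθ hNy
  have hN1 : (1 : ℝ) ≤ N := by exact_mod_cast hN
  have hN0 : (0 : ℝ) < N := by linarith
  rw [div_le_iff₀ hε0] at hNε
  rw [div_le_iff₀ hθ0, mul_comm (N : ℝ)] at hNθ
  set K := ⌈ε * N⌉₊ with hK
  have hK1 : (K : ℝ) < ε * N + 1 := Nat.ceil_lt_add_one (by positivity)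
  have hK0 : 0 < K := Nat.ceil_pos.2 (by positivity)
  have hKN : K ≤ N := Nat.ceil_le.2 (by nlinarith)
  have hKN' : (K : ℝ) ≤ N := by exact_mod_cast hKN
  have huN := hu N hN
  have hbd := hB N hN (u N) huN (h0 N hN)
  set x := ⌊(N : ℝ) * y⌋ with hx
  have hxN : |(x : ℝ)| ≤ N * |y| + 1 := by
    have e1 := Int.floor_le ((N : ℝ) * y)
    have e2 := Int.lt_floor_add_one ((N : ℝ) * y)
    have e3 : |(N : ℝ) * y| = N * |y| := by rw [abs_mul, abs_of_pos hN0]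
    have e4 := abs_le.1 e3.le
    rw [abs_le]
    constructor <;> linarith [e4.1, e4.2]
  have hT : (N : ℝ) ^ 2 * t ∈ Set.Icc 0 ((N : ℝ) ^ 2 * t) := ⟨by positivity, le_rfl⟩
  have hinit : ∀ x : ℤ, |blockAvg K (u N 0) x - heatSol m φ ε' (x / N)| ≤
      θ * Real.exp ((a + 1) / N * |(x : ℝ)|) := by
    intro x
    rcases le_total |(x : ℝ)| (R * N) with hxR | hxR
    · have e1 := hNc x hxR
      have hxR' : (x : ℝ) / N ∈ Set.Icc (-(R : ℝ)) R := by
        rw [abs_le] at hxR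
        constructor
        · rw [le_div_iff₀ hN0]; linarith [hxR.1]
        · rw [div_le_iff₀ hN0]; linarith [hxR.2]
      have e2 := huc (ε', (x : ℝ) / N) ⟨⟨hε'0.le, hε'1⟩, hxR'⟩ (0, (x : ℝ) / N)
        ⟨⟨le_rfl, zero_le_one⟩, hxR'⟩ (by
          rw [Prod.dist_eq, dist_self, max_lt_iff, Real.dist_eq, sub_zero, abs_of_pos hε'0]
          exact ⟨hε'r₁, hr₁⟩)
      simp only [heatSol_zero] at e2
      rw [Real.dist_eq, abs_sub_comm] at e2
      have e3 := abs_add_le (blockAvg K (u N 0) x - φ (x / N)) (φ (x / N) - heatSol m φ ε' (x / N))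
      rw [sub_add_sub_cancel] at e3
      have e4 : 1 ≤ Real.exp ((a + 1) / N * |(x : ℝ)|) := Real.one_le_exp (by positivity)
      nlinarith
    · refine le_trans ?_ (exp_tail_le hN hR hθ0.le hxR)
      refine (abs_sub _ _).trans ?_
      rw [add_mul]
      refine add_le_add ?_ ?_
      · have := abs_blockAvg_sub_le hK0 (f := u N 0) (x := x) (c := 0)
          (L := C * Real.exp a * Real.exp (a / N * |(x : ℝ)|)) fun j hj => by
            rw [sub_zero, abs_of_nonneg (huN.nonneg 0 _)]
            refine (h0 N hN _).trans ?_
            rw [mul_assoc, ← Real.exp_add]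
            have h1 : |((x + j : ℤ) : ℝ)| ≤ |(x : ℝ)| + N := by
              push_cast
              refine (abs_add_le _ _).trans ?_
              rw [abs_of_nonneg (Nat.cast_nonneg j : (0 : ℝ) ≤ j)]
              have : (j : ℝ) ≤ N := by exact_mod_cast (hj.le.trans hKN)
              linarith
            have h2 : a / N * |((x + j : ℤ) : ℝ)| ≤ a + a / N * |(x : ℝ)| := by
              refine (mul_le_mul_of_nonneg_left h1 (by positivity)).trans_eq ?_
              field_simp
              ring
            gcongr
        simpa using this
      · have e1 := hK₀ ε' (by linarith) (x / N)
        rwa [abs_div, abs_of_pos hN0, show a * (|(x : ℝ)| / N) = a / N * |(x : ℝ)| by ring] at e1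
  have hcmp := abs_blockAvg_sub_heatSol_le hm hφc ha hC hφ hε'0 hB0 hK₀0 hK₃
    (fun τ hτ => hK₀ τ (by linarith)) hN hK₃0 hθ0.le hNθ huN (fun s hs x => (hbd s hs x).1)
    hKN hK0 hinit ht.le x
  have hcmp' : |blockAvg K (u N (N ^ 2 * t)) x - heatSol m φ (ε' + t) (x / N)| ≤ δ / 4 := by
    refine hcmp.trans ?_
    have e1 := exp_cosh_scaled_le hm (a + 1) hN hT.1 le_rfl
    have e2 := cosh_le_exp_abs ((a + 1) / N * x)
    have e3 : |(a + 1) / N * x| ≤ (a + 1) * (|y| + 1) := by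
      rw [abs_mul, abs_of_nonneg (by positivity), div_mul_eq_mul_div, mul_div_assoc]
      gcongr
      rw [div_le_iff₀ hN0]
      linarith
    calc θ * (1 + t) * (2 * Real.exp (m * (Real.cosh ((a + 1) / N) - 1) * (N ^ 2 * t)) *
          Real.cosh ((a + 1) / N * x))
        ≤ θ * (1 + t) * (2 * Real.exp (m * ((a + 1) ^ 2 / 2 * Real.exp ((a + 1) ^ 2 / 2)) * t) *
          Real.exp ((a + 1) * (|y| + 1))) := by
          gcongr
          exact e2.trans (Real.exp_le_exp.2 e3)
      _ = θ * D := by rw [hD]; ring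
      _ = δ / 4 := by rw [hθ]; field_simp
  have hgrad : ∀ j < K, |u N (N ^ 2 * t) (x + j + 1) - u N (N ^ 2 * t) (x + j)| ≤ G / N := by
    intro j hj
    have e1 := (hbd _ hT (x + j)).2
    have hxj : |((x + j : ℤ) : ℝ)| ≤ N * (|y| + 2) := by
      push_cast
      refine (abs_add_le _ _).trans ?_
      rw [abs_of_nonneg (Nat.cast_nonneg j : (0 : ℝ) ≤ j)]
      have : (j : ℝ) ≤ N := by exact_mod_cast (hj.le.trans hKN)
      linarith
    have e2 : Real.exp (2 * (a / N) * |((x + j : ℤ) : ℝ)|) ≤ Real.exp (a * (|y| + 2)) ^ 2 := by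
      rw [← Real.exp_nat_mul]
      refine Real.exp_le_exp.2 ?_
      calc 2 * (a / N) * |((x + j : ℤ) : ℝ)| ≤ 2 * (a / N) * (N * (|y| + 2)) := by gcongr
        _ = _ := by push_cast; field_simp
    refine abs_le_of_sq_le_sq ?_ (by positivity)
    rw [hG, div_div, div_pow, le_div_iff₀ (by positivity), mul_pow, mul_pow, Real.sq_sqrt ht.le]
    have e3 := mul_le_mul_of_nonneg_left e2 (sq_nonneg B)
    have e4 := sq_nonneg (u N (N ^ 2 * t) (x + j + 1) - u N (N ^ 2 * t) (x + j))
    rw [add_mul, one_mul] at e1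
    rw [← mul_comm ((N : ℝ) ^ 2) t, mul_comm]
    linarith
  have hblock : |blockAvg K (u N (N ^ 2 * t)) x - u N (N ^ 2 * t) x| ≤ δ / 4 := by
    refine abs_blockAvg_sub_le hK0 fun j hj => ?_
    refine (abs_sub_le_of_gradient hgrad j hj.le).trans ?_
    -- Rounding up in `⌈ε N⌉` costs at most one site, and `1 ≤ ε N`.
    have e1 : (j : ℝ) ≤ 2 * (ε * N) := by
      have : (j : ℝ) ≤ K := by exact_mod_cast hj.le
      linarith
    calc (j : ℝ) * (G / N) ≤ 2 * (ε * N) * (G / N) := by gcongr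
      _ = 2 * (ε * G) := by field_simp
      _ ≤ δ / 4 := by nlinarith
  have hlast := hca (x := (ε' + t, (x : ℝ) / N)) (by
    rw [Prod.dist_eq, max_lt_iff, Real.dist_eq, add_sub_cancel_right, abs_of_pos hε'0]
    exact ⟨hε'r₂, hNy⟩)
  rw [Real.dist_eq] at hlast ⊢
  rw [abs_le] at hcmp' hblock
  rw [abs_lt] at hlast ⊢
  constructor <;> linarith [hcmp'.1, hcmp'.2, hblock.1, hblock.2, hlast.1, hlast.2]

end limit

/-! ### Propagation of chaos in the diffusive scaling -/

section propagation

variable {m C a : ℝ}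

lemma abs_floor_mul_div_le {N : ℕ} (hN : 1 ≤ N) (y : ℝ) :
    |((⌊(N : ℝ) * y⌋ : ℤ) : ℝ)| / N ≤ |y| + 1 := by
  have hN1 : (1 : ℝ) ≤ N := by exact_mod_cast hN
  have hN0 : (0 : ℝ) < N := by linarith
  have e1 := Int.floor_le ((N : ℝ) * y)
  have e2 := Int.lt_floor_add_one ((N : ℝ) * y)
  have e3 : |(N : ℝ) * y| = N * |y| := by rw [abs_mul, abs_of_pos hN0]
  have e4 := abs_le.1 e3.le
  rw [div_le_iff₀ hN0, abs_le]
  constructor <;> nlinarith [e4.1, e4.2]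

/-- Propagation of chaos: in the diffusive scaling the correlations factorize. -/
theorem tendsto_correlation_sub_prod (hm : 0 < m) (hC : 0 ≤ C) (ha : 0 ≤ a) {n : ℕ}
    {F : ℕ → ℝ → (Fin n → ℤ) → ℝ} {u : ℕ → ℝ → ℤ → ℝ}
    (hF : ∀ N : ℕ, 1 ≤ N → IsNonnegSolution (dualRate m) dualMove (F N))
    (hu : ∀ N : ℕ, 1 ≤ N → IsNonnegSolution (walkRate m) walkMove (u N))
    (hFu : ∀ N : ℕ, 1 ≤ N → ∀ x, F N 0 x = ∏ i, u N 0 (x i))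
    (h0 : ∀ N : ℕ, 1 ≤ N → ∀ x : ℤ, u N 0 x ≤ C * Real.exp (a / N * |(x : ℝ)|))
    {t : ℝ} (ht : 0 < t) (y : Fin n → ℝ) :
    Tendsto (fun N : ℕ => F N (N ^ 2 * t) (fun i => ⌊(N : ℝ) * y i⌋) -
      ∏ i, u N (N ^ 2 * t) ⌊(N : ℝ) * y i⌋) atTop (𝓝 0) := by
  obtain ⟨B, hB0, hB⟩ := exists_scaled_walk_bounds hm hC ha t
  obtain ⟨α, σ₀, K, hα, hσ₀, hK, hdec⟩ := exists_decorrelation hm n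
  set b := 2 * n * a with hb
  have hb0 : 0 ≤ b := by positivity
  set H := Real.exp (m * (b ^ 2 / 2 * Real.exp (b ^ 2 / 2)) * t) *
    ∑ j, Real.exp (b * (|y j| + 1)) with hH
  have hH0 : 0 ≤ H := by positivity
  rw [Metric.tendsto_nhds]
  intro δ hδ
  -- `κ` is fixed first, making the non-decaying part of the error at most `δ / 2`; afterwards the
  -- part with `κ⁻¹` vanishes as `N` grows. The `+ 1` avoids division by zero.
  set κ := δ / (2 * (K * B ^ n * H + 1)) with hκ
  have hκ0 : 0 < κ := by positivity
  have hκδ : K * B ^ n * (κ * H) ≤ δ / 2 := by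
    have h1 : κ * (K * B ^ n * H + 1) = δ / 2 := by rw [hκ]; field_simp
    nlinarith
  have hpow : Tendsto (fun N : ℕ => K * B ^ n * (κ⁻¹ * (σ₀ + (N : ℝ) ^ 2 * t) ^ (-α))) atTop
      (𝓝 0) := by
    have h1 : Tendsto (fun N : ℕ => σ₀ + (N : ℝ) ^ 2 * t) atTop atTop :=
      tendsto_atTop_add_const_left _ _ (((tendsto_pow_atTop two_ne_zero).comp
        tendsto_natCast_atTop_atTop).atTop_mul_const ht)
    have h2 := (((tendsto_rpow_neg_atTop hα).comp h1).const_mul κ⁻¹).const_mul (K * B ^ n)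
    simpa using h2
  filter_upwards [eventually_ge_atTop 1, hpow.eventually_lt_const (half_pos hδ)] with N hN hNδ
  have hN0 : (0 : ℝ) < N := by exact_mod_cast hN
  have hT : (0 : ℝ) ≤ N ^ 2 * t := by positivity
  have haN : 0 ≤ a / N := by positivity
  have hbd := hB N hN (u N) (hu N hN) (h0 N hN)
  have hlow := prod_le_correlation hm (hF N hN) (hu N hN) (hFu N hN) hT hB0 haN
    (fun s hs x => (hbd s hs x).1) (fun i => ⌊(N : ℝ) * y i⌋)
  have hup := hdec (F N) (u N) (hF N hN) (hu N hN) (hFu N hN) (N ^ 2 * t) B (a / N) κ hT hB0 haN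
    hκ0 (fun s hs x => (hbd s hs x).1) (fun s hs x => (hbd s hs x).2)
    (fun i => ⌊(N : ℝ) * y i⌋)
  have hbN : 2 * n * (a / N) = b / N := by rw [hb]; ring
  rw [hbN] at hup
  have e1 := exp_cosh_scaled_le hm b hN hT le_rfl
  have e2 : ∑ j, Real.cosh (b / N * (⌊(N : ℝ) * y j⌋ : ℤ)) ≤ ∑ j, Real.exp (b * (|y j| + 1)) := by
    refine Finset.sum_le_sum fun j _ => (cosh_le_exp_abs _).trans (Real.exp_le_exp.2 ?_)
    rw [abs_mul, abs_of_nonneg (by positivity), div_mul_eq_mul_div, mul_div_assoc]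
    exact mul_le_mul_of_nonneg_left (abs_floor_mul_div_le hN _) hb0
  have e3 : κ * Real.exp (m * (Real.cosh (b / N) - 1) * (N ^ 2 * t)) *
      ∑ j, Real.cosh (b / N * (⌊(N : ℝ) * y j⌋ : ℤ)) ≤ κ * H := by
    rw [mul_assoc, hH]
    exact mul_le_mul_of_nonneg_left (mul_le_mul e1 e2
      (Finset.sum_nonneg fun j _ => (Real.cosh_pos _).le) (Real.exp_pos _).le) hκ0.le
  have e4 := mul_le_mul_of_nonneg_left e3 (show 0 ≤ K * B ^ n by positivity)
  rw [mul_add] at hup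
  rw [Real.dist_eq, sub_zero, abs_of_nonneg (by linarith)]
  linarith

lemma measurable_duality (m : ℝ) (ξ : ℤ →₀ ℕ) : Measurable (duality m ξ) := by
  unfold duality
  exact Finset.measurable_prod _ fun i _ =>
    (measurable_from_top (f := dualitySingle m (ξ i))).comp (measurable_pi_apply i)

lemma IsSIP.integrable_duality_map {Ω : Type*} [MeasurableSpace Ω] {P : Measure Ω}
    [IsProbabilityMeasure P] {μ : Measure Config} {η : ℝ≥0 → Ω → Config} (hm : 0 < m)
    (h : IsSIP m μ P η) (t : ℝ≥0) {n : ℕ} (x : Fin n → ℤ) :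
    Integrable (duality m (pointConfig x)) (P.map (η t)) ∧
      ∫ ζ, duality m (pointConfig x) ζ ∂(P.map (η t)) = correlation m P η t x := by
  have hd := measurable_duality m (pointConfig x)
  constructor
  · rw [integrable_map_measure hd.aestronglyMeasurable (h.measurable t).aemeasurable]
    exact h.integrable_duality hm t x
  · rw [integral_map (h.measurable t).aemeasurable hd.aestronglyMeasurable, correlation,
      Real.toNNReal_coe]

/-- The one-point consequence of the correspondence of profiles. -/
lemma Corresponds.tendsto (hm : 0 < m) {l : ℕ → ℤ → ℝ} (hl : ∀ N i, l N i ∈ Set.Ico (0 : ℝ) 1)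
    {p : ℝ → ℝ} (h : Corresponds m l p) (y : ℝ) :
    Tendsto (fun N : ℕ => l N ⌊(N : ℝ) * y⌋ / (1 - l N ⌊(N : ℝ) * y⌋)) atTop
      (𝓝 (p y / (1 - p y))) := by
  have h1 := (h 1 fun _ => y).2
  simpa [(integral_duality_localGamma hm (hl _) _).2] using h1

end propagation

end InclusionProcess

/-! ### The main theorem -/

open InclusionProcess in
theorem mainTheorem3 (m : ℝ) (hm : 0 < m)
    (p : ℝ → ℝ) (hp : ContDiff ℝ (⊤ : ℕ∞) p) (hp01 : ∀ y, p y ∈ Set.Ico (0 : ℝ) 1)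
    (l : ℕ → ℤ → ℝ) (hl01 : ∀ N i, l N i ∈ Set.Ico (0 : ℝ) 1)
    (hgrowth : ∃ C a : ℝ, ∀ N : ℕ, 1 ≤ N → ∀ i : ℤ,
      l N i / (1 - l N i) ≤ C * Real.exp (a * (|(i : ℝ)| / N)))
    (hlp : Corresponds m l p)
    {Ω : ℕ → Type*} [∀ N, MeasurableSpace (Ω N)] (P : ∀ N, Measure (Ω N))
    [∀ N, IsProbabilityMeasure (P N)] (η : ∀ N, ℝ≥0 → Ω N → Config)
    (hη : ∀ N : ℕ, 1 ≤ N → IsSIP m (localGamma m (l N)) (P N) (η N)) :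
    (∃ ψ : ℝ → ℝ → ℝ, IsDiffusionSolution (m / 2) (fun y => p y / (1 - p y)) ψ) ∧
    ∀ ψ : ℝ → ℝ → ℝ, IsDiffusionSolution (m / 2) (fun y => p y / (1 - p y)) ψ →
      ∀ t : ℝ≥0, (∀ y, 0 ≤ ψ t y) ∧
        LocalEquilibrium m (fun N => (P N).map (η N ((N : ℝ≥0) ^ 2 * t)))
          (fun y => ψ t y / (1 + ψ t y)) := by
  obtain ⟨C, a, hC, ha, hg⟩ : ∃ C a : ℝ, 0 ≤ C ∧ 0 ≤ a ∧ ∀ N : ℕ, 1 ≤ N → ∀ i : ℤ,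
      l N i / (1 - l N i) ≤ C * Real.exp (a / N * |(i : ℝ)|) := by
    obtain ⟨C, a, hg⟩ := hgrowth
    refine ⟨|C|, |a|, abs_nonneg _, abs_nonneg _, fun N hN i => (hg N hN i).trans ?_⟩
    have h1 : a * (|(i : ℝ)| / N) ≤ |a| / N * |(i : ℝ)| := by
      rw [div_mul_eq_mul_div, ← mul_div_assoc]
      gcongr
      exact le_abs_self a
    exact (mul_le_mul_of_nonneg_right (le_abs_self C) (Real.exp_pos _).le).trans (by gcongr)
  set φ : ℝ → ℝ := fun y => p y / (1 - p y) with hφdef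
  have hφ0 : ∀ y, 0 ≤ φ y := fun y =>
    div_nonneg (hp01 y).1 (by linarith [(hp01 y).2])
  have hφc : Continuous φ :=
    hp.continuous.div (continuous_const.sub hp.continuous) fun y => by linarith [(hp01 y).2]
  have hlim : ∀ y, Tendsto (fun N : ℕ => l N ⌊(N : ℝ) * y⌋ / (1 - l N ⌊(N : ℝ) * y⌋)) atTop
      (𝓝 (φ y)) := fun y => hlp.tendsto hm hl01 y
  -- The macroscopic growth bound is the limit of the lattice bound at `⌊N y⌋`.
  have hφ : ∀ y, |φ y| ≤ C * Real.exp (a * |y|) := fun y => by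
    rw [abs_of_nonneg (hφ0 y)]
    have h1 : Tendsto (fun N : ℕ => C * Real.exp (a * |((⌊(N : ℝ) * y⌋ : ℤ) : ℝ) / N|)) atTop
        (𝓝 (C * Real.exp (a * |y|))) :=
      ((by fun_prop : Continuous fun z : ℝ => C * Real.exp (a * |z|)).tendsto y).comp
        (tendsto_floor_mul_div y)
    refine le_of_tendsto_of_tendsto (hlim y) h1 ?_
    filter_upwards [eventually_ge_atTop 1] with N hN
    refine (hg N hN _).trans_eq ?_
    rw [abs_div, Nat.abs_cast]
    ring_nf
  have hheat := isDiffusionSolution_heatSol hm hφc ha hC hφ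
  refine ⟨⟨_, hheat⟩, fun ψ hψ t => ?_⟩
  have hψ0 : ∀ y, 0 ≤ ψ t y := fun y => hψ.nonneg (by positivity) hφ0 t.coe_nonneg y
  refine ⟨hψ0, fun n y => ⟨?_, ?_⟩⟩
  · filter_upwards [eventually_ge_atTop 1] with N hN
    exact ((hη N hN).integrable_duality_map hm _ _).1
  have hprof : ∏ i, ψ t (y i) / (1 + ψ t (y i)) / (1 - ψ t (y i) / (1 + ψ t (y i))) =
      ∏ i, ψ t (y i) := Finset.prod_congr rfl fun i _ => by
    have : 1 + ψ t (y i) ≠ 0 := by linarith [hψ0 (y i)]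
    field_simp
    ring
  rw [hprof]
  have hint : (fun N : ℕ => correlation m (P N) (η N) ((N : ℝ) ^ 2 * t)
      (fun i => ⌊(N : ℝ) * y i⌋)) =ᶠ[atTop] fun N : ℕ =>
        ∫ ζ, duality m (pointConfig fun i => ⌊(N : ℝ) * y i⌋) ζ
          ∂((P N).map (η N ((N : ℝ≥0) ^ 2 * t))) := by
    filter_upwards [eventually_ge_atTop 1] with N hN
    rw [((hη N hN).integrable_duality_map hm _ _).2]
    push_cast
    rfl
  refine Tendsto.congr' hint ?_
  -- At time zero the correlations factorize exactly. The smoothing estimates need a positive time.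
  rcases eq_or_ne t 0 with ht | ht
  · subst ht
    have h1 : Tendsto (fun N : ℕ => ∏ i, l N ⌊(N : ℝ) * y i⌋ / (1 - l N ⌊(N : ℝ) * y i⌋)) atTop
        (𝓝 (∏ i, ψ 0 (y i))) := by
      refine tendsto_finsetProd _ fun i _ => ?_
      rw [hψ.initial]
      exact hlim (y i)
    refine h1.congr' ?_
    filter_upwards [eventually_ge_atTop 1] with N hN
    rw [NNReal.coe_zero, mul_zero, (hη N hN).correlation_zero hm (hl01 N)]
  · have ht' : (0 : ℝ) < t := NNReal.coe_pos.2 (pos_iff_ne_zero.2 ht)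
    set u : ℕ → ℝ → ℤ → ℝ := fun N s x =>
      correlation m (P N) (η N) s (fun _ : Fin 1 => x) with hudef
    have hu0 : ∀ N : ℕ, 1 ≤ N → ∀ x, u N 0 x = l N x / (1 - l N x) := fun N hN x => by
      simp [hudef, (hη N hN).correlation_zero hm (hl01 N)]
    have hu : ∀ N : ℕ, 1 ≤ N → IsNonnegSolution (walkRate m) walkMove (u N) := fun N hN =>
      ((hη N hN).isNonnegSolution hm 1).walk
    have hub : ∀ N : ℕ, 1 ≤ N → ∀ x : ℤ, u N 0 x ≤ C * Real.exp (a / N * |(x : ℝ)|) :=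
      fun N hN x => by rw [hu0 N hN]; exact hg N hN x
    have hulim : ∀ y : ℝ, Tendsto (fun N : ℕ => u N 0 ⌊(N : ℝ) * y⌋) atTop (𝓝 (φ y)) := fun y => by
      refine (hlim y).congr' ?_
      filter_upwards [eventually_ge_atTop 1] with N hN
      rw [hu0 N hN]
    have h1 := tendsto_correlation_sub_prod hm hC ha
      (F := fun N s x => correlation m (P N) (η N) s x) (u := u)
      (fun N hN => (hη N hN).isNonnegSolution hm n) hu
      (fun N hN x => by
        simp only [hu0 N hN]
        exact (hη N hN).correlation_zero hm (hl01 N) x) hub ht' y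
    have h2 : Tendsto (fun N : ℕ => ∏ i, u N (N ^ 2 * t) ⌊(N : ℝ) * y i⌋) atTop
        (𝓝 (∏ i, ψ t (y i))) := by
      refine tendsto_finsetProd _ fun i _ => ?_
      -- Uniqueness replaces the given solution by the Gaussian one, for which convergence of the
      -- lattice equation is known.
      rw [hψ.unique (by positivity) hheat t.coe_nonneg (y i)]
      exact tendsto_scaled_walk hm hφc ha hC hφ hu hub hulim ht' (y i)
    simpa using h1.add h2
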